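/- Let $\mathcal{O}=\mathbb{C}[[t]]$, $\mathcal{K}=\mathbb{C}((t))$, and let $\mathrm{Gr}=\mathrm{PGL}_3(\mathcal{K})/\mathrm{PGL}_3(\mathcal{O})$ be the affine Grassmannian, i.e. the vertex set of the affine building of $\mathrm{PGL}_3$. For $x,y\in\mathrm{Gr}$ and a dominant weight $\mu=a\omega_1+b\omega_2$ of $\mathrm{SL}(3)$ write $d(x,y)=\mu$ if some $g\in\mathrm{PGL}_3(\mathcal{K})$ satisfies $gx=t^0$ and $gy=t^\mu$, where $t^\mu$ is the class of $\mathrm{diag}(t^{a+b},t^b,1)$. Weights are partially ordered by $\mu\le\nu$ iff $\nu-\mu$ is a non-negative integer combination of simple roots. Let $\vec\lambda=(\lambda_1,\dots,\lambda_n)$ be a minuscule sequence, i.e. each $\lambda_k\in\{\omega_1,\omega_2\}$, and let $\vec\mu=(\mu_0,\dots,\mu_n)$ be a minuscule path of type $\vec\lambda$: a sequence of dominant weights with $\mu_0=\mu_n=0$ and $\mu_k-\mu_{k-1}\in W\lambda_k$ for every $k$, where $W$ is the Weyl group. The fan $A(\vec\lambda,\vec\mu)$ is the linkage whose vertices are those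 of a closed polygon $p=v_0,v_1,\dots,v_n=v_0$, with sides $v_{k-1}\to v_k$ labelled $\lambda_k$ and ribs $p\to v_k$ ($0<k<n$) labelled $\mu_k$. A diskoid of type $A_2$ is a contractible compact planar region $D$, triangulated, with a base point on its boundary and with oriented edges labelled by $\omega_1$ or $\omega_2$ (an edge labelled $\omega_1$ being the same as the reversed edge labelled $\omega_2$) so that the three edges of each triangle, oriented cyclically, carry the same label. Its boundary is the closed edge path $q_0,q_1,\dots,q_n=q_0$ (clockwise, starting at the base vertex, possibly visiting vertices repeatedly). The distance $d_D(p,q)$ is the minimum of the total weights of edge paths from $p$ to $q$. $D$ is $\mathrm{CAT}(0)$ (equivalently, its dual web is non-elliptic) if the total angle at every interior vertex is at least $2\pi$ when all triangles are equilateral, i.e. every interior vertex lies on at least six triangles. Let $D=D(\vec\lambda,\vec\mu)$ be the $\mathrm{CAT}(0)$ diskoid of type $A_2$ whose boundary edges $q_{k-1}\to q_k$ are labelled $\lambda_k$ and for which $d_D(q_0,q_k)=\mu_k$ for all $k$. For a based linkage $\Gamma$ (such as the fan or the $1$-skeleton of $D$), let $Q(\Gamma)$ be the set of maps $f$ from the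 vertices of $\Gamma$ to $\mathrm{Gr}$ that send the base vertex to $t^0$ and satisfy $d(f(u),f(v))=\nu$ for every edge $u\to v$ labelled $\nu$. Theorem. Every fan configuration $f\in Q(A(\vec\lambda,\vec\mu))$ extends uniquely to a diskoid configuration: there is exactly one $g\in Q(D(\vec\lambda,\vec\mu))$ with $g(q_k)=f(v_k)$ for all $k=0,\dots,n$. -/

import Mathlib

open scoped MatrixGroups LaurentSeries PowerSeries

namespace SL3

/-! ## Weights of `SL(3)` -/

/-- The weight lattice of `SL(3)` in fundamental coordinates: `(a, b)` stands for
`a ω₁ + b ω₂`, so that `a = ⟨α₁^∨, λ⟩` and `b = ⟨α₂^∨, λ⟩`. It is also the coweight lattice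
of the Langlands dual group `PGL(3)`. -/
abbrev Weight : Type := ℤ × ℤ

namespace Weight

/-- The simple root `α₁ = 2ω₁ - ω₂`. -/
def simpleRoot₁ : Weight := (2, -1)

/-- The simple root `α₂ = -ω₁ + 2ω₂`. -/
def simpleRoot₂ : Weight := (-1, 2)

/-- Reflection in `α₁`: `λ ↦ λ - ⟨α₁^∨, λ⟩ α₁`. -/
def reflection₁ : Equiv.Perm Weight :=
  Function.Involutive.toPerm (fun v => v - v.1 • simpleRoot₁) (by
    rintro ⟨a, b⟩
    simp only [simpleRoot₁, Prod.smul_mk, Prod.mk_sub_mk, smul_eq_mul, Prod.mk.injEq]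
    constructor <;> ring)

/-- Reflection in `α₂`: `λ ↦ λ - ⟨α₂^∨, λ⟩ α₂`. -/
def reflection₂ : Equiv.Perm Weight :=
  Function.Involutive.toPerm (fun v => v - v.2 • simpleRoot₂) (by
    rintro ⟨a, b⟩
    simp only [simpleRoot₂, Prod.smul_mk, Prod.mk_sub_mk, smul_eq_mul, Prod.mk.injEq]
    constructor <;> ring)

/-- The Weyl group `W`, acting on the weight lattice. -/
def weylGroup : Subgroup (Equiv.Perm Weight) :=
  Subgroup.closure {reflection₁, reflection₂}

/-- The dual weight: `V(λ)^* ≅ V(λ^*)` for dominant `λ`. -/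
def dual (v : Weight) : Weight := (v.2, v.1)

/-- The dominant Weyl chamber. -/
def IsDominant (v : Weight) : Prop := 0 ≤ v.1 ∧ 0 ≤ v.2

/-- The highest weights of the (two, nontrivial) minuscule representations of `SL(3)`: dominant
nonzero weights `v` with `⟨α^∨, v⟩ ≤ 1` for each of the positive coroots `α₁^∨`, `α₂^∨`,
`α₁^∨ + α₂^∨`. -/
def IsMinuscule (v : Weight) : Prop :=
  v.IsDominant ∧ v ≠ 0 ∧ v.1 ≤ 1 ∧ v.2 ≤ 1 ∧ v.1 + v.2 ≤ 1

/-- The partial order on weights: `v ≤ w` if and only if `w - v` is a non-negative integer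
combination of simple roots. (It is not the product order of `ℤ × ℤ`.) -/
def DomLE (v w : Weight) : Prop :=
  ∃ k l : ℕ, w - v = k • simpleRoot₁ + l • simpleRoot₂

end Weight

/-- `mu = (μ₀, …, μₙ)` is a minuscule path (ending at `0`) of type `lam = (λ₁, …, λₙ)`: all `μₖ`
are dominant, `μₖ - μₖ₋₁ ∈ W λₖ` for all `k`, and `μ₀ = μₙ = 0`.
(The entry `λₖ` is `lam` at the index `k - 1`.) -/
structure IsMinusculePath {n : ℕ} (lam : Fin n → Weight) (mu : Fin (n + 1) → Weight) : Prop where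
  dominant : ∀ k, (mu k).IsDominant
  step : ∀ k : Fin n, ∃ w ∈ Weight.weylGroup, mu k.succ - mu k.castSucc = w (lam k)
  start : mu 0 = 0
  finish : mu (Fin.last n) = 0

/-! ## The affine Grassmannian of `PGL(3)` -/

/-- `PGL₃(𝒪)` as a subgroup of `PGL₃(𝒦)`, where `𝒪 = ℂ⟦t⟧` and `𝒦 = ℂ((t))`. -/
noncomputable def integralPGL : Subgroup PGL(3, ℂ⸨X⸩) :=
  (Matrix.ProjGenLinGroup.map (algebraMap ℂ⟦X⟧ ℂ⸨X⸩) : PGL(3, ℂ⟦X⟧) →* PGL(3, ℂ⸨X⸩)).range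

/-- The affine Grassmannian `Gr = PGL₃(𝒦) / PGL₃(𝒪)`, which is the set of vertices of the affine
building of `PGL(3)`. -/
abbrev Gr : Type := PGL(3, ℂ⸨X⸩) ⧸ integralPGL

/-- The variable `t`, as a unit of `𝒦`. -/
noncomputable def unitT : ℂ⸨X⸩ˣ :=
  Units.mk0 (HahnSeries.single (1 : ℤ) (1 : ℂ)) (HahnSeries.single_ne_zero one_ne_zero)

/-- The point `t^v` of `PGL₃(𝒦)`: for `v = a ω₁ + b ω₂`, it is the class of the diagonal matrix
with entries `t^(a+b)`, `t^b`, `1`. -/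
noncomputable def tPowGroup (v : Weight) : PGL(3, ℂ⸨X⸩) :=
  Matrix.ProjGenLinGroup.mk
    (Units.map (Matrix.diagonalRingHom (Fin 3) ℂ⸨X⸩).toMonoidHom
      (MulEquiv.piUnits.symm ![unitT ^ (v.1 + v.2), unitT ^ v.2, 1]))

/-- The point `t^v` of the affine Grassmannian. -/
noncomputable def tPow (v : Weight) : Gr := (tPowGroup v : Gr)

/-- The weight-valued distance: `d(x, y) = v` means that `v` is dominant and some
`g ∈ PGL₃(𝒦)` satisfies `g x = t^0` and `g y = t^v`. -/
def GrDist (x y : Gr) (v : Weight) : Prop :=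
  v.IsDominant ∧ ∃ g : PGL(3, ℂ⸨X⸩), g • x = tPow 0 ∧ g • y = tPow v

/-! ## Linkages and configuration spaces -/

/-- A based linkage: an oriented graph with edges labelled by weights and a base vertex.
`Edge p v q` says that there is an edge from `p` to `q` with label `v`. -/
structure Linkage where
  /-- vertices -/
  V : Type
  /-- base vertex -/
  base : V
  /-- labelled oriented edges -/
  Edge : V → Weight → V → Prop

namespace Linkage

/-- `Γ.PathLength p q v`: some edge path from `p` to `q` has total length `v`. An edge labelled
`w` may be traversed backwards, as an edge labelled `w^*`. -/
inductive PathLength (Γ : Linkage) : Γ.V → Γ.V → Weight → Prop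
  | refl (p : Γ.V) : PathLength Γ p p 0
  | forward {p q r : Γ.V} {w v : Weight} :
      Γ.Edge p w q → PathLength Γ q r v → PathLength Γ p r (w + v)
  | backward {p q r : Γ.V} {w v : Weight} :
      Γ.Edge q w p → PathLength Γ q r v → PathLength Γ p r (w.dual + v)

/-- The distance in a linkage: `d(p, q) = v` means that `v` is the minimum of the total lengths of
all edge paths from `p` to `q`, in the partial order of weights. -/
def Dist (Γ : Linkage) (p q : Γ.V) (v : Weight) : Prop :=
  Γ.PathLength p q v ∧ ∀ w, Γ.PathLength p q w → v.DomLE w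

/-- The configuration space `Q(Γ) = Q(Γ, Gr)`: based maps from the vertices of `Γ` to `Gr` for
which `d(f p, f q)` equals the label of the edge from `p` to `q`, for every edge. -/
def configSpace (Γ : Linkage) : Set (Γ.V → Gr) :=
  {f | f Γ.base = tPow 0 ∧ ∀ p v q, Γ.Edge p v q → GrDist (f p) (f q) v}

end Linkage

/-! ## The fan -/

/-- The vertices of a closed polygon with `n` sides: `0, …, n` with `0` and `n` identified. -/
def PolygonVertex (n : ℕ) : Type :=
  Quot fun i j : Fin (n + 1) => i = 0 ∧ j = Fin.last n

/-- The `k`th vertex of a polygon. -/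
def PolygonVertex.mk {n : ℕ} (k : Fin (n + 1)) : PolygonVertex n := Quot.mk _ k

/-- The edges of the fan `A(λ, μ)`: the sides `λₖ` of the polygon and the ribs `μₖ` from
the base vertex to the `k`th vertex. -/
inductive FanEdge {n : ℕ} (lam : Fin n → Weight) (mu : Fin (n + 1) → Weight) :
    PolygonVertex n → Weight → PolygonVertex n → Prop
  | side (k : Fin n) :
      FanEdge lam mu (PolygonVertex.mk k.castSucc) (lam k) (PolygonVertex.mk k.succ)
  | rib (k : Fin (n + 1)) (h0 : k ≠ 0) (hn : k ≠ Fin.last n) :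
      FanEdge lam mu (PolygonVertex.mk 0) (mu k) (PolygonVertex.mk k)

/-- The linkage of the fan diskoid `A(λ, μ)`. -/
def fan {n : ℕ} (lam : Fin n → Weight) (mu : Fin (n + 1) → Weight) : Linkage where
  V := PolygonVertex n
  base := PolygonVertex.mk 0
  Edge := FanEdge lam mu

/-! ## Diskoids of type `A₂` -/

/-- A based, triangulated diskoid of type `A₂` with a boundary of `n` sides, given as a planar
combinatorial map.

A dart is an edge with a direction; `rev` reverses it; `next d` is the dart that follows `d` on the
boundary of the face on the left of `d`, so that the darts leaving a vertex are permuted cyclically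
by `next ∘ rev`. The faces are the cycles of `next`. One of them is the outer face, whose
darts `bdry 0, …, bdry (n - 1)` form the (clockwise) boundary polygon of the diskoid, starting at
the base vertex; all the others are triangles. The graph is connected, and the Euler characteristic
`#vertices - #edges + #triangles` of the diskoid is `1`, so that the map together with its
outer face is a sphere and the union of the vertices, the edges and the triangles is a contractible
region of the plane. (Cut vertices, bridges, trees, and a single point with `n = 0`, are allowed.)

Edges are labelled by minuscule weights, the label of a reversed edge being the dual weight.
A triangle is dual to a vertex of an `A₂` web: its three edges, oriented cyclically, are
labelled `(ω₁, ω₁, ω₁)` or `(ω₂, ω₂, ω₂)`, which are the triples of minuscule weights with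
a nonzero invariant. -/
structure Diskoid (n : ℕ) where
  /-- vertices -/
  V : Type
  /-- darts, that is, directed edges -/
  Dart : Type
  finite_vertices : Finite V
  finite_darts : Finite Dart
  /-- the base vertex -/
  base : V
  /-- the vertex where a dart starts -/
  src : Dart → V
  /-- reversal of darts -/
  rev : Dart → Dart
  rev_rev : ∀ d, rev (rev d) = d
  rev_ne : ∀ d, rev d ≠ d
  /-- the next dart around the face on the left -/
  next : Equiv.Perm Dart
  src_next : ∀ d, src (next d) = src (rev d)
  /-- the darts that leave a vertex form a single cycle of the rotation `next ∘ rev` -/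
  rotation : ∀ d e, src d = src e → ∃ k : ℕ, (fun x => next (rev x))^[k] d = e
  /-- the boundary polygon -/
  bdry : Fin n → Dart
  bdry_injective : Function.Injective bdry
  bdry_next : ∀ k, next (bdry k) = bdry (finRotate n k)
  bdry_base : ∀ k : Fin n, (k : ℕ) = 0 → src (bdry k) = base
  /-- the inner faces are triangles -/
  triangle : ∀ d, d ∉ Set.range bdry → next d ≠ d ∧ next (next (next d)) = d
  connected : ∀ v w, Relation.ReflTransGen (fun x y => ∃ d, src d = x ∧ src (rev d) = y) v w
  /-- `#vertices + #triangles = #edges + 1`; every edge has two darts, and every triangle has three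
  of the `Nat.card Dart - n` inner darts -/
  euler : Nat.card V + (Nat.card Dart - n) / 3 = Nat.card Dart / 2 + 1
  /-- the labels of the edges -/
  label : Dart → Weight
  label_minuscule : ∀ d, (label d).IsMinuscule
  label_rev : ∀ d, label (rev d) = (label d).dual
  label_triangle : ∀ d, d ∉ Set.range bdry → label (next d) = label d

namespace Diskoid

variable {n : ℕ} (D : Diskoid n)

/-- The vertices of the boundary polygon, in order; the last one is the base vertex again. -/
def bdryVertex (k : Fin (n + 1)) : D.V :=
  if h : (k : ℕ) < n then D.src (D.bdry ⟨k, h⟩) else D.base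

/-- The 1-skeleton `Γ(D)`, as a linkage. -/
def linkage : Linkage where
  V := D.V
  base := D.base
  Edge p v q := ∃ d, D.src d = p ∧ D.src (D.rev d) = q ∧ D.label d = v

/-- The total angle at a vertex: the triangles are equilateral, so that each triangle corner (one
for each inner dart leaving the vertex) contributes `π / 3`. -/
noncomputable def totalAngle (v : D.V) : ℝ :=
  Nat.card {d : D.Dart // d ∉ Set.range D.bdry ∧ D.src d = v} * (Real.pi / 3)

/-- The diskoid is `CAT(0)`, or its dual web is non-elliptic: all complete angles, that is, the
total angles at the interior vertices, are at least `2π`. -/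
def IsCAT0 : Prop := ∀ v, v ∉ Set.range D.bdryVertex → 2 * Real.pi ≤ D.totalAngle v

/-- `D` has the boundary polygon `P(λ)`. -/
def HasBoundary (lam : Fin n → Weight) : Prop := ∀ k, D.label (D.bdry k) = lam k

/-- The distances from the base vertex of `D` to its boundary vertices are `μ₀, …, μₙ`. -/
def HasDistances (mu : Fin (n + 1) → Weight) : Prop :=
  ∀ k, D.linkage.Dist D.base (D.bdryVertex k) (mu k)

end Diskoid

/-- `D = D(λ, μ)`: the `CAT(0)` diskoid of type `A₂` with boundary `λ` in which the distances
from the base vertex to the boundary vertices are given by `μ`. -/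
structure IsDiskoidOf {n : ℕ} (lam : Fin n → Weight) (mu : Fin (n + 1) → Weight)
    (D : Diskoid n) : Prop where
  cat0 : D.IsCAT0
  boundary : D.HasBoundary lam
  distances : D.HasDistances mu

end SL3

/-!
A fan configuration prescribes the boundary values of a diskoid configuration. Whether they extend
is decided by removing ears of the diskoid one at a time.

The affine Grassmannian enters through an asymmetric integral distance `grDist`, which is `a + 2 b`
from `x` to `y` and `2 a + b` from `y` to `x` when `d(x, y) = a ω₁ + b ω₂`. In terms of lattices,
`grDist` from `x` to `y` is at most `deg h - deg g` exactly when the lattice of `h` is contained in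
the lattice of `g`, where `g` and `h` represent `x` and `y` (`lattice_le_iff`). This makes the
triangle inequality evident, and it gives the local geometry of the building. If `x → y` is an edge
along which the distance to `p` rises by the maximal amount `2`, then, for suitable representatives,
the lattice of `x` is the sum of the lattices of `y` and `p`, so that `x` is determined by `y` and
`p`; dually for intersections (`lattice_eq_sup`, `lattice_eq_inf`). The existence of all distances
is the Cartan decomposition (`exists_grDist`). The facts that the rest of the argument needs are
collected in the structure `A2Space`, of which `grSpace` is the instance at hand.

On the side of the diskoid, the distances from and to the base vertex are integral heights `h` and
`k`. By Gauss–Bonnet the curvatures of all vertices add up to `6`, those of interior vertices are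
not positive, and a vertex that has a neighbour has curvature at most `3`. Hence, unless only the
base vertex is left, there is a boundary vertex `y` of positive curvature other than the base
vertex, and the full subcomplex near `y` is an ear: a bare edge, a triangle, or two triangles.
Removing `y` preserves the Euler characteristic, and the heights remain distances because geodesics
through `y` can be rerouted (`TriMap.IsRooted.erase`). The same peeling procedure shows that the two
heights change along edges as a weight-valued distance does (`TriMap.IsRooted.isStep`) and that
predecessors on geodesics are unique (`TriMap.IsRooted.parent_unique`).

When an ear at `y` is removed, the boundary values of the remaining subcomplex are determined by the
old ones (`TriMap.exists_reduction`). For a bare edge, the two boundary values at its other end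
are equal, both being the predecessor of the value at `y`. For a triangle, the new boundary edge
is an edge of the building. For two triangles, the new boundary vertex has exactly one
possible position; its uniqueness uses that a configuration does not increase distances from the
base point. Induction gives existence and uniqueness together (`TriMap.exists_unique_config`). The
intermediate subcomplexes may have pinched boundaries, so boundary values are attached to boundary
darts, not to boundary vertices.
-/

namespace SL3

/-! ### Triangulated planar maps -/

/-- A planar map with darts `E` and vertices `V`, in which some faces (those of the darts marked
`inner`) are triangles. `next` runs along the face on the left of a dart. An oriented edge is
recorded by `cost`: it is `2` for a dart that agrees with the orientation of its edge and `1` for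
one that runs against it; inner triangles are cyclically oriented. Vertices all of whose corners
are inner have at least six of them. -/
structure TriMap (V E : Type) where
  /-- the start of a dart -/
  src : E → V
  /-- the reversed dart -/
  rev : E → E
  /-- the next dart around the face on the left -/
  next : E → E
  /-- the darts whose left face is a triangle -/
  inner : E → Prop
  /-- the orientation of the edge, seen from the dart -/
  cost : E → ℤ
  rev_rev : ∀ d, rev (rev d) = d
  next_injective : Function.Injective next
  src_next : ∀ d, src (next d) = src (rev d)
  rotation : ∀ d e, src d = src e → ∃ k : ℕ, (fun x => next (rev x))^[k] d = e
  inner_next : ∀ d, inner d → inner (next d)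
  next_next_next : ∀ d, inner d → next (next (next d)) = d
  next_ne : ∀ d, inner d → next d ≠ d
  cost_cases : ∀ d, cost d = 1 ∨ cost d = 2
  cost_rev : ∀ d, cost (rev d) = 3 - cost d
  cost_next : ∀ d, inner d → cost (next d) = cost d
  six_le : ∀ v, (∃ d, src d = v) → (∀ d, src d = v → inner d) → 6 ≤ {d | src d = v}.ncard

namespace TriMap

variable {V E : Type} (M : TriMap V E)

/-- The end of a dart. -/
def tgt (d : E) : V := M.src (M.rev d)

/-- For an inner dart `d`, the other dart that leaves `src d` along the triangle left of `d`. -/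
def turn (d : E) : E := M.rev (M.next (M.next d))

/-- The map with all orientations reversed. -/
def dual : TriMap V E :=
  { M with
    cost := fun d => 3 - M.cost d
    cost_cases := fun d => by rcases M.cost_cases d with h | h <;> omega
    cost_rev := fun d => by rw [M.cost_rev]
    cost_next := fun d hd => by rw [M.cost_next d hd] }

@[simp] lemma dual_src : M.dual.src = M.src := rfl
@[simp] lemma dual_tgt : M.dual.tgt = M.tgt := rfl
@[simp] lemma dual_cost (d : E) : M.dual.cost d = 3 - M.cost d := rfl

lemma tgt_rev (d : E) : M.tgt (M.rev d) = M.src d := by rw [tgt, M.rev_rev]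

lemma src_next_eq_tgt (d : E) : M.src (M.next d) = M.tgt d := M.src_next d

lemma rev_injective : Function.Injective M.rev := fun a b h => by
  rw [← M.rev_rev a, h, M.rev_rev]

lemma rev_ne (d : E) : M.rev d ≠ d := fun h => by
  have h1 := M.cost_rev d
  rw [h] at h1
  omega

lemma src_turn {d : E} (hd : M.inner d) : M.src (M.turn d) = M.src d := by
  rw [turn, ← M.src_next, M.next_next_next d hd]

lemma tgt_turn (d : E) : M.tgt (M.turn d) = M.tgt (M.next d) := by
  rw [turn, tgt_rev, src_next_eq_tgt]

lemma next_rev_turn {d : E} (hd : M.inner d) : M.next (M.rev (M.turn d)) = d := by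
  rw [turn, M.rev_rev, M.next_next_next d hd]

lemma cost_turn {d : E} (hd : M.inner d) : M.cost (M.turn d) = 3 - M.cost d := by
  rw [turn, M.cost_rev, M.cost_next _ (M.inner_next d hd), M.cost_next d hd]

lemma turn_ne {d : E} (hd : M.inner d) : M.turn d ≠ d := fun h => by
  have h1 := M.cost_turn hd
  rw [h] at h1
  omega

lemma turn_ne_rev {d : E} (hd : M.inner d) : M.turn d ≠ M.rev d := fun h => by
  have h1 : M.next (M.next d) = d := M.rev_injective h
  have h2 := M.next_next_next d hd
  rw [h1] at h2
  exact M.next_ne d hd h2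

lemma turn_injOn {d e : E} (hd : M.inner d) (he : M.inner e) (h : M.turn d = M.turn e) :
    d = e := by
  rw [← M.next_rev_turn hd, h, M.next_rev_turn he]

/-! ### Full subcomplexes -/

/-- The dart lies in the full subcomplex on `S`. -/
def Alive (S : Finset V) (d : E) : Prop := M.src d ∈ S ∧ M.tgt d ∈ S

/-- The triangle left of the dart lies in the full subcomplex on `S`. -/
def InnerIn (S : Finset V) (d : E) : Prop :=
  M.inner d ∧ M.src d ∈ S ∧ M.tgt d ∈ S ∧ M.tgt (M.next d) ∈ S

variable {M} in
lemma InnerIn.alive {S : Finset V} {d : E} (h : M.InnerIn S d) : M.Alive S d := ⟨h.2.1, h.2.2.1⟩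

variable {M} in
lemma Alive.rev {S : Finset V} {d : E} (h : M.Alive S d) : M.Alive S (M.rev d) :=
  ⟨h.2, by rw [tgt_rev]; exact h.1⟩

lemma tgt_next_next {d : E} (hd : M.inner d) : M.tgt (M.next (M.next d)) = M.src d := by
  rw [← src_next_eq_tgt, M.next_next_next d hd]

variable {M} in
lemma InnerIn.next {S : Finset V} {d : E} (h : M.InnerIn S d) : M.InnerIn S (M.next d) :=
  ⟨M.inner_next d h.1, by rw [src_next_eq_tgt]; exact h.2.2.1, h.2.2.2, by
    rw [M.tgt_next_next h.1]; exact h.2.1⟩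

variable {M} in
lemma InnerIn.turn_alive {S : Finset V} {d : E} (h : M.InnerIn S d) : M.Alive S (M.turn d) :=
  ⟨by rw [M.src_turn h.1]; exact h.2.1, by rw [tgt_turn]; exact h.2.2.2⟩

variable {M} in
lemma alive_erase_iff [DecidableEq V] {S : Finset V} {y : V} {d : E} :
    M.Alive (S.erase y) d ↔ M.Alive S d ∧ M.src d ≠ y ∧ M.tgt d ≠ y := by
  simp only [Alive, Finset.mem_erase]; tauto

variable {M} in
lemma innerIn_erase_iff [DecidableEq V] {S : Finset V} {y : V} {d : E} :
    M.InnerIn (S.erase y) d ↔ M.InnerIn S d ∧ M.src d ≠ y ∧ M.tgt d ≠ y ∧ M.tgt (M.next d) ≠ y := by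
  simp only [InnerIn, Finset.mem_erase]; tauto

/-- A set of inner darts at `v` that is closed under `turn` contains all darts at `v`, because the
rotation at `v` is transitive. -/
lemma mem_of_turn_closed {v : V} {B : Finset E} (hne : B.Nonempty)
    (hB : ∀ d ∈ B, M.inner d ∧ M.src d = v ∧ M.turn d ∈ B) {e : E} (he : M.src e = v) : e ∈ B := by
  classical
  have himg : B.image M.turn = B := by
    apply Finset.eq_of_subset_of_card_le
    · intro x hx
      obtain ⟨d, hd, rfl⟩ := Finset.mem_image.1 hx
      exact (hB d hd).2.2
    · rw [Finset.card_image_of_injOn]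
      exact fun a ha b hb h => M.turn_injOn (hB a ha).1 (hB b hb).1 h
  have hstep : ∀ d ∈ B, M.next (M.rev d) ∈ B := by
    intro d hd
    rw [← himg] at hd
    obtain ⟨c, hc, rfl⟩ := Finset.mem_image.1 hd
    rw [M.next_rev_turn (hB c hc).1]
    exact hc
  obtain ⟨d, hd⟩ := hne
  obtain ⟨k, hk⟩ := M.rotation d e (by rw [(hB d hd).2.1, he])
  have : ∀ k : ℕ, (fun x => M.next (M.rev x))^[k] d ∈ B := by
    intro k
    induction k with
    | zero => exact hd
    | succ k ih => rw [Function.iterate_succ_apply']; exact hstep _ ih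
  rw [← hk]
  exact this k

variable [Fintype E]

open Classical in
/-- The darts of the subcomplex on `S` that leave `v`. -/
noncomputable def darts (S : Finset V) (v : V) : Finset E :=
  Finset.univ.filter fun d => M.Alive S d ∧ M.src d = v

open Classical in
/-- The triangle corners at `v` in the subcomplex on `S`. -/
noncomputable def corners (S : Finset V) (v : V) : Finset E :=
  Finset.univ.filter fun d => M.InnerIn S d ∧ M.src d = v

lemma mem_darts {S : Finset V} {v : V} {d : E} :
    d ∈ M.darts S v ↔ M.Alive S d ∧ M.src d = v := by simp [darts]

lemma mem_corners {S : Finset V} {v : V} {d : E} :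
    d ∈ M.corners S v ↔ M.InnerIn S d ∧ M.src d = v := by simp [corners]

lemma corners_subset (S : Finset V) (v : V) : M.corners S v ⊆ M.darts S v := fun d hd => by
  rw [mem_corners] at hd
  exact M.mem_darts.2 ⟨hd.1.alive, hd.2⟩

lemma turn_mem_darts {S : Finset V} {v : V} {d : E} (hd : d ∈ M.corners S v) :
    M.turn d ∈ M.darts S v := by
  rw [mem_corners] at hd
  exact M.mem_darts.2 ⟨hd.1.turn_alive, by rw [M.src_turn hd.1.1, hd.2]⟩

/-- The curvature at `v` of the subcomplex on `S`, in multiples of `π / 3`: `3` minus the number of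
triangles for an ordinary boundary vertex, and `6` minus the number of triangles for an interior
vertex. -/
noncomputable def curv (S : Finset V) (v : V) : ℤ :=
  6 - 3 * ((M.darts S v).card : ℤ) + 2 * ((M.corners S v).card : ℤ)

lemma dual_darts (S : Finset V) (v : V) : M.dual.darts S v = M.darts S v := rfl

/-- `v` is the tip of an ear of the subcomplex on `S`: the triangles at `v` form a fan of
at most two triangles, with darts `d`, `turn d`, `turn (turn d)`. -/
inductive IsEar (S : Finset V) (v : V) : Prop
  | leaf (e : E) (hd : M.darts S v = {e}) (hc : M.corners S v = ∅)
  | one (e : E) (hd : ∀ x, x ∈ M.darts S v ↔ x = e ∨ x = M.turn e)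
      (hc : ∀ x, x ∈ M.corners S v ↔ x = e)
  | two (e : E) (hd : ∀ x, x ∈ M.darts S v ↔ x = e ∨ x = M.turn e ∨ x = M.turn (M.turn e))
      (hc : ∀ x, x ∈ M.corners S v ↔ x = e ∨ x = M.turn e) (hne : M.turn (M.turn e) ≠ e)

lemma card_corners_lt {S : Finset V} {v : V} (h0 : (M.darts S v).Nonempty)
    (hpos : 0 < M.curv S v) : (M.corners S v).card < (M.darts S v).card := by
  rcases lt_or_eq_of_le (Finset.card_le_card (M.corners_subset S v)) with h | h
  · exact h
  exfalso
  have heq := Finset.eq_of_subset_of_card_le (M.corners_subset S v) h.ge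
  have hB : ∀ d ∈ M.darts S v, M.inner d ∧ M.src d = v ∧ M.turn d ∈ M.darts S v := by
    intro d hd
    rw [← heq] at hd
    exact ⟨(M.mem_corners.1 hd).1.1, (M.mem_corners.1 hd).2, M.turn_mem_darts hd⟩
  have hall : ∀ e, M.src e = v → e ∈ M.darts S v := fun e he => M.mem_of_turn_closed h0 hB he
  have hset : {d | M.src d = v} = (M.darts S v : Set E) := by
    ext d
    exact ⟨fun hd => hall d hd, fun hd => (M.mem_darts.1 hd).2⟩
  obtain ⟨d, hd⟩ := h0
  have h6 := M.six_le v ⟨d, (M.mem_darts.1 hd).2⟩ fun e he => (hB e (hall e he)).1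
  rw [hset, Set.ncard_coe_finset] at h6
  unfold curv at hpos
  omega

lemma curv_le_three {S : Finset V} {v : V} (h0 : (M.darts S v).Nonempty) : M.curv S v ≤ 3 := by
  by_contra h
  have := M.card_corners_lt h0 (by omega)
  unfold curv at h
  omega

/-- A vertex of positive curvature is the tip of an ear. -/
lemma isEar_of_curv_pos {S : Finset V} {v : V} (h0 : (M.darts S v).Nonempty)
    (hpos : 0 < M.curv S v) : M.IsEar S v := by
  classical
  have hlt := M.card_corners_lt h0 hpos
  have hcases : ((M.darts S v).card = 1 ∧ (M.corners S v).card = 0) ∨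
      ((M.darts S v).card = 2 ∧ (M.corners S v).card = 1) ∨
      ((M.darts S v).card = 3 ∧ (M.corners S v).card = 2) := by
    unfold curv at hpos
    omega
  have hclosed : ∀ B : Finset E, B.Nonempty → B ⊆ M.corners S v → (∀ d ∈ B, M.turn d ∈ B) →
      False := by
    intro B hne hsub hturn
    have : M.darts S v ⊆ B := fun e he =>
      M.mem_of_turn_closed hne (fun d hd => ⟨(M.mem_corners.1 (hsub hd)).1.1,
        (M.mem_corners.1 (hsub hd)).2, hturn d hd⟩) (M.mem_darts.1 he).2
    have := Finset.card_le_card (this.trans hsub)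
    omega
  rcases hcases with ⟨h1, h2⟩ | ⟨h1, h2⟩ | ⟨h1, h2⟩
  · obtain ⟨e, he⟩ := Finset.card_eq_one.1 h1
    exact .leaf e he (Finset.card_eq_zero.1 h2)
  · obtain ⟨e, he⟩ := Finset.card_eq_one.1 h2
    have hemem : e ∈ M.corners S v := by rw [he]; simp
    have hin := (M.mem_corners.1 hemem).1.1
    have hD : {e, M.turn e} = M.darts S v := by
      apply Finset.eq_of_subset_of_card_le
      · intro x hx
        rcases Finset.mem_insert.1 hx with rfl | hx
        · exact M.corners_subset S v hemem
        · rw [Finset.mem_singleton.1 hx]; exact M.turn_mem_darts hemem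
      · rw [Finset.card_pair (M.turn_ne hin).symm, h1]
    exact .one e (fun x => by rw [← hD]; simp) (fun x => by rw [he]; simp)
  · obtain ⟨a, b, hab, hC⟩ := Finset.card_eq_two.1 h2
    -- one of the two corners is followed by the other, which is followed by the third dart
    have key : ∀ a b : E, a ≠ b → M.corners S v = {a, b} → M.turn a = b → M.IsEar S v := by
      intro a b hab hC hturn
      have ha : a ∈ M.corners S v := by rw [hC]; simp
      have hb : b ∈ M.corners S v := by rw [hC]; simp
      have hia := (M.mem_corners.1 ha).1.1
      have hib := (M.mem_corners.1 hb).1.1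
      have hba : M.turn b ≠ a := by
        intro h
        refine hclosed {a, b} ⟨a, by simp⟩ hC.ge ?_
        intro d hd
        rcases Finset.mem_insert.1 hd with rfl | hd
        · simp [hturn]
        · rw [Finset.mem_singleton.1 hd]; simp [h]
      have hD : {a, b, M.turn b} = M.darts S v := by
        apply Finset.eq_of_subset_of_card_le
        · intro x hx
          simp only [Finset.mem_insert, Finset.mem_singleton] at hx
          rcases hx with rfl | rfl | rfl
          · exact M.corners_subset S v ha
          · exact M.corners_subset S v hb
          · exact M.turn_mem_darts hb
        · rw [h1, Finset.card_eq_three.2 ⟨a, b, M.turn b, hab, hba.symm, (M.turn_ne hib).symm, rfl⟩]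
      subst hturn
      exact .two a (fun x => by rw [← hD]; simp) (fun x => by rw [hC]; simp) hba
    by_cases h : M.turn a = b
    · exact key a b hab hC h
    · apply key b a hab.symm (by rw [hC, Finset.pair_comm])
      have ha : a ∈ M.corners S v := by rw [hC]; simp
      have hb : b ∈ M.corners S v := by rw [hC]; simp
      have hia := (M.mem_corners.1 ha).1.1
      have hib := (M.mem_corners.1 hb).1.1
      by_contra hba
      have hsub : {a, b, M.turn a, M.turn b} ⊆ M.darts S v := by
        intro x hx
        simp only [Finset.mem_insert, Finset.mem_singleton] at hx
        rcases hx with rfl | rfl | rfl | rfl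
        · exact M.corners_subset S v ha
        · exact M.corners_subset S v hb
        · exact M.turn_mem_darts ha
        · exact M.turn_mem_darts hb
      have h4 : ({a, b, M.turn a, M.turn b} : Finset E).card = 4 := by
        rw [Finset.card_insert_of_notMem, Finset.card_insert_of_notMem,
          Finset.card_pair fun h => hab (M.turn_injOn hia hib h)]
        · simp only [Finset.mem_insert, Finset.mem_singleton, not_or]
          exact ⟨Ne.symm h, (M.turn_ne hib).symm⟩
        · simp only [Finset.mem_insert, Finset.mem_singleton, not_or]
          exact ⟨hab, (M.turn_ne hia).symm, Ne.symm hba⟩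
      have := Finset.card_le_card hsub
      omega

variable {M}

lemma IsEar.card_eq {S : Finset V} {v : V} (h : M.IsEar S v) :
    (M.darts S v).card = (M.corners S v).card + 1 := by
  classical
  rcases h with ⟨e, hd, hc⟩ | ⟨e, hd, hc⟩ | ⟨e, hd, hc, hne⟩
  · rw [hd, hc]; simp
  · have hi : M.inner e := (M.mem_corners.1 ((hc e).2 rfl)).1.1
    have h1 : M.darts S v = {e, M.turn e} := by ext x; rw [hd]; simp
    have h2 : M.corners S v = {e} := by ext x; rw [hc]; simp
    rw [h1, h2, Finset.card_pair (M.turn_ne hi).symm]; simp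
  · have hi : M.inner e := (M.mem_corners.1 ((hc e).2 (.inl rfl))).1.1
    have hi' : M.inner (M.turn e) := (M.mem_corners.1 ((hc _).2 (.inr rfl))).1.1
    have h1 : M.darts S v = {e, M.turn e, M.turn (M.turn e)} := by ext x; rw [hd]; simp
    have h2 : M.corners S v = {e, M.turn e} := by ext x; rw [hc]; simp
    rw [h2, Finset.card_pair (M.turn_ne hi).symm, h1]
    exact Finset.card_eq_three.2 ⟨_, _, _, (M.turn_ne hi).symm, hne.symm, (M.turn_ne hi').symm, rfl⟩

/-- There are no loops at the tip of an ear, since the orientations of the darts of its fan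
alternate. -/
lemma IsEar.tgt_ne {S : Finset V} {v : V} (h : M.IsEar S v) {d : E} (hd : d ∈ M.darts S v) :
    M.tgt d ≠ v := by
  intro hv
  have hr : M.rev d ∈ M.darts S v := M.mem_darts.2 ⟨(M.mem_darts.1 hd).1.rev, hv⟩
  have hcr := M.cost_rev d
  have hne := M.rev_ne d
  rcases h with ⟨e, hD, hc⟩ | ⟨e, hD, hc⟩ | ⟨e, hD, hc, -⟩
  · rw [hD, Finset.mem_singleton] at hd hr
    exact hne (hr.trans hd.symm)
  · have hi : M.inner e := (M.mem_corners.1 ((hc e).2 rfl)).1.1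
    have h1 := M.turn_ne_rev hi
    rw [hD] at hd hr
    rcases hd with rfl | rfl <;> rcases hr with hr | hr
    · exact hne hr
    · exact h1 hr.symm
    · exact h1 (by rw [← hr, M.rev_rev, hr])
    · exact hne hr
  · have hi : M.inner e := (M.mem_corners.1 ((hc e).2 (.inl rfl))).1.1
    have hi' : M.inner (M.turn e) := (M.mem_corners.1 ((hc _).2 (.inr rfl))).1.1
    have h1 := M.turn_ne_rev hi
    have h2 := M.turn_ne_rev hi'
    have c1 := M.cost_turn hi
    have c2 := M.cost_turn hi'
    rw [hD] at hd hr
    rcases hd with rfl | rfl | rfl <;> rcases hr with hr | hr | hr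
    · exact hne hr
    · exact h1 hr.symm
    · rw [hr] at hcr; omega
    · exact h1 (by rw [← hr, M.rev_rev, hr])
    · exact hne hr
    · exact h2 hr.symm
    · rw [hr] at hcr; omega
    · exact h2 (by rw [← hr, M.rev_rev, hr])
    · exact hne hr

open Classical in
/-- Gauss–Bonnet, before the use of the Euler characteristic. -/
lemma sum_curv (S : Finset V) : ∑ v ∈ S, M.curv S v =
    6 * (S.card : ℤ) - 3 * ((Finset.univ.filter (M.Alive S)).card : ℤ) +
      2 * ((Finset.univ.filter (M.InnerIn S)).card : ℤ) := by
  have h1 : (Finset.univ.filter (M.Alive S)).card = ∑ v ∈ S, (M.darts S v).card := by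
    rw [Finset.card_eq_sum_card_fiberwise (f := M.src) (t := S)]
    · refine Finset.sum_congr rfl fun v _ => congrArg Finset.card ?_
      ext d; simp [mem_darts]
    · intro d hd
      exact (Finset.mem_filter.1 hd).2.1
  have h2 : (Finset.univ.filter (M.InnerIn S)).card = ∑ v ∈ S, (M.corners S v).card := by
    rw [Finset.card_eq_sum_card_fiberwise (f := M.src) (t := S)]
    · refine Finset.sum_congr rfl fun v _ => congrArg Finset.card ?_
      ext d; simp [mem_corners]
    · intro d hd
      exact (Finset.mem_filter.1 hd).2.2.1
  rw [h1, h2]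
  simp only [curv, Finset.sum_add_distrib, Finset.sum_sub_distrib, ← Finset.mul_sum,
    Finset.sum_const, Nat.cast_sum]
  ring

variable [DecidableEq V]

/-- Removing the tip of an ear does not change the Euler characteristic. -/
lemma IsEar.sum_curv_erase {S : Finset V} {y : V} (hy : y ∈ S) (h : M.IsEar S y) :
    ∑ v ∈ S.erase y, M.curv (S.erase y) v = ∑ v ∈ S, M.curv S v := by
  classical
  have hloop : ∀ d, M.Alive S d → M.src d = y → M.tgt d ≠ y := fun d h1 h2 =>
    h.tgt_ne (M.mem_darts.2 ⟨h1, h2⟩)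
  rw [sum_curv, sum_curv]
  have hA : Finset.univ.filter (M.Alive S) =
      Finset.univ.filter (M.Alive (S.erase y)) ∪ (M.darts S y ∪ (M.darts S y).image M.rev) := by
    ext d
    simp only [Finset.mem_filter, Finset.mem_univ, true_and, Finset.mem_union, Finset.mem_image,
      mem_darts, alive_erase_iff]
    constructor
    · intro hd
      by_cases h1 : M.src d = y
      · exact .inr (.inl ⟨hd, h1⟩)
      · by_cases h2 : M.tgt d = y
        · exact .inr (.inr ⟨M.rev d, ⟨hd.rev, h2⟩, M.rev_rev d⟩)
        · exact .inl ⟨hd, h1, h2⟩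
    · rintro (h1 | h1 | ⟨e, he, rfl⟩)
      · exact h1.1
      · exact h1.1
      · exact he.1.rev
  have hAc : (Finset.univ.filter (M.Alive S)).card =
      (Finset.univ.filter (M.Alive (S.erase y))).card + 2 * (M.darts S y).card := by
    rw [hA, Finset.card_union_of_disjoint, Finset.card_union_of_disjoint,
      Finset.card_image_of_injective _ M.rev_injective, two_mul]
    · rw [Finset.disjoint_left]
      intro d h1 h2
      obtain ⟨e, he, rfl⟩ := Finset.mem_image.1 h2
      exact h.tgt_ne he (M.mem_darts.1 h1).2
    · rw [Finset.disjoint_left]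
      intro d h1 h2
      rw [Finset.mem_filter, alive_erase_iff] at h1
      rcases Finset.mem_union.1 h2 with h2 | h2
      · exact h1.2.2.1 (M.mem_darts.1 h2).2
      · obtain ⟨e, he, rfl⟩ := Finset.mem_image.1 h2
        exact h1.2.2.2 (by rw [tgt_rev]; exact (M.mem_darts.1 he).2)
  -- a triangle with a vertex at `y` has exactly one corner at `y`
  have hC : Finset.univ.filter (M.InnerIn S) = Finset.univ.filter (M.InnerIn (S.erase y)) ∪
      (M.corners S y ∪ ((M.corners S y).image M.next ∪
        (M.corners S y).image (fun d => M.next (M.next d)))) := by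
    ext d
    simp only [Finset.mem_filter, Finset.mem_univ, true_and, Finset.mem_union, Finset.mem_image,
      mem_corners, innerIn_erase_iff]
    constructor
    · intro hd
      by_cases h1 : M.src d = y
      · exact .inr (.inl ⟨hd, h1⟩)
      · by_cases h2 : M.tgt d = y
        · exact .inr (.inr (.inr ⟨M.next d, ⟨hd.next, by rw [src_next_eq_tgt, h2]⟩,
            M.next_next_next d hd.1⟩))
        · by_cases h3 : M.tgt (M.next d) = y
          · exact .inr (.inr (.inl ⟨M.next (M.next d), ⟨hd.next.next, by
              rw [src_next_eq_tgt, h3]⟩, M.next_next_next d hd.1⟩))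
          · exact .inl ⟨hd, h1, h2, h3⟩
    · rintro (h1 | h1 | ⟨e, he, rfl⟩ | ⟨e, he, rfl⟩)
      · exact h1.1
      · exact h1.1
      · exact he.1.next
      · exact he.1.next.next
  have hCc : (Finset.univ.filter (M.InnerIn S)).card =
      (Finset.univ.filter (M.InnerIn (S.erase y))).card + 3 * (M.corners S y).card := by
    rw [hC, Finset.card_union_of_disjoint, Finset.card_union_of_disjoint,
      Finset.card_union_of_disjoint, Finset.card_image_of_injective _ M.next_injective,
      Finset.card_image_of_injective (f := fun d => M.next (M.next d)) _
        (M.next_injective.comp M.next_injective)]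
    · ring
    · rw [Finset.disjoint_left]
      intro d h1 h2
      obtain ⟨e, he, rfl⟩ := Finset.mem_image.1 h1
      obtain ⟨e', he', h3⟩ := Finset.mem_image.1 h2
      have h4 : M.next e' = e := M.next_injective h3
      have he' := M.mem_corners.1 he'
      apply hloop e' he'.1.alive he'.2
      rw [← src_next_eq_tgt, h4]
      exact (M.mem_corners.1 he).2
    · rw [Finset.disjoint_left]
      intro d h1 h2
      have h1 := M.mem_corners.1 h1
      rcases Finset.mem_union.1 h2 with h2 | h2
      · obtain ⟨e, he, rfl⟩ := Finset.mem_image.1 h2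
        have he := M.mem_corners.1 he
        exact hloop e he.1.alive he.2 (by rw [← src_next_eq_tgt]; exact h1.2)
      · obtain ⟨e, he, rfl⟩ := Finset.mem_image.1 h2
        have he := M.mem_corners.1 he
        exact hloop _ h1.1.alive h1.2 (by rw [M.tgt_next_next he.1.1]; exact he.2)
    · rw [Finset.disjoint_left]
      intro d h1 h2
      rw [Finset.mem_filter, innerIn_erase_iff] at h1
      simp only [Finset.mem_union, Finset.mem_image, mem_corners] at h2
      rcases h2 with h2 | ⟨e, he, rfl⟩ | ⟨e, he, rfl⟩
      · exact h1.2.2.1 h2.2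
      · exact h1.2.2.2.2 (by rw [M.tgt_next_next he.1.1]; exact he.2)
      · exact h1.2.2.2.1 (by rw [M.tgt_next_next he.1.1]; exact he.2)
  have := h.card_eq
  have hcard := Finset.card_erase_add_one hy
  rw [hAc, hCc, this]
  push_cast [← hcard]
  ring

end TriMap

namespace TriMap

/-! ### Heights on subcomplexes -/

variable {V E : Type} {M : TriMap V E} [Fintype E]

variable (M) in
/-- The subcomplex on `S` has Euler characteristic `1`, and `h` is a height on it with root `p`:
it behaves like the distance to `p`, in that the triangle inequality holds along every dart and
every other vertex has a neighbour through which its distance is attained. -/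
structure IsRooted (h : V → ℤ) (S : Finset V) (p : V) : Prop where
  mem : p ∈ S
  sum : ∑ v ∈ S, M.curv S v = 6
  le : ∀ d, M.Alive S d → h (M.src d) ≤ h (M.tgt d) + M.cost d
  parent : ∀ v ∈ S, v ≠ p → ∃ d ∈ M.darts S v, h v = h (M.tgt d) + M.cost d

/-- The third side of the triangle at a corner `c`. -/
lemma side_facts {h : V → ℤ} {S : Finset V} {p y : V} (H : M.IsRooted h S p) {c : E}
    (hc : c ∈ M.corners S y) :
    M.Alive S (M.next c) ∧ M.cost (M.next c) = M.cost c ∧ M.cost (M.turn c) = 3 - M.cost c ∧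
      h (M.tgt c) ≤ h (M.tgt (M.turn c)) + M.cost c ∧
      h (M.tgt (M.turn c)) ≤ h (M.tgt c) + (3 - M.cost c) := by
  have hc' := (M.mem_corners.1 hc).1
  have h1 := H.le _ hc'.next.alive
  have h2 := H.le _ hc'.next.alive.rev
  rw [src_next_eq_tgt, ← tgt_turn, M.cost_next c hc'.1] at h1
  rw [tgt_rev, src_next_eq_tgt, M.cost_rev, M.cost_next c hc'.1, ← tgt, ← tgt_turn] at h2
  exact ⟨hc'.next.alive, M.cost_next c hc'.1, M.cost_turn hc'.1, h1, h2⟩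

lemma src_of_mem {S : Finset V} {y : V} {d : E} (hd : d ∈ M.darts S y) : M.src d = y :=
  (M.mem_darts.1 hd).2

lemma IsRooted.le_of_mem {h : V → ℤ} {S : Finset V} {p y : V} (H : M.IsRooted h S p) {d : E}
    (hd : d ∈ M.darts S y) : h y ≤ h (M.tgt d) + M.cost d ∧ h (M.tgt d) ≤ h y + (3 - M.cost d) := by
  obtain ⟨hal, rfl⟩ := M.mem_darts.1 hd
  have h2 := H.le _ hal.rev
  rw [tgt_rev, M.cost_rev] at h2
  exact ⟨H.le d hal, h2⟩

lemma tgt_mem {S : Finset V} {y : V} {d : E} (hd : d ∈ M.darts S y) : M.tgt d ∈ S :=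
  (M.mem_darts.1 hd).1.2

lemma rev_mem_darts {S : Finset V} {y : V} {d : E} (hd : d ∈ M.darts S y) :
    M.rev d ∈ M.darts S (M.tgt d) :=
  M.mem_darts.2 ⟨(M.mem_darts.1 hd).1.rev, rfl⟩

/-- Heights are smallest at the root. -/
lemma IsRooted.lt {h : V → ℤ} {S : Finset V} {p : V} (H : M.IsRooted h S p) {v : V} (hv : v ∈ S)
    (hvp : v ≠ p) : h p < h v := by
  obtain ⟨m, hm, hmin⟩ := S.exists_min_image h ⟨p, H.mem⟩
  have hlow : ∀ v ∈ S, v ≠ p → ∃ u ∈ S, h u < h v := by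
    intro v hv hvp
    obtain ⟨d, hd, he⟩ := H.parent v hv hvp
    have := M.cost_cases d
    exact ⟨M.tgt d, tgt_mem hd, by omega⟩
  have hmp : m = p := by
    by_contra hne
    obtain ⟨u, hu, hlt⟩ := hlow m hm hne
    have := hmin u hu
    omega
  subst hmp
  obtain ⟨u, hu, hlt⟩ := hlow v hv hvp
  have := hmin u hu
  omega

lemma IsRooted.darts_nonempty {h : V → ℤ} {S : Finset V} {p : V} (H : M.IsRooted h S p) {v : V}
    (hv : v ∈ S) (hne : ∃ w ∈ S, w ≠ p) : (M.darts S v).Nonempty := by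
  classical
  by_cases hvp : v = p
  · subst hvp
    -- the lowest vertex other than the root is joined to the root
    obtain ⟨w, hw, hwv⟩ := hne
    obtain ⟨m, hm, hmin⟩ := (S.erase v).exists_min_image h ⟨w, Finset.mem_erase.2 ⟨hwv, hw⟩⟩
    rw [Finset.mem_erase] at hm
    obtain ⟨d, hd, he⟩ := H.parent m hm.2 hm.1
    have hc := M.cost_cases d
    have hdv : M.tgt d = v := by
      by_contra hdv
      have := hmin _ (Finset.mem_erase.2 ⟨hdv, tgt_mem hd⟩)
      omega
    exact ⟨M.rev d, hdv ▸ rev_mem_darts hd⟩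
  · obtain ⟨d, hd, -⟩ := H.parent v hv hvp
    exact ⟨d, hd⟩

lemma IsRooted.not_alive {h : V → ℤ} {S : Finset V} {p : V} (H : M.IsRooted h S p)
    (hne : ¬ ∃ w ∈ S, w ≠ p) (d : E) : ¬ M.Alive S d := by
  intro hd
  push Not at hne
  have hS : S = {p} := Finset.eq_singleton_iff_unique_mem.2 ⟨H.mem, hne⟩
  have hdp : d ∈ M.darts S p := M.mem_darts.2 ⟨hd, hne _ hd.1⟩
  have h1 := H.sum
  rw [hS, Finset.sum_singleton, ← hS] at h1
  have := M.curv_le_three ⟨d, hdp⟩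
  omega

lemma curv_le_one_of_two {S : Finset V} {y : V} {b : E}
    (hD : ∀ x, x ∈ M.darts S y ↔ x = b ∨ x = M.turn b ∨ x = M.turn (M.turn b))
    (hc : ∀ x, x ∈ M.corners S y ↔ x = b ∨ x = M.turn b) (hb : M.turn (M.turn b) ≠ b) :
    M.curv S y ≤ 1 := by
  classical
  have h1 := (IsEar.two b hD hc hb).card_eq
  have hi := (M.mem_corners.1 ((hc b).2 (.inl rfl))).1.1
  have h2 : M.corners S y = {b, M.turn b} := by ext x; rw [hc]; simp
  rw [h2, Finset.card_pair (M.turn_ne hi).symm] at h1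
  unfold curv
  rw [h1, h2, Finset.card_pair (M.turn_ne hi).symm]
  omega

/-- A vertex with two darts of the same orientation has curvature at most `1`. -/
lemma curv_le_one_of_cost_eq {S : Finset V} {y : V} {d d' : E} (hd : d ∈ M.darts S y)
    (hd' : d' ∈ M.darts S y) (hne : d ≠ d') (hcost : M.cost d = M.cost d') : M.curv S y ≤ 1 := by
  by_contra hcon
  rcases M.isEar_of_curv_pos ⟨d, hd⟩ (by omega) with ⟨b, hD, -⟩ | ⟨b, hD, hc⟩ | ⟨b, hD, hc, hb⟩
  · rw [hD, Finset.mem_singleton] at hd hd'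
    exact hne (hd.trans hd'.symm)
  · have hcb := M.cost_cases b
    have := M.cost_turn (M.mem_corners.1 ((hc b).2 rfl)).1.1
    rw [hD] at hd hd'
    rcases hd with rfl | rfl <;> rcases hd' with rfl | rfl
    · exact hne rfl
    · omega
    · omega
    · exact hne rfl
  · exact hcon (curv_le_one_of_two hD hc hb)

/-- If `x` has a neighbour that lies higher by `2` along a dart of cost `1`, then the parent of
`x` shares no triangle with that dart, which leaves no room for curvature more than `1`. -/
lemma IsRooted.curv_le_one {h : V → ℤ} {S : Finset V} {p x : V} (H : M.IsRooted h S p)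
    (hx : x ∈ S) (hxp : x ≠ p) {r : E} (hr : r ∈ M.darts S x) (hcost : M.cost r = 1)
    (hlow : h x + 2 = h (M.tgt r)) : M.curv S x ≤ 1 := by
  by_contra hcon
  obtain ⟨f, hf, hfh⟩ := H.parent x hx hxp
  have hne : f ≠ r := by rintro rfl; omega
  rcases M.isEar_of_curv_pos ⟨r, hr⟩ (by omega) with ⟨b, hD, -⟩ | ⟨b, hD, hc⟩ | ⟨b, hD, hc, hb⟩
  · rw [hD, Finset.mem_singleton] at hr hf
    exact hne (hf.trans hr.symm)
  · obtain ⟨-, h2, h3, h4, h5⟩ := side_facts H ((hc b).2 rfl)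
    rw [hD] at hr hf
    rcases hr with rfl | rfl <;> rcases hf with rfl | rfl
    · exact hne rfl
    · omega
    · omega
    · exact hne rfl
  · exact hcon (curv_le_one_of_two hD hc hb)

lemma IsEar.exists_eq_singleton {S : Finset V} {v : V} (hear : M.IsEar S v)
    (h3 : 3 ≤ M.curv S v) : ∃ e, M.darts S v = {e} := by
  have h1 := hear.card_eq
  unfold curv at h3
  exact Finset.card_eq_one.1 (by omega)

lemma IsEar.dual {S : Finset V} {v : V} (h : M.IsEar S v) : M.dual.IsEar S v := by
  rcases h with ⟨e, hD, hc⟩ | ⟨e, hD, hc⟩ | ⟨e, hD, hc, hne⟩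
  exacts [.leaf e hD hc, .one e hD hc, .two e hD hc hne]

variable [DecidableEq V]

lemma mem_darts_erase {S : Finset V} {y v : V} {d : E} :
    d ∈ M.darts (S.erase y) v ↔ d ∈ M.darts S v ∧ v ≠ y ∧ M.tgt d ≠ y := by
  simp only [mem_darts, alive_erase_iff]
  constructor
  · rintro ⟨⟨h1, h2, h3⟩, rfl⟩; exact ⟨⟨h1, rfl⟩, h2, h3⟩
  · rintro ⟨⟨h1, rfl⟩, h2, h3⟩; exact ⟨⟨h1, h2, h3⟩, rfl⟩

/-- A geodesic through the tip of an ear can be replaced by one along the remaining sides of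
the ear. -/
lemma IsRooted.reroute {h : V → ℤ} {S : Finset V} {p y : V} (H : M.IsRooted h S p)
    (hear : M.IsEar S y) {a e : E} (ha : a ∈ M.darts S y) (he : e ∈ M.darts S y)
    (heq : h (M.tgt a) = h (M.tgt e) + M.cost e + (3 - M.cost a)) :
    ∃ x ∈ M.darts (S.erase y) (M.tgt a), h (M.tgt a) = h (M.tgt x) + M.cost x := by
  have hmem : ∀ c ∈ M.corners S y, M.next c ∈ M.darts (S.erase y) (M.tgt c) ∧
      M.rev (M.next c) ∈ M.darts (S.erase y) (M.tgt (M.turn c)) := by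
    intro c hc
    have h1 := hear.tgt_ne (M.corners_subset _ _ hc)
    have h2 := hear.tgt_ne (M.turn_mem_darts hc)
    have h3 := (side_facts H hc).1
    rw [mem_darts_erase, mem_darts_erase, mem_darts, mem_darts, tgt_rev, src_next_eq_tgt,
      ← tgt_turn, ← tgt, tgt_turn]
    rw [tgt_turn] at h2
    exact ⟨⟨⟨h3, rfl⟩, h1, h2⟩, ⟨h3.rev, rfl⟩, h2, h1⟩
  have hfwd : ∀ c ∈ M.corners S y, h (M.tgt c) = h (M.tgt (M.turn c)) + M.cost c →
      ∃ x ∈ M.darts (S.erase y) (M.tgt c), h (M.tgt c) = h (M.tgt x) + M.cost x := by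
    intro c hc h1
    refine ⟨M.next c, (hmem c hc).1, ?_⟩
    rw [(side_facts H hc).2.1, ← tgt_turn, h1]
  have hbwd : ∀ c ∈ M.corners S y, h (M.tgt (M.turn c)) = h (M.tgt c) + (3 - M.cost c) →
      ∃ x ∈ M.darts (S.erase y) (M.tgt (M.turn c)),
        h (M.tgt (M.turn c)) = h (M.tgt x) + M.cost x := by
    intro c hc h1
    refine ⟨M.rev (M.next c), (hmem c hc).2, ?_⟩
    rw [M.cost_rev, (side_facts H hc).2.1, tgt_rev, src_next_eq_tgt, h1]
  rcases hear with ⟨b, hD, -⟩ | ⟨b, hD, hc⟩ | ⟨b, hD, hc, -⟩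
  · rw [hD, Finset.mem_singleton] at ha he
    subst ha he; omega
  · have hb := (hc b).2 rfl
    obtain ⟨-, h2, h3, h4, h5⟩ := side_facts H hb
    have hcb := M.cost_cases b
    rw [hD] at ha he
    rcases ha with rfl | rfl <;> rcases he with rfl | rfl
    · omega
    · exact hfwd _ hb (by omega)
    · exact hbwd _ hb (by omega)
    · omega
  · have hb := (hc b).2 (.inl rfl)
    have hb' := (hc _).2 (.inr rfl)
    obtain ⟨-, h2, h3, h4, h5⟩ := side_facts H hb
    obtain ⟨-, h2', h3', h4', h5'⟩ := side_facts H hb'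
    have hcb := M.cost_cases b
    rw [hD] at ha he
    rcases ha with rfl | rfl | rfl <;> rcases he with rfl | rfl | rfl
    · omega
    · exact hfwd _ hb (by omega)
    · exact hfwd _ hb (by omega)
    · exact hbwd _ hb (by omega)
    · omega
    · exact hfwd _ hb' (by omega)
    · exact hbwd _ hb' (by omega)
    · exact hbwd _ hb' (by omega)
    · omega

lemma IsRooted.erase {h : V → ℤ} {S : Finset V} {p y : V} (H : M.IsRooted h S p) (hy : y ∈ S)
    (hyp : y ≠ p) (hear : M.IsEar S y) : M.IsRooted h (S.erase y) p where
  mem := Finset.mem_erase.2 ⟨hyp.symm, H.mem⟩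
  sum := by rw [hear.sum_curv_erase hy, H.sum]
  le d hd := H.le d (alive_erase_iff.1 hd).1
  parent v hv hvp := by
    rw [Finset.mem_erase] at hv
    obtain ⟨d, hd, hdh⟩ := H.parent v hv.2 hvp
    by_cases hdy : M.tgt d = y
    · obtain ⟨e, he, heh⟩ := H.parent y hy hyp
      have hr : M.rev d ∈ M.darts S y := hdy ▸ rev_mem_darts hd
      have hv' : M.tgt (M.rev d) = v := by rw [tgt_rev, src_of_mem hd]
      have := H.reroute hear hr he (by
        rw [hv', M.cost_rev, hdh, hdy, heh]; ring)
      rwa [hv'] at this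
    · exact ⟨d, mem_darts_erase.2 ⟨hd, hv.1, hdy⟩, hdh⟩

/-- If the root is a leaf, then its neighbour can serve as the root of the rest. -/
lemma IsRooted.erase_root {h : V → ℤ} {S : Finset V} {p : V} (H : M.IsRooted h S p) {e : E}
    (hD : M.darts S p = {e}) (hear : M.IsEar S p) : M.IsRooted h (S.erase p) (M.tgt e) := by
  have he : e ∈ M.darts S p := by rw [hD]; simp
  refine ⟨Finset.mem_erase.2 ⟨hear.tgt_ne he, tgt_mem he⟩, by
    rw [hear.sum_curv_erase H.mem, H.sum], fun d hd => H.le d (alive_erase_iff.1 hd).1, ?_⟩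
  intro v hv hve
  rw [Finset.mem_erase] at hv
  obtain ⟨d, hd, hdh⟩ := H.parent v hv.2 hv.1
  refine ⟨d, mem_darts_erase.2 ⟨hd, hv.1, fun hdp => hve ?_⟩, hdh⟩
  have hr : M.rev d ∈ M.darts S p := hdp ▸ rev_mem_darts hd
  rw [hD, Finset.mem_singleton] at hr
  rw [← hr, tgt_rev, src_of_mem hd]

/-- By Gauss–Bonnet, any set of vertices of total curvature less than `6` misses an ear. -/
lemma IsRooted.exists_ear {h : V → ℤ} {S : Finset V} {p : V} (H : M.IsRooted h S p)
    (hne : ∃ w ∈ S, w ≠ p) {B : Finset V} (hB : B ⊆ S) (hsum : ∑ v ∈ B, M.curv S v < 6) :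
    ∃ y ∈ S, y ∉ B ∧ M.IsEar S y := by
  by_contra hcon
  have hle : ∑ v ∈ S \ B, M.curv S v ≤ 0 := by
    refine Finset.sum_nonpos fun v hv => ?_
    rw [Finset.mem_sdiff] at hv
    by_contra hpos
    exact hcon ⟨v, hv.1, hv.2, M.isEar_of_curv_pos (H.darts_nonempty hv.1 hne) (by omega)⟩
  have := Finset.sum_sdiff hB (f := M.curv S)
  rw [H.sum] at this
  omega

lemma IsRooted.exists_ear_ne {h : V → ℤ} {S : Finset V} {p : V} (H : M.IsRooted h S p)
    (hne : ∃ w ∈ S, w ≠ p) : ∃ y ∈ S, y ≠ p ∧ M.IsEar S y := by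
  obtain ⟨y, hy, hyB, hear⟩ := H.exists_ear hne (B := {p}) (by simpa using H.mem) (by
    rw [Finset.sum_singleton]
    have := M.curv_le_three (H.darts_nonempty H.mem hne)
    omega)
  exact ⟨y, hy, by simpa using hyB, hear⟩

/-- Heights change along a dart by the same amount modulo `3` on all rooted subcomplexes: this
follows by adding ears one at a time. -/
lemma IsRooted.dichotomy {h : V → ℤ} {S : Finset V} {p : V} (H : M.IsRooted h S p) :
    ∀ d, M.Alive S d →
      h (M.src d) = h (M.tgt d) + M.cost d ∨ h (M.src d) = h (M.tgt d) + M.cost d - 3 := by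
  induction hn : S.card generalizing S with
  | zero =>
    have := Finset.card_pos.2 ⟨p, H.mem⟩
    omega
  | succ n ih =>
  by_cases hne : ∃ w ∈ S, w ≠ p
  swap
  · exact fun d hd => absurd hd (H.not_alive hne d)
  obtain ⟨y, hy, hyp, hear⟩ := H.exists_ear_ne hne
  have IH := ih (H.erase hy hyp hear) (by rw [Finset.card_erase_of_mem hy, hn]; rfl)
  have hside : ∀ c ∈ M.corners S y, h (M.tgt c) = h (M.tgt (M.turn c)) + M.cost c ∨
      h (M.tgt c) = h (M.tgt (M.turn c)) + M.cost c - 3 := by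
    intro c hc
    have hs := side_facts H hc
    have := IH (M.next c) (alive_erase_iff.2 ⟨hs.1, by
      rw [src_next_eq_tgt]; exact hear.tgt_ne (M.corners_subset _ _ hc), by
      rw [← tgt_turn]; exact hear.tgt_ne (M.turn_mem_darts hc)⟩)
    rwa [src_next_eq_tgt, ← tgt_turn, hs.2.1] at this
  have hmain : ∀ d ∈ M.darts S y,
      h y = h (M.tgt d) + M.cost d ∨ h y = h (M.tgt d) + M.cost d - 3 := by
    intro d hd
    obtain ⟨e, he, heh⟩ := H.parent y hy hyp
    have hle := H.le_of_mem hd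
    rcases hear with ⟨b, hD, -⟩ | ⟨b, hD, hc⟩ | ⟨b, hD, hc, -⟩
    · rw [hD, Finset.mem_singleton] at hd he
      subst hd he; exact .inl heh
    · have hb := (hc b).2 rfl
      obtain ⟨-, h2, h3, h4, h5⟩ := side_facts H hb
      have hcb := M.cost_cases b
      have hs := hside b hb
      rw [hD] at hd he
      rcases hd with rfl | rfl <;> rcases he with rfl | rfl <;> omega
    · have hb := (hc b).2 (.inl rfl)
      have hb' := (hc _).2 (.inr rfl)
      obtain ⟨-, h2, h3, h4, h5⟩ := side_facts H hb
      obtain ⟨-, h2', h3', h4', h5'⟩ := side_facts H hb'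
      have hcb := M.cost_cases b
      have hs := hside b hb
      have hs' := hside _ hb'
      rw [hD] at hd he
      rcases hd with rfl | rfl | rfl <;> rcases he with rfl | rfl | rfl <;> omega
  intro d hd
  by_cases h1 : M.src d = y
  · rw [h1]; exact hmain d (M.mem_darts.2 ⟨hd, h1⟩)
  · by_cases h2 : M.tgt d = y
    · have := hmain (M.rev d) (M.mem_darts.2 ⟨hd.rev, h2⟩)
      rw [tgt_rev, M.cost_rev] at this
      rw [h2]
      omega
    · exact IH d (alive_erase_iff.2 ⟨hd, h1, h2⟩)

lemma mem_darts_erase_of {S : Finset V} {w v : V} {d : E} (hd : d ∈ M.darts S v) (h1 : w ≠ v)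
    (h2 : w ≠ M.tgt d) : d ∈ M.darts (S.erase w) v :=
  mem_darts_erase.2 ⟨hd, h1.symm, h2.symm⟩

/-- Uniqueness of predecessors: at most one edge of a given type at `y` starts a geodesic
from `y` to the root. In a minimal counterexample all positive curvature is at `y`, at the two
predecessors, and at the root, which is not enough for Gauss–Bonnet. -/
theorem IsRooted.parent_unique {h : V → ℤ} {S : Finset V} {p y : V} (H : M.IsRooted h S p)
    {d d' : E} (hd : d ∈ M.darts S y) (hd' : d' ∈ M.darts S y) (hcd : M.cost d = 2)
    (hcd' : M.cost d' = 2) (hh : h y = h (M.tgt d) + 2) (hh' : h y = h (M.tgt d') + 2) :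
    d = d' := by
  by_contra hne
  induction hn : S.card generalizing S p with
  | zero =>
    have := Finset.card_pos.2 ⟨p, H.mem⟩
    omega
  | succ n ih =>
  have hyS : y ∈ S := src_of_mem hd ▸ (M.mem_darts.1 hd).1.1
  have hyp : y ≠ p := by
    rintro rfl
    have := H.lt (tgt_mem hd) (fun h1 => by rw [h1] at hh; omega)
    omega
  have hxy : M.tgt d ≠ y := fun h1 => by rw [h1] at hh; omega
  have hzy : M.tgt d' ≠ y := fun h1 => by rw [h1] at hh'; omega
  have hS : ∃ w ∈ S, w ≠ p := ⟨y, hyS, hyp⟩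
  -- all vertices other than these four can be peeled off
  have hpeel : ∀ B ⊆ S, p ∈ B → y ∈ B → M.tgt d ∈ B → M.tgt d' ∈ B → ∑ v ∈ B, M.curv S v < 6 →
      False := by
    intro B hB hp hy hx hz hsum
    obtain ⟨w, hw, hwB, hear⟩ := H.exists_ear hS hB hsum
    have h1 : ∀ b ∈ B, w ≠ b := fun b hb h => hwB (h ▸ hb)
    exact ih (H.erase hw (h1 p hp) hear) (mem_darts_erase_of hd (h1 y hy) (h1 _ hx))
      (mem_darts_erase_of hd' (h1 y hy) (h1 _ hz)) (by
        rw [Finset.card_erase_of_mem hw, hn]; rfl)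
  have hcy : M.curv S y ≤ 1 := curv_le_one_of_cost_eq hd hd' hne (hcd.trans hcd'.symm)
  have hp3 : M.curv S p ≤ 3 := M.curv_le_three (H.darts_nonempty H.mem hS)
  have hrd := rev_mem_darts hd
  have hrd' := rev_mem_darts hd'
  have hcr : M.cost (M.rev d) = 1 := by rw [M.cost_rev, hcd]; rfl
  have hcr' : M.cost (M.rev d') = 1 := by rw [M.cost_rev, hcd']; rfl
  have hx1 : M.tgt d ≠ p → M.curv S (M.tgt d) ≤ 1 := fun hxp =>
    H.curv_le_one (tgt_mem hd) hxp hrd hcr (by rw [tgt_rev, src_of_mem hd, hh])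
  have hz1 : M.tgt d' ≠ p → M.curv S (M.tgt d') ≤ 1 := fun hxp =>
    H.curv_le_one (tgt_mem hd') hxp hrd' hcr' (by rw [tgt_rev, src_of_mem hd', hh'])
  by_cases hxz : M.tgt d = M.tgt d'
  · by_cases hxp : M.tgt d = p
    · have hp1 : M.curv S p ≤ 1 := by
        rw [← hxp]
        refine curv_le_one_of_cost_eq hrd (hxz ▸ hrd') (fun h1 => hne (M.rev_injective h1)) ?_
        rw [hcr, hcr']
      refine hpeel {y, p} ?_ (by simp) (by simp) (by simp [hxp]) (by simp [← hxz, hxp]) ?_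
      · intro v hv
        simp only [Finset.mem_insert, Finset.mem_singleton] at hv
        rcases hv with rfl | rfl
        exacts [hyS, H.mem]
      · rw [Finset.sum_pair hyp]; omega
    · refine hpeel {M.tgt d, y, p} ?_ (by simp) (by simp) (by simp) (by simp [← hxz]) ?_
      · intro v hv
        simp only [Finset.mem_insert, Finset.mem_singleton] at hv
        rcases hv with rfl | rfl | rfl
        exacts [tgt_mem hd, hyS, H.mem]
      · rw [Finset.sum_insert (by simp [hxy, hxp]), Finset.sum_pair hyp]
        have := hx1 hxp
        omega
  · have hxp : M.tgt d ≠ p := fun hxp => by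
      have := H.lt (tgt_mem hd') (fun h1 => hxz (hxp.trans h1.symm))
      rw [← hxp] at this
      omega
    have hzp : M.tgt d' ≠ p := fun hzp => by
      have := H.lt (tgt_mem hd) hxp
      rw [← hzp] at this
      omega
    have h1 := hx1 hxp
    have h2 := hz1 hzp
    by_cases hp2 : M.curv S p ≤ 2
    · refine hpeel {M.tgt d', M.tgt d, y, p} ?_ (by simp) (by simp) (by simp) (by simp) ?_
      · intro v hv
        simp only [Finset.mem_insert, Finset.mem_singleton] at hv
        rcases hv with rfl | rfl | rfl | rfl
        exacts [tgt_mem hd', tgt_mem hd, hyS, H.mem]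
      · rw [Finset.sum_insert (by simp [hzy, hzp, Ne.symm hxz]),
          Finset.sum_insert (by simp [hxy, hxp]), Finset.sum_pair hyp]
        omega
    · -- the root is a leaf, and can be moved to its neighbour
      have hear := M.isEar_of_curv_pos (H.darts_nonempty H.mem hS) (by omega)
      obtain ⟨e, he⟩ := hear.exists_eq_singleton (by omega)
      exact ih (H.erase_root he hear) (mem_darts_erase_of hd hyp.symm hxp.symm)
        (mem_darts_erase_of hd' hyp.symm hzp.symm) (by
          rw [Finset.card_erase_of_mem H.mem, hn]; rfl)

/-- The two heights, of distances from and to the root, cannot both drop maximally and in opposite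
directions along an edge. -/
theorem IsRooted.not_opposite {h k : V → ℤ} {S : Finset V} {p : V} (H : M.IsRooted h S p)
    (K : M.dual.IsRooted k S p) {d : E} (hd : M.Alive S d) (hcd : M.cost d = 2)
    (hh : h (M.src d) = h (M.tgt d) + 2) (hk : k (M.tgt d) = k (M.src d) + 2) : False := by
  induction hn : S.card generalizing S with
  | zero =>
    have := Finset.card_pos.2 ⟨p, H.mem⟩
    omega
  | succ n ih =>
  have hup : M.src d ≠ p := by
    intro h1
    have := H.lt hd.2 (fun h2 => by rw [h1, h2] at hh; omega)
    rw [h1] at hh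
    omega
  have hvp : M.tgt d ≠ p := by
    intro h1
    have := K.lt hd.1 hup
    rw [h1] at hk
    omega
  have huv : M.src d ≠ M.tgt d := fun h1 => by rw [h1] at hh; omega
  have hS : ∃ w ∈ S, w ≠ p := ⟨_, hd.1, hup⟩
  have hp3 : M.curv S p ≤ 3 := M.curv_le_three (H.darts_nonempty H.mem hS)
  have hu : M.curv S (M.src d) ≤ 1 :=
    K.curv_le_one (r := d) hd.1 hup (M.mem_darts.2 ⟨hd, rfl⟩) (by rw [dual_cost, hcd]; rfl)
      (by rw [dual_tgt, hk])
  have hv : M.curv S (M.tgt d) ≤ 1 :=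
    H.curv_le_one (r := M.rev d) hd.2 hvp (M.mem_darts.2 ⟨hd.rev, rfl⟩)
      (by rw [M.cost_rev, hcd]; rfl) (by rw [tgt_rev, hh])
  obtain ⟨w, hw, hwB, hear⟩ := H.exists_ear hS (B := {M.src d, M.tgt d, p}) (by
    intro v hv
    simp only [Finset.mem_insert, Finset.mem_singleton] at hv
    rcases hv with rfl | rfl | rfl
    exacts [hd.1, hd.2, H.mem]) (by
    rw [Finset.sum_insert (by simp [huv, hup]), Finset.sum_pair hvp]; omega)
  simp only [Finset.mem_insert, Finset.mem_singleton, not_or] at hwB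
  exact ih (H.erase hw hwB.2.2 hear) (K.erase hw hwB.2.2 hear.dual)
    (alive_erase_iff.2 ⟨hd, Ne.symm hwB.1, Ne.symm hwB.2.1⟩) (by
      rw [Finset.card_erase_of_mem hw, hn]; rfl)

end TriMap

/-! ### Spaces with the local geometry of an affine building of type `A₂` -/

/-- A set of points with an asymmetric integral distance that has those properties of
the vertices of an affine building of type `A₂` on which the filling of diskoids depends. If `x` and
`y` are at the weight-valued distance `a ω₁ + b ω₂`, then `dist x y = a + 2 b` and
`dist y x = 2 a + b`; there is an oriented edge from `x` to `y` when `dist x y = 1`. -/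
structure A2Space (P : Type) where
  /-- the asymmetric distance -/
  dist : P → P → ℤ
  dist_self : ∀ x, dist x x = 0
  eq_of_dist_eq_zero : ∀ x y, dist x y = 0 → x = y
  triangle : ∀ x y z, dist x z ≤ dist x y + dist y z
  dist_symm_of_edge : ∀ x y, dist x y = 1 → dist y x = 2
  dist_le_two_mul : ∀ x y, dist y x ≤ 2 * dist x y
  pred_unique : ∀ p x x' y, dist x y = 1 → dist x' y = 1 → dist x p + 2 = dist y p →
    dist x' p + 2 = dist y p → x = x'
  succ_unique : ∀ p y z z', dist y z = 1 → dist y z' = 1 → dist p z + 2 = dist p y →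
    dist p z' + 2 = dist p y → z = z'
  triangle_of_pred : ∀ p x y z, dist x y = 1 → dist y z = 1 → dist x p + 2 = dist y p →
    dist z p + 1 = dist y p → dist z x = 1
  triangle_of_succ : ∀ p x y z, dist x y = 1 → dist y z = 1 → dist p z + 2 = dist p y →
    dist p x + 1 = dist p y → dist z x = 1
  exists_pred : ∀ p y, 3 ≤ 2 * dist y p - dist p y →
    ∃ x, dist x y = 1 ∧ dist p x + 1 = dist p y ∧ dist x p + 2 = dist y p
  exists_succ : ∀ p y, 3 ≤ 2 * dist p y - dist y p →
    ∃ z, dist y z = 1 ∧ dist p z + 2 = dist p y ∧ dist z p + 1 = dist y p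

/-- The difference `(a, b)` of the distances from and to a base point along a dart: along an
oriented edge it is in the Weyl group orbit of `ω₁`, in the coordinates `a + 2 b`, `2 a + b`. -/
def IsStep (c a b : ℤ) : Prop :=
  (c = 2 ∧ ((a = 1 ∧ b = 2) ∨ (a = 1 ∧ b = -1) ∨ (a = -2 ∧ b = -1))) ∨
  (c = 1 ∧ ((a = -1 ∧ b = -2) ∨ (a = -1 ∧ b = 1) ∨ (a = 2 ∧ b = 1)))

lemma IsStep.dual {c a b : ℤ} (h : IsStep c a b) : IsStep (3 - c) b a := by
  unfold IsStep at *; omega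

namespace A2Space

variable {P : Type} (A : A2Space P)

/-- The space with all edges reversed. -/
def dual : A2Space P where
  dist x y := A.dist y x
  dist_self := A.dist_self
  eq_of_dist_eq_zero x y h := (A.eq_of_dist_eq_zero y x h).symm
  triangle x y z := by have := A.triangle z y x; omega
  dist_symm_of_edge x y := A.dist_symm_of_edge y x
  dist_le_two_mul x y := A.dist_le_two_mul y x
  pred_unique p x x' y h1 h2 h3 h4 := A.succ_unique p y x x' h1 h2 h3 h4
  succ_unique p y z z' h1 h2 h3 h4 := A.pred_unique p z z' y h1 h2 h3 h4
  triangle_of_pred p x y z h1 h2 h3 h4 := A.triangle_of_succ p z y x h2 h1 h3 h4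
  triangle_of_succ p x y z h1 h2 h3 h4 := A.triangle_of_pred p z y x h2 h1 h3 h4
  exists_pred p y h := by
    obtain ⟨z, h1, h2, h3⟩ := A.exists_succ p y h
    exact ⟨z, h1, h3, h2⟩
  exists_succ p y h := by
    obtain ⟨z, h1, h2, h3⟩ := A.exists_pred p y h
    exact ⟨z, h1, h3, h2⟩

@[simp] lemma dual_dist (x y : P) : A.dual.dist x y = A.dist y x := rfl

/-- There is an edge between `x` and `y`, oriented from `x` to `y` if `c = 2` and from `y` to
`x` if `c = 1`. -/
def Rel (c : ℤ) (x y : P) : Prop := if c = 2 then A.dist x y = 1 else A.dist y x = 1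

lemma rel_one {x y : P} : A.Rel 1 x y ↔ A.dist y x = 1 := by simp [Rel]
lemma rel_two {x y : P} : A.Rel 2 x y ↔ A.dist x y = 1 := by simp [Rel]

variable {A}

lemma Rel.flip {c : ℤ} (hc : c = 1 ∨ c = 2) {x y : P} (h : A.Rel c x y) : A.Rel (3 - c) y x := by
  rcases hc with rfl | rfl <;> simpa [Rel] using h

lemma Rel.dual {c : ℤ} (hc : c = 1 ∨ c = 2) {x y : P} (h : A.Rel c x y) :
    A.dual.Rel (3 - c) x y := by
  rcases hc with rfl | rfl <;> simpa [Rel] using h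

lemma Rel.of_dual {c : ℤ} (hc : c = 1 ∨ c = 2) {x y : P} (h : A.dual.Rel (3 - c) x y) :
    A.Rel c x y := by
  rcases hc with rfl | rfl <;> simpa [Rel] using h

lemma Rel.dist_eq {c : ℤ} (hc : c = 1 ∨ c = 2) {x y : P} (h : A.Rel c x y) : A.dist y x = c := by
  rcases hc with rfl | rfl
  · exact A.rel_one.1 h
  · exact A.dist_symm_of_edge _ _ (A.rel_two.1 h)

lemma eq_of_leaf {c : ℤ} (hc : c = 1 ∨ c = 2) {p y u u' : P} (hu : A.Rel c y u)
    (hu' : A.Rel c y u') (h1 : A.dist p y = A.dist p u + c)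
    (h2 : A.dist y p = A.dist u p + (3 - c)) (h1' : A.dist p y = A.dist p u' + c)
    (h2' : A.dist y p = A.dist u' p + (3 - c)) : u = u' := by
  rcases hc with rfl | rfl
  · rw [rel_one] at hu hu'
    exact A.pred_unique p u u' y hu hu' (by omega) (by omega)
  · rw [rel_two] at hu hu'
    exact A.succ_unique p y u u' hu hu' (by omega) (by omega)

/-- If the boundary path `z, y, x` runs around a triangle that is an ear of a diskoid, then the
third side of the triangle exists. -/
lemma rel_of_ear {c : ℤ} (hc : c = 1 ∨ c = 2) {p x y z : P} (hz : A.Rel c y z)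
    (hx : A.Rel (3 - c) y x)
    (sz : IsStep c (A.dist p z - A.dist p y) (A.dist z p - A.dist y p))
    (sx : IsStep (3 - c) (A.dist p x - A.dist p y) (A.dist x p - A.dist y p))
    (s : IsStep c (A.dist p x - A.dist p z) (A.dist x p - A.dist z p))
    (h1 : A.dist p y = A.dist p z + c ∨ A.dist p y = A.dist p x + (3 - c))
    (h2 : A.dist y p = A.dist z p + (3 - c) ∨ A.dist y p = A.dist x p + c) : A.Rel c z x := by
  rcases hc with rfl | rfl
  · rw [rel_one] at hz ⊢
    replace hx := A.rel_two.1 hx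
    have : (A.dist z p + 2 = A.dist y p ∧ A.dist x p + 1 = A.dist y p) ∨
        (A.dist p x + 2 = A.dist p y ∧ A.dist p z + 1 = A.dist p y) := by
      unfold IsStep at *; omega
    rcases this with ⟨h3, h4⟩ | ⟨h3, h4⟩
    · exact A.triangle_of_pred p z y x hz hx h3 h4
    · exact A.triangle_of_succ p z y x hz hx h3 h4
  · rw [rel_two] at hz ⊢
    replace hx := A.rel_one.1 hx
    have : (A.dist x p + 2 = A.dist y p ∧ A.dist z p + 1 = A.dist y p) ∨
        (A.dist p z + 2 = A.dist p y ∧ A.dist p x + 1 = A.dist p y) := by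
      unfold IsStep at *; omega
    rcases this with ⟨h3, h4⟩ | ⟨h3, h4⟩
    · exact A.triangle_of_pred p x y z hx hz h3 h4
    · exact A.triangle_of_succ p x y z hx hz h3 h4

lemma exists_fourth_aux {p x y z : P} {w1 w2 : ℤ} (hz : A.dist z y = 1) (hx : A.dist x y = 1)
    (hz1 : A.dist p z = A.dist p y + 2) (hz2 : A.dist z p = A.dist y p + 1)
    (hx1 : A.dist p x + 1 = A.dist p y) (hx2 : A.dist x p + 2 = A.dist y p)
    (hw1 : w1 = A.dist p y + 1) (hw2 : w2 = A.dist y p - 1) :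
    ∃ w, A.dist y w = 1 ∧ A.dist w z = 1 ∧ A.dist w x = 1 ∧ A.dist p w = w1 ∧ A.dist w p = w2 ∧
      ∀ w', A.dist w' z = 1 → A.dist w' p ≤ w2 → w' = w := by
  have hle := A.dist_le_two_mul x p
  obtain ⟨w, h1, h2, h3⟩ := A.exists_pred p z (by omega)
  have h4 := A.triangle_of_pred p w z y h1 hz h3 (by omega)
  refine ⟨w, h4, h1, A.triangle_of_pred p x y w hx h4 hx2 (by omega), by omega, by omega, ?_⟩
  intro w' h5 h6
  have h7 := A.dist_symm_of_edge _ _ h5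
  have h8 := A.triangle z w' p
  exact A.pred_unique p w' w z h5 h1 (by omega) h3

/-- The possible positions of the two neighbours `z`, `x` of `y` and of the fourth vertex `w`
of a rhombus, when the edges are oriented towards `y`. -/
lemma fourth_cases {y1 y2 z1 z2 x1 x2 w1 w2 : ℤ} (sz : IsStep 1 (z1 - y1) (z2 - y2))
    (sx : IsStep 1 (x1 - y1) (x2 - y2)) (sw : IsStep 2 (w1 - y1) (w2 - y2))
    (swz : IsStep 1 (w1 - z1) (w2 - z2)) (swx : IsStep 2 (x1 - w1) (x2 - w2))
    (h1 : y1 = z1 + 1 ∨ y1 = x1 + 1 ∨ y1 = w1 + 2)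
    (h2 : y2 = z2 + 2 ∨ y2 = x2 + 2 ∨ y2 = w2 + 1)
    (u2 : ¬ (y2 = z2 + 2 ∧ y2 = x2 + 2)) :
    (w1 = y1 - 2 ∧ w2 = y2 - 1 ∧ z1 + 1 = y1 ∧ x1 + 1 = y1 ∧ (z2 = y2 + 1 ∨ x2 = y2 + 1)) ∨
      (w1 = y1 + 1 ∧ w2 = y2 - 1 ∧
        ((z1 = y1 + 2 ∧ z2 = y2 + 1 ∧ x1 + 1 = y1 ∧ x2 + 2 = y2) ∨
          (x1 = y1 + 2 ∧ x2 = y2 + 1 ∧ z1 + 1 = y1 ∧ z2 + 2 = y2))) := by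
  simp only [IsStep, OfNat.one_ne_ofNat, OfNat.ofNat_ne_one, false_and, true_and, false_or,
    or_false] at sz sx sw swz swx
  rcases sw with sw | sw | sw <;> rcases sz with sz | sz | sz <;> rcases sx with sx | sx | sx <;>
    first
    | (exfalso; omega)
    | (left; omega)
    | (right; omega)

/-- If the boundary path `z, y, x` runs around a rhombus that is an ear of a diskoid, then there
is exactly one possible position for the fourth vertex of the rhombus: it is determined as
the next vertex, towards the base point, from one of `x`, `y`, `z`. -/
lemma exists_fourth {c : ℤ} (hc : c = 1 ∨ c = 2) {p x y z : P} {w1 w2 : ℤ} (hz : A.Rel c y z)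
    (hx : A.Rel c y x)
    (sz : IsStep c (A.dist p z - A.dist p y) (A.dist z p - A.dist y p))
    (sx : IsStep c (A.dist p x - A.dist p y) (A.dist x p - A.dist y p))
    (sw : IsStep (3 - c) (w1 - A.dist p y) (w2 - A.dist y p))
    (swz : IsStep c (w1 - A.dist p z) (w2 - A.dist z p))
    (swx : IsStep (3 - c) (A.dist p x - w1) (A.dist x p - w2))
    (h1 : A.dist p y = A.dist p z + c ∨ A.dist p y = A.dist p x + c ∨
      A.dist p y = w1 + (3 - c))
    (h2 : A.dist y p = A.dist z p + (3 - c) ∨ A.dist y p = A.dist x p + (3 - c) ∨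
      A.dist y p = w2 + c)
    (u1 : c = 2 → ¬ (A.dist p y = A.dist p z + 2 ∧ A.dist p y = A.dist p x + 2))
    (u2 : c = 1 → ¬ (A.dist y p = A.dist z p + 2 ∧ A.dist y p = A.dist x p + 2)) :
    ∃ w, A.Rel (3 - c) y w ∧ A.Rel c z w ∧ A.Rel (3 - c) w x ∧ A.dist p w = w1 ∧
      A.dist w p = w2 ∧ ∀ w', A.Rel (3 - c) y w' → A.Rel c z w' → A.Rel (3 - c) w' x →
        A.dist p w' ≤ w1 → A.dist w' p ≤ w2 → w' = w := by
  -- by duality, the edges may be taken to be oriented towards `y`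
  wlog hc1 : c = 1 generalizing A c w1 w2
  · have hc2 : c = 2 := by omega
    subst hc2
    obtain ⟨w, k1, k2, k3, k4, k5, k6⟩ := this (A := A.dual) (c := 1) (.inl rfl) (w1 := w2)
      (w2 := w1) (hz.dual (.inr rfl)) (hx.dual (.inr rfl)) sz.dual sx.dual sw.dual swz.dual
      swx.dual (by simpa using h2) (by simpa using h1) (by simp) (fun _ => by simpa using u1 rfl)
      rfl
    refine ⟨w, Rel.of_dual (.inl rfl) k1, Rel.of_dual (.inr rfl) k2, Rel.of_dual (.inl rfl) k3,
      k5, k4, fun w' m1 m2 m3 m4 m5 => k6 w' (m1.dual (.inl rfl)) (m2.dual (.inr rfl))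
        (m3.dual (.inl rfl)) m5 m4⟩
  subst hc1
  have e : (3 - 1 : ℤ) = 2 := rfl
  replace u2 := u2 rfl
  rw [rel_one] at hz hx
  simp only [e, rel_one, rel_two] at sw swx h1 h2 ⊢
  have hcases := fourth_cases sz sx sw swz swx h1 h2 u2
  rcases hcases with ⟨k1, k2, k3, k4, k5⟩ | ⟨k1, k2, ⟨k3, k4, k5, k6⟩ | ⟨k3, k4, k5, k6⟩⟩
  · have l1 := A.dist_le_two_mul p z
    have l2 := A.dist_le_two_mul p x
    obtain ⟨w, m1, m2, m3⟩ := A.exists_succ p y (by omega)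
    refine ⟨w, m1, A.triangle_of_succ p z y w hz m1 m2 k3,
      A.triangle_of_succ p x y w hx m1 m2 k4, by omega, by omega, ?_⟩
    intro w' n1 _ _ n2 _
    have n3 := A.dist_symm_of_edge _ _ n1
    have n4 := A.triangle p w' y
    exact A.succ_unique p y w' w n1 m1 (by omega) m2
  · obtain ⟨w, m1, m2, m3, m4, m5, m6⟩ := exists_fourth_aux hz hx k3 k4 k5 k6 k1 k2
    exact ⟨w, m1, m2, m3, m4, m5, fun w' _ n1 _ _ n2 => m6 w' n1 n2⟩
  · obtain ⟨w, m1, m2, m3, m4, m5, m6⟩ := exists_fourth_aux hx hz k3 k4 k5 k6 k1 k2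
    exact ⟨w, m1, m3, m2, m4, m5, fun w' _ _ n1 _ n2 => m6 w' n1 n2⟩

end A2Space

namespace TriMap

/-! ### The boundary of a subcomplex -/

variable {V E : Type} (M : TriMap V E)

/-- The dart bounds the subcomplex on `S` on its left. -/
def Outer (S : Finset V) (d : E) : Prop := M.Alive S d ∧ ¬ M.InnerIn S d

open Classical in
/-- The successor of a dart along the boundary of a face of the subcomplex on `S`: the first dart
of the subcomplex in the rotation at the end of `d`. -/
noncomputable def nextIn (S : Finset V) (d : E) : E :=
  if h : ∃ j : ℕ, M.Alive S ((fun x => M.next (M.rev x))^[j] (M.next d)) then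
    (fun x => M.next (M.rev x))^[Nat.find h] (M.next d)
  else d

variable {M}

lemma exists_iterate {d z : E} (hz : M.src z = M.tgt d) :
    ∃ j : ℕ, (fun x => M.next (M.rev x))^[j] (M.next d) = z :=
  M.rotation _ _ (by rw [src_next_eq_tgt, hz])

lemma src_iterate (d : E) (j : ℕ) :
    M.src ((fun x => M.next (M.rev x))^[j] (M.next d)) = M.tgt d := by
  induction j with
  | zero => exact M.src_next_eq_tgt d
  | succ j ih => rw [Function.iterate_succ_apply', src_next_eq_tgt, tgt_rev, ih]

lemma nextIn_spec {S : Finset V} {d z : E} (hz : M.Alive S z) (hzd : M.src z = M.tgt d) :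
    ∃ j : ℕ, M.nextIn S d = (fun x => M.next (M.rev x))^[j] (M.next d) ∧
      M.Alive S (M.nextIn S d) ∧
      ∀ i < j, ¬ M.Alive S ((fun x => M.next (M.rev x))^[i] (M.next d)) := by
  classical
  obtain ⟨j, hj⟩ := exists_iterate hzd
  have h : ∃ j : ℕ, M.Alive S ((fun x => M.next (M.rev x))^[j] (M.next d)) := ⟨j, hj ▸ hz⟩
  have heq : M.nextIn S d = (fun x => M.next (M.rev x))^[Nat.find h] (M.next d) := by
    unfold nextIn
    rw [dif_pos h]
  exact ⟨Nat.find h, heq, heq ▸ Nat.find_spec h, fun i hi => Nat.find_min h hi⟩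

lemma nextIn_eq {S : Finset V} {d : E} {j : ℕ}
    (hj : M.Alive S ((fun x => M.next (M.rev x))^[j] (M.next d)))
    (hlt : ∀ i < j, ¬ M.Alive S ((fun x => M.next (M.rev x))^[i] (M.next d))) :
    M.nextIn S d = (fun x => M.next (M.rev x))^[j] (M.next d) := by
  obtain ⟨k, hk, hal, hk'⟩ := nextIn_spec hj (src_iterate d j)
  rw [hk] at hal ⊢
  rcases lt_trichotomy j k with h | h | h
  · exact absurd hj (hk' j h)
  · rw [h]
  · exact absurd hal (hlt k h)

lemma nextIn_eq_next {S : Finset V} {d : E} (h : M.Alive S (M.next d)) :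
    M.nextIn S d = M.next d :=
  nextIn_eq (j := 0) h (by simp)

lemma src_nextIn {S : Finset V} {d z : E} (hz : M.Alive S z) (hzd : M.src z = M.tgt d) :
    M.src (M.nextIn S d) = M.tgt d := by
  obtain ⟨j, hj, -⟩ := nextIn_spec hz hzd
  rw [hj, src_iterate]

lemma outer_nextIn {S : Finset V} {d z : E} (hz : M.Alive S z) (hzd : M.src z = M.tgt d)
    (hd : ¬ M.InnerIn S d) : M.Outer S (M.nextIn S d) := by
  obtain ⟨j, hj, hal, hlt⟩ := nextIn_spec hz hzd
  refine ⟨hal, fun hin => ?_⟩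
  have h1 := M.next_rev_turn hin.1
  cases j with
  | zero =>
    have h2 : M.nextIn S d = M.next d := hj
    rw [h2] at h1
    have h3 := M.next_injective h1
    apply hd
    rw [turn, M.rev_rev] at h3
    rw [h2] at hin
    exact h3 ▸ hin.next.next
  | succ j =>
    rw [Function.iterate_succ_apply'] at hj
    have h2 := M.rev_injective (M.next_injective (h1.trans hj))
    exact hlt j (by omega) (h2 ▸ hin.turn_alive)

/-- The boundary can only turn back at a vertex with a single dart. -/
lemma eq_rev_of_nextIn_eq_rev {S : Finset V} {d z : E} (hz : M.Alive S z)
    (hzd : M.src z = M.tgt d) (h : M.nextIn S d = M.rev d) : z = M.rev d := by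
  obtain ⟨j, hj, hal, hlt⟩ := nextIn_spec hz hzd
  obtain ⟨m, hm⟩ := exists_iterate hzd
  have hper : Function.IsPeriodicPt (fun x => M.next (M.rev x)) (j + 1) (M.next d) := by
    rw [Function.IsPeriodicPt, Function.IsFixedPt, Function.iterate_succ_apply', ← hj, h, M.rev_rev]
  rw [← hper.iterate_mod_apply m] at hm
  have hmod : m % (j + 1) < j + 1 := Nat.mod_lt _ (by omega)
  rcases Nat.lt_succ_iff_lt_or_eq.1 hmod with h1 | h1
  · exact absurd (hm ▸ hz) (hlt _ h1)
  · rw [h1] at hm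
    rw [← hm, ← hj, h]

variable [DecidableEq V]

lemma nextIn_erase_of_alive {S : Finset V} {y : V} {d z : E} (hz : M.Alive S z)
    (hzd : M.src z = M.tgt d) (h : M.Alive (S.erase y) (M.nextIn S d)) :
    M.nextIn (S.erase y) d = M.nextIn S d := by
  obtain ⟨j, hj, hal, hlt⟩ := nextIn_spec hz hzd
  rw [hj] at h ⊢
  exact nextIn_eq h fun i hi hi' => hlt i hi (alive_erase_iff.1 hi').1

lemma nextIn_erase_of_not_alive {S : Finset V} {y : V} {d z : E} (hz : M.Alive (S.erase y) z)
    (hzd : M.src z = M.tgt d) (h : ¬ M.Alive (S.erase y) (M.nextIn S d)) :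
    M.nextIn (S.erase y) d = M.nextIn (S.erase y) (M.rev (M.nextIn S d)) := by
  obtain ⟨j, hj, hal, hlt⟩ := nextIn_spec (alive_erase_iff.1 hz).1 hzd
  obtain ⟨k, hk, hal', hlt'⟩ := nextIn_spec hz hzd
  have hjk : j < k := by
    rcases lt_trichotomy j k with h1 | rfl | h1
    · exact h1
    · exact absurd (by rw [hj, ← hk]; exact hal') h
    · exact absurd (hk ▸ (alive_erase_iff.1 hal').1) (hlt k h1)
  obtain ⟨i, rfl⟩ := Nat.exists_eq_add_of_lt hjk
  have hit : ∀ i, (fun x => M.next (M.rev x))^[j + i + 1] (M.next d) =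
      (fun x => M.next (M.rev x))^[i] (M.next (M.rev (M.nextIn S d))) := by
    intro i
    rw [show j + i + 1 = i + (j + 1) by ring, Function.iterate_add_apply,
      Function.iterate_succ_apply', ← hj]
  rw [hk, hit]
  symm
  apply nextIn_eq
  · rw [← hit, ← hk]; exact hal'
  · intro m hm
    rw [← hit]
    exact hlt' _ (by omega)

lemma outer_of_outer_erase {S : Finset V} {y : V} {d : E} (hd : M.Outer (S.erase y) d) :
    M.Outer S d ∨ (M.InnerIn S d ∧ M.src (M.next (M.next d)) = y) := by
  have h1 := alive_erase_iff.1 hd.1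
  by_cases h : M.InnerIn S d
  · right
    refine ⟨h, ?_⟩
    by_contra h2
    rw [src_next_eq_tgt] at h2
    exact hd.2 (innerIn_erase_iff.2 ⟨h, h1.2.1, h1.2.2, h2⟩)
  · exact .inl ⟨h1.1, h⟩

lemma Outer.erase {S : Finset V} {y : V} {d : E} (hd : M.Outer S d) (h1 : M.src d ≠ y)
    (h2 : M.tgt d ≠ y) : M.Outer (S.erase y) d :=
  ⟨alive_erase_iff.2 ⟨hd.1, h1, h2⟩, fun h => hd.2 (innerIn_erase_iff.1 h).1⟩

end TriMap

namespace TriMap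

/-! ### Extending configurations from the boundary -/

variable {V E P : Type} {M : TriMap V E} {A : A2Space P} {p₀ : P} {h k : V → ℤ}
  {S : Finset V} {p : V}

variable (M A p₀ S p) in
/-- `g` is a configuration in `A` of the subcomplex on `S` that sends `p` to `p₀`. -/
structure IsConfig (g : V → P) : Prop where
  base : g p = p₀
  edge : ∀ d, M.Alive S d → A.Rel (M.cost d) (g (M.src d)) (g (M.tgt d))

variable (M A p₀ h k S) in
/-- `F` assigns points to the corners of the boundary of the subcomplex on `S` (a corner is recorded
by the boundary dart that leaves it; corners at the same vertex may have different
points), such that successive points are related as the boundary darts demand, and the distances to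
and from `p₀` are given by the heights `h`, `k`. -/
structure IsBoundaryConfig (F : E → P) : Prop where
  edge : ∀ d, M.Outer S d → A.Rel (M.cost d) (F d) (F (M.nextIn S d))
  dist_left : ∀ d, M.Outer S d → A.dist p₀ (F d) = h (M.src d)
  dist_right : ∀ d, M.Outer S d → A.dist (F d) p₀ = k (M.src d)

variable (M S) in
/-- The configuration `g` takes the boundary values `F`. -/
def Fills (F : E → P) (g : V → P) : Prop := ∀ d, M.Outer S d → g (M.src d) = F d

lemma IsConfig.dual {g : V → P} (hg : M.IsConfig A p₀ S p g) : M.dual.IsConfig A.dual p₀ S p g :=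
  ⟨hg.base, fun d hd => (hg.edge d hd).dual (M.cost_cases d)⟩

lemma IsConfig.erase [DecidableEq V] {y : V} {g : V → P} (hg : M.IsConfig A p₀ S p g) :
    M.IsConfig A p₀ (S.erase y) p g :=
  ⟨hg.base, fun d hd => hg.edge d (alive_erase_iff.1 hd).1⟩

variable [Fintype E]

/-- A configuration does not increase distances from the base point. -/
lemma IsConfig.dist_le {g : V → P} (hg : M.IsConfig A p₀ S p g) (H : M.IsRooted h S p)
    (hp : h p = 0) {v : V} (hv : v ∈ S) : A.dist p₀ (g v) ≤ h v := by
  obtain ⟨n, hn⟩ : ∃ n : ℕ, h v ≤ n := ⟨(h v).toNat, Int.self_le_toNat _⟩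
  induction n generalizing v with
  | zero =>
    by_cases hvp : v = p
    · rw [hvp, hg.base, A.dist_self, hp]
    · have := H.lt hv hvp
      rw [hp] at this
      push_cast at hn
      omega
  | succ n ih =>
    by_cases hvp : v = p
    · rw [hvp, hg.base, A.dist_self, hp]
    · obtain ⟨d, hd, hdh⟩ := H.parent v hv hvp
      have hc := M.cost_cases d
      have h1 := ih (tgt_mem hd) (by push_cast at hn; omega)
      have h2 := hg.edge d (M.mem_darts.1 hd).1
      rw [src_of_mem hd] at h2
      have h3 := h2.dist_eq hc
      have h4 := A.triangle p₀ (g (M.tgt d)) (g v)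
      omega

/-- A rooted pair of heights changes along darts like a weight-valued distance. -/
lemma IsRooted.isStep (H : M.IsRooted h S p) (K : M.dual.IsRooted k S p) {d : E}
    (hd : M.Alive S d) :
    IsStep (M.cost d) (h (M.tgt d) - h (M.src d)) (k (M.tgt d) - k (M.src d)) := by
  classical
  have h1 := H.dichotomy d hd
  have h2 := K.dichotomy d hd
  rw [dual_src, dual_tgt, dual_cost] at h2
  unfold IsStep
  rcases M.cost_cases d with hc | hc <;> rw [hc] at h1 h2
  · refine .inr ⟨hc, ?_⟩
    have h4 : ¬ (h (M.tgt d) = h (M.src d) + 2 ∧ k (M.src d) = k (M.tgt d) + 2) :=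
      fun ⟨h5, h6⟩ => H.not_opposite K hd.rev (by rw [M.cost_rev, hc]; rfl)
        (by rw [tgt_rev]; exact h5) (by rw [tgt_rev]; exact h6)
    rcases h1 with h1 | h1 <;> rcases h2 with h2 | h2 <;> omega
  · refine .inl ⟨hc, ?_⟩
    have h3 : ¬ (h (M.src d) = h (M.tgt d) + 2 ∧ k (M.tgt d) = k (M.src d) + 2) :=
      fun ⟨h5, h6⟩ => H.not_opposite K hd hc h5 h6
    rcases h1 with h1 | h1 <;> rcases h2 with h2 | h2 <;> omega

variable (M S) in
/-- At the tip `y` of an ear, `a` is the first dart of the fan of triangles and `b` the last: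
the boundary of the subcomplex on `S` passes through `y` once, along `rev a` and `b`. -/
structure HeadTail (y : V) (a b : E) : Prop where
  head_mem : a ∈ M.darts S y
  tail_mem : b ∈ M.darts S y
  outer_tail : M.Outer S b
  outer_rev_head : M.Outer S (M.rev a)
  eq_tail : ∀ d, M.Outer S d → M.src d = y → d = b
  eq_rev_head : ∀ d, M.Outer S d → M.tgt d = y → d = M.rev a

lemma HeadTail.of {y : V} {a b : E} (ha : a ∈ M.darts S y) (hb : b ∈ M.darts S y)
    (hbc : b ∉ M.corners S y) (hac : ∀ c ∈ M.corners S y, M.turn c ≠ a)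
    (hb' : ∀ d ∈ M.darts S y, d ∈ M.corners S y ∨ d = b)
    (ha' : ∀ d ∈ M.darts S y, d = a ∨ ∃ c ∈ M.corners S y, M.turn c = d) : M.HeadTail S y a b where
  head_mem := ha
  tail_mem := hb
  outer_tail := ⟨(M.mem_darts.1 hb).1, fun h => hbc (M.mem_corners.2 ⟨h, src_of_mem hb⟩)⟩
  outer_rev_head := by
    refine ⟨(M.mem_darts.1 ha).1.rev, fun hin => hac (M.next (M.rev a)) ?_ ?_⟩
    · exact M.mem_corners.2 ⟨hin.next, by rw [src_next_eq_tgt, tgt_rev, src_of_mem ha]⟩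
    · rw [turn, M.next_next_next _ hin.1, M.rev_rev]
  eq_tail d hd hdy := (hb' d (M.mem_darts.2 ⟨hd.1, hdy⟩)).resolve_left fun h =>
    hd.2 (M.mem_corners.1 h).1
  eq_rev_head d hd hdy := by
    rcases ha' (M.rev d) (M.mem_darts.2 ⟨hd.1.rev, hdy⟩) with h1 | ⟨c, hc, h1⟩
    · rw [← h1, M.rev_rev]
    · refine absurd ?_ hd.2
      rw [← M.rev_rev d, ← h1, turn, M.rev_rev]
      exact (M.mem_corners.1 hc).1.next.next

lemma headTail_leaf {y : V} {e : E} (hD : M.darts S y = {e}) (hc : M.corners S y = ∅) :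
    M.HeadTail S y e e :=
  .of (by simp [hD]) (by simp [hD]) (by simp [hc]) (by simp [hc]) (by simp [hD]) (by simp [hD])

lemma headTail_one {y : V} {e : E} (hD : ∀ x, x ∈ M.darts S y ↔ x = e ∨ x = M.turn e)
    (hc : ∀ x, x ∈ M.corners S y ↔ x = e) : M.HeadTail S y e (M.turn e) := by
  have hi := (M.mem_corners.1 ((hc e).2 rfl)).1.1
  refine .of (by simp [hD]) (by simp [hD]) ?_ ?_ ?_ ?_
  · rw [hc]; exact M.turn_ne hi
  · intro c h1
    rw [(hc c).1 h1]; exact M.turn_ne hi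
  · intro d hd
    rw [hc]; exact (hD d).1 hd
  · intro d hd
    exact ((hD d).1 hd).imp_right fun h1 => ⟨e, (hc e).2 rfl, h1.symm⟩

lemma headTail_two {y : V} {e : E}
    (hD : ∀ x, x ∈ M.darts S y ↔ x = e ∨ x = M.turn e ∨ x = M.turn (M.turn e))
    (hc : ∀ x, x ∈ M.corners S y ↔ x = e ∨ x = M.turn e) (hne : M.turn (M.turn e) ≠ e) :
    M.HeadTail S y e (M.turn (M.turn e)) := by
  have hi := (M.mem_corners.1 ((hc e).2 (.inl rfl))).1.1
  have hi' := (M.mem_corners.1 ((hc _).2 (.inr rfl))).1.1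
  refine .of (by simp [hD]) (by simp [hD]) ?_ ?_ ?_ ?_
  · rw [hc]
    rintro (h1 | h1)
    exacts [hne h1, M.turn_ne hi' h1]
  · intro c h1
    rcases (hc c).1 h1 with rfl | rfl
    exacts [M.turn_ne hi, hne]
  · intro d hd
    rw [hc]
    exact or_assoc.2 ((hD d).1 hd)
  · intro d hd
    refine ((hD d).1 hd).imp_right ?_
    rintro (rfl | rfl)
    exacts [⟨e, (hc _).2 (.inl rfl), rfl⟩, ⟨M.turn e, (hc _).2 (.inr rfl), rfl⟩]

lemma HeadTail.nextIn_rev_head {y : V} {a b : E} (ht : M.HeadTail S y a b) :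
    M.nextIn S (M.rev a) = b := by
  have ha := M.mem_darts.1 ht.head_mem
  have hs : M.src a = M.tgt (M.rev a) := by rw [tgt_rev]
  refine ht.eq_tail _ (outer_nextIn ha.1 hs ht.outer_rev_head.2) ?_
  rw [src_nextIn ha.1 hs, ← hs, ha.2]

lemma HeadTail.outer_nextIn_tail {y : V} {a b : E} (ht : M.HeadTail S y a b) :
    M.Outer S (M.nextIn S b) :=
  outer_nextIn ht.outer_tail.1.rev rfl ht.outer_tail.2

lemma HeadTail.src_nextIn_tail {y : V} {a b : E} (ht : M.HeadTail S y a b) :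
    M.src (M.nextIn S b) = M.tgt b :=
  src_nextIn ht.outer_tail.1.rev rfl

lemma HeadTail.rel_head {y : V} {a b : E} (ht : M.HeadTail S y a b) {F : E → P}
    (hF : M.IsBoundaryConfig A p₀ h k S F) : A.Rel (M.cost a) (F b) (F (M.rev a)) := by
  have h1 := (hF.edge _ ht.outer_rev_head).flip (M.cost_cases _)
  rw [ht.nextIn_rev_head, M.cost_rev] at h1
  simpa using h1

variable [DecidableEq V]

/-- Successors along the boundary, and the points there, before and after the removal of an ear. -/
lemma HeadTail.apply_nextIn_erase {y : V} {a b : E} (ht : M.HeadTail S y a b) {F F' : E → P}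
    (hold : ∀ d, M.Outer S d → M.Alive (S.erase y) d → F' d = F d)
    (hhead : ∀ z, M.Alive (S.erase y) z → M.src z = M.tgt a →
      F' (M.nextIn (S.erase y) a) = F (M.rev a))
    {x z : E} (hz : M.Alive (S.erase y) z) (hzx : M.src z = M.tgt x)
    (hout : M.Outer S (M.nextIn S x)) : F' (M.nextIn (S.erase y) x) = F (M.nextIn S x) := by
  have hz' := alive_erase_iff.1 hz
  by_cases h1 : M.Alive (S.erase y) (M.nextIn S x)
  · rw [nextIn_erase_of_alive hz'.1 hzx h1, hold _ hout h1]
  · have hs := src_nextIn hz'.1 hzx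
    have h2 : M.nextIn S x = M.rev a := by
      refine ht.eq_rev_head _ hout ?_
      by_contra h2
      exact h1 (alive_erase_iff.2 ⟨hout.1, by rw [hs, ← hzx]; exact hz'.2.1, h2⟩)
    rw [nextIn_erase_of_not_alive hz hzx h1, h2, M.rev_rev]
    refine hhead z hz ?_
    rw [hzx, ← hs, h2]; rfl

/-- If the boundary configuration `F'` of the complement of an ear is compatible with `F`, then
a configuration with boundary values `F'` extends to one with boundary values `F`. -/
lemma HeadTail.exists_config {y : V} {a b : E} (ht : M.HeadTail S y a b) {F F' : E → P}
    (hyp : y ≠ p) (hear : M.IsEar S y) (H' : M.IsRooted h (S.erase y) p)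
    (hp : h p = 0) (hF : M.IsBoundaryConfig A p₀ h k S F)
    (hold : ∀ d, M.Outer S d → M.Alive (S.erase y) d → F' d = F d)
    (hhead : ∀ z, M.Alive (S.erase y) z → M.src z = M.tgt a →
      F' (M.nextIn (S.erase y) a) = F (M.rev a))
    (hmid : ∀ d ∈ M.darts S y, d = a ∨ d = b ∨ (M.Outer (S.erase y) (M.next d) ∧
      A.Rel (M.cost d) (F b) (F' (M.next d))))
    (hex : ∃ g, M.IsConfig A p₀ (S.erase y) p g ∧ M.Fills (S.erase y) F' g) :
    ∃ g, M.IsConfig A p₀ S p g ∧ M.Fills S F g := by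
  obtain ⟨g, hg, hfill⟩ := hex
  have hval : ∀ d, M.Outer S d → M.src d ≠ y → g (M.src d) = F d := by
    intro d hd hdy
    by_cases h1 : M.tgt d = y
    · obtain rfl := ht.eq_rev_head d hd h1
      by_cases hex : ∃ z, M.Alive (S.erase y) z ∧ M.src z = M.tgt a
      · obtain ⟨z, hz, hza⟩ := hex
        rw [← hhead z hz hza]
        have hin : ¬ M.InnerIn (S.erase y) a := fun h2 =>
          (innerIn_erase_iff.1 h2).2.1 (src_of_mem ht.head_mem)
        rw [← hfill _ (outer_nextIn hz hza hin), src_nextIn hz hza]; rfl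
      · -- the other end of a bare edge can only be the root
        have hu : M.src (M.rev a) = p := by
          by_contra hu
          obtain ⟨z, hz, -⟩ := H'.parent (M.src (M.rev a))
            (Finset.mem_erase.2 ⟨hdy, hd.1.1⟩) hu
          exact hex ⟨z, M.mem_darts.1 hz⟩
        rw [hu, hg.base]
        refine A.eq_of_dist_eq_zero _ _ ?_
        rw [hF.dist_left _ hd, hu, hp]
    · have h2 := hd.erase hdy h1
      rw [hfill d h2, hold d hd h2.1]
  have hedge : ∀ d ∈ M.darts S y, A.Rel (M.cost d) (F b) (g (M.tgt d)) := by
    intro d hd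
    have hdy := hear.tgt_ne hd
    rcases hmid d hd with rfl | rfl | ⟨h1, h2⟩
    · have h3 := hval _ ht.outer_rev_head hdy
      have h4 : g (M.tgt d) = F (M.rev d) := h3
      rw [h4]
      exact ht.rel_head hF
    · have h3 := hval _ ht.outer_nextIn_tail (by rw [ht.src_nextIn_tail]; exact hdy)
      rw [ht.src_nextIn_tail] at h3
      rw [h3]
      exact hF.edge _ ht.outer_tail
    · have h3 := hfill _ h1
      rw [src_next_eq_tgt] at h3
      rwa [h3]
  refine ⟨Function.update g y (F b), ⟨?_, fun d hd => ?_⟩, fun d hd => ?_⟩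
  · rw [Function.update_of_ne hyp.symm, hg.base]
  · by_cases h1 : M.src d = y
    · have hm := M.mem_darts.2 ⟨hd, h1⟩
      rw [h1, Function.update_self, Function.update_of_ne (hear.tgt_ne hm)]
      exact hedge d hm
    · by_cases h2 : M.tgt d = y
      · have hm : M.rev d ∈ M.darts S y := M.mem_darts.2 ⟨hd.rev, h2⟩
        have h3 := (hedge _ hm).flip (M.cost_cases _)
        rw [M.cost_rev, tgt_rev] at h3
        rw [h2, Function.update_self, Function.update_of_ne h1]
        simpa using h3
      · rw [Function.update_of_ne h1, Function.update_of_ne h2]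
        exact hg.edge d (alive_erase_iff.2 ⟨hd, h1, h2⟩)
  · by_cases h1 : M.src d = y
    · rw [h1, Function.update_self, ht.eq_tail d hd h1]
    · rw [Function.update_of_ne h1, hval d hd h1]

lemma HeadTail.old_edge {y : V} {a b : E} (ht : M.HeadTail S y a b) {F F' : E → P}
    (hF : M.IsBoundaryConfig A p₀ h k S F)
    (hold : ∀ d, M.Outer S d → M.Alive (S.erase y) d → F' d = F d)
    (hhead : ∀ z, M.Alive (S.erase y) z → M.src z = M.tgt a →
      F' (M.nextIn (S.erase y) a) = F (M.rev a)) {d : E} (hd : M.Outer S d)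
    (hd' : M.Alive (S.erase y) d) : A.Rel (M.cost d) (F' d) (F' (M.nextIn (S.erase y) d)) := by
  rw [hold d hd hd', ht.apply_nextIn_erase hold hhead hd'.rev rfl
    (outer_nextIn hd.1.rev rfl hd.2)]
  exact hF.edge d hd

/-- A boundary configuration of `S` restricts to the complement of an ear as soon as the new
boundary darts `next c` are taken care of. -/
lemma HeadTail.isBoundaryConfig {y : V} {a b : E} (ht : M.HeadTail S y a b) {F F' : E → P}
    (hF : M.IsBoundaryConfig A p₀ h k S F)
    (hold : ∀ d, M.Outer S d → M.Alive (S.erase y) d → F' d = F d)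
    (hhead : ∀ z, M.Alive (S.erase y) z → M.src z = M.tgt a →
      F' (M.nextIn (S.erase y) a) = F (M.rev a))
    (hnew : ∀ c ∈ M.corners S y,
      A.Rel (M.cost (M.next c)) (F' (M.next c)) (F' (M.nextIn (S.erase y) (M.next c))) ∧
      A.dist p₀ (F' (M.next c)) = h (M.tgt c) ∧ A.dist (F' (M.next c)) p₀ = k (M.tgt c)) :
    M.IsBoundaryConfig A p₀ h k (S.erase y) F' := by
  have key : ∀ d, M.Outer (S.erase y) d → M.Outer S d ∨ ∃ c ∈ M.corners S y, d = M.next c := by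
    intro d hd
    refine (outer_of_outer_erase hd).imp_right fun ⟨h1, h2⟩ => ⟨M.next (M.next d), ?_, ?_⟩
    · exact M.mem_corners.2 ⟨h1.next.next, h2⟩
    · rw [M.next_next_next d h1.1]
  refine ⟨fun d hd => ?_, fun d hd => ?_, fun d hd => ?_⟩ <;>
    rcases key d hd with h1 | ⟨c, hc, rfl⟩
  · exact ht.old_edge hF hold hhead h1 hd.1
  · exact (hnew c hc).1
  · rw [hold d h1 hd.1, hF.dist_left d h1]
  · rw [(hnew c hc).2.1, src_next_eq_tgt]
  · rw [hold d h1 hd.1, hF.dist_right d h1]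
  · rw [(hnew c hc).2.2, src_next_eq_tgt]

lemma fills_erase {y : V} {F F' : E → P} {g : V → P} (hg : M.Fills S F g)
    (hold : ∀ d, M.Outer S d → M.Alive (S.erase y) d → F' d = F d)
    (hnew : ∀ c ∈ M.corners S y, g (M.tgt c) = F' (M.next c)) : M.Fills (S.erase y) F' g := by
  intro d hd
  rcases outer_of_outer_erase hd with h1 | ⟨h1, h2⟩
  · rw [hold d h1 hd.1, hg d h1]
  · have h3 := hnew _ (M.mem_corners.2 ⟨h1.next.next, h2⟩)
    rwa [← src_next_eq_tgt, M.next_next_next d h1.1] at h3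

lemma next_alive_erase {y : V} (hear : M.IsEar S y) {c : E} (hc : c ∈ M.corners S y) :
    M.Alive (S.erase y) (M.next c) := by
  refine alive_erase_iff.2 ⟨(M.mem_corners.1 hc).1.next.alive, ?_, ?_⟩
  · rw [src_next_eq_tgt]; exact hear.tgt_ne (M.corners_subset _ _ hc)
  · rw [← tgt_turn]; exact hear.tgt_ne (M.turn_mem_darts hc)

lemma next_outer_erase {y : V} (hear : M.IsEar S y) {c : E} (hc : c ∈ M.corners S y) :
    M.Outer (S.erase y) (M.next c) :=
  ⟨next_alive_erase hear hc, fun h1 => (innerIn_erase_iff.1 h1).2.2.2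
    (by rw [M.tgt_next_next (M.mem_corners.1 hc).1.1]; exact (M.mem_corners.1 hc).2)⟩

/-- The boundary of the complement of an ear continues from `next c` as it would from `turn c`. -/
lemma nextIn_erase_next {y : V} (hear : M.IsEar S y) {c : E} (hc : c ∈ M.corners S y) :
    M.nextIn (S.erase y) (M.next c) = M.nextIn (S.erase y) (M.turn c) := by
  have hc' := M.mem_corners.1 hc
  have h1 : M.nextIn S (M.next c) = M.next (M.next c) := nextIn_eq_next hc'.1.next.next.alive
  rw [nextIn_erase_of_not_alive (next_alive_erase hear hc).rev rfl, h1]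
  · rfl
  · rw [h1]
    exact fun h2 => (alive_erase_iff.1 h2).2.2 (by rw [M.tgt_next_next hc'.1.1, hc'.2])

/-- The complement of an ear, with a boundary configuration that determines the given one. -/
lemma exists_reduction {y : V} (hear : M.IsEar S y) (hy : y ∈ S) (hyp : y ≠ p)
    (H : M.IsRooted h S p) (K : M.dual.IsRooted k S p) (hp : h p = 0) (kp : k p = 0) {F : E → P}
    (hF : M.IsBoundaryConfig A p₀ h k S F) :
    ∃ F', M.IsBoundaryConfig A p₀ h k (S.erase y) F' ∧
      ((∃ g, M.IsConfig A p₀ (S.erase y) p g ∧ M.Fills (S.erase y) F' g) →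
        ∃ g, M.IsConfig A p₀ S p g ∧ M.Fills S F g) ∧
      ∀ g, M.IsConfig A p₀ S p g → M.Fills S F g → M.Fills (S.erase y) F' g := by
  classical
  have H' := H.erase hy hyp hear
  obtain ⟨f, hf, hfh⟩ := H.parent y hy hyp
  obtain ⟨f', hf', hfk⟩ := K.parent y hy hyp
  have hstep : ∀ d ∈ M.darts S y, IsStep (M.cost d) (h (M.tgt d) - h y) (k (M.tgt d) - k y) := by
    intro d hd
    have h1 := H.isStep K (M.mem_darts.1 hd).1
    rwa [src_of_mem hd] at h1
  have hside : ∀ c ∈ M.corners S y, IsStep (M.cost c) (h (M.tgt (M.turn c)) - h (M.tgt c))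
      (k (M.tgt (M.turn c)) - k (M.tgt c)) := by
    intro c hc
    have h1 := H.isStep K (M.mem_corners.1 hc).1.next.alive
    rwa [src_next_eq_tgt, ← tgt_turn, M.cost_next _ (M.mem_corners.1 hc).1.1] at h1
  have hne_next : ∀ d, M.Outer S d → ∀ c ∈ M.corners S y, d ≠ M.next c := by
    rintro d hd c hc rfl
    exact hd.2 (M.mem_corners.1 hc).1.next
  rcases hear with ⟨e, hD, hc⟩ | ⟨e, hD, hc⟩ | ⟨e, hD, hc, hne⟩
  · have hear : M.IsEar S y := .leaf e hD hc
    have ht := headTail_leaf hD hc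
    have he : e ∈ M.darts S y := ht.head_mem
    have hsrc := src_of_mem he
    have hout := ht.outer_nextIn_tail
    have hsn := ht.src_nextIn_tail
    rw [hD, Finset.mem_singleton] at hf
    rw [dual_darts, hD, Finset.mem_singleton] at hf'
    rw [hf] at hfh
    rw [hf', dual_tgt, dual_cost] at hfk
    -- a bare edge: both boundary values at its other end are the predecessor of the value at `y`
    have heq : F (M.nextIn S e) = F (M.rev e) := by
      refine A2Space.eq_of_leaf (M.cost_cases e) (p := p₀) (hF.edge e ht.outer_tail)
        (ht.rel_head hF) ?_ ?_ ?_ ?_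
      · rw [hF.dist_left _ ht.outer_tail, hF.dist_left _ hout, hsrc, hsn, hfh]
      · rw [hF.dist_right _ ht.outer_tail, hF.dist_right _ hout, hsrc, hsn, hfk]
      · rw [hF.dist_left _ ht.outer_tail, hF.dist_left _ ht.outer_rev_head, hsrc, hfh]; rfl
      · rw [hF.dist_right _ ht.outer_tail, hF.dist_right _ ht.outer_rev_head, hsrc, hfk]; rfl
    have hhead : ∀ z, M.Alive (S.erase y) z → M.src z = M.tgt e →
        F (M.nextIn (S.erase y) e) = F (M.rev e) := by
      intro z hz hze
      have hz' := alive_erase_iff.1 hz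
      rw [nextIn_erase_of_alive hz'.1 hze, heq]
      refine alive_erase_iff.2 ⟨hout.1, by rw [hsn]; exact hear.tgt_ne he, fun h1 => ?_⟩
      have h2 := eq_rev_of_nextIn_eq_rev hz'.1 hze (ht.eq_rev_head _ hout h1)
      exact hz'.2.2 (by rw [h2, tgt_rev, hsrc])
    have hold : ∀ d, M.Outer S d → M.Alive (S.erase y) d → F d = F d := fun _ _ _ => rfl
    refine ⟨F, ht.isBoundaryConfig hF hold hhead (by simp [hc]),
      ht.exists_config hyp hear H' hp hF hold hhead (fun d hd => .inl ?_),
      fun g _ hfill => fills_erase hfill hold (by simp [hc])⟩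
    rw [hD, Finset.mem_singleton] at hd
    exact hd
  · -- a triangle: its third side joins two points that `F` prescribes already
    have hear : M.IsEar S y := .one e hD hc
    have ht := headTail_one hD hc
    have hec : e ∈ M.corners S y := (hc e).2 rfl
    have hi := (M.mem_corners.1 hec).1.1
    have hsrc := src_of_mem ht.tail_mem
    have hout := ht.outer_nextIn_tail
    have hsn := ht.src_nextIn_tail
    have hct := M.cost_turn hi
    have hcn := M.cost_next e hi
    let F' : E → P := fun d => if d = M.next e then F (M.rev e) else F d
    have hF'1 : F' (M.next e) = F (M.rev e) := if_pos rfl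
    have hold : ∀ d, M.Outer S d → M.Alive (S.erase y) d → F' d = F d := fun d hd _ =>
      if_neg (hne_next d hd e hec)
    have hal := next_alive_erase hear hec
    have hhead : ∀ z, M.Alive (S.erase y) z → M.src z = M.tgt e →
        F' (M.nextIn (S.erase y) e) = F (M.rev e) := fun z _ _ => by
      rw [nextIn_eq_next hal, hF'1]
    have hz1 := hF.dist_left _ ht.outer_rev_head
    have hz2 := hF.dist_right _ ht.outer_rev_head
    have hy1 := hF.dist_left _ ht.outer_tail
    have hy2 := hF.dist_right _ ht.outer_tail
    have hx1 := hF.dist_left _ hout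
    have hx2 := hF.dist_right _ hout
    rw [hsrc] at hy1 hy2
    rw [hsn] at hx1 hx2
    refine ⟨F', ht.isBoundaryConfig hF hold hhead ?_,
      ht.exists_config hyp hear H' hp hF hold hhead ?_, ?_⟩
    · intro c hcc
      obtain rfl := (hc c).1 hcc
      rw [hF'1, nextIn_erase_next hear hec, ht.apply_nextIn_erase hold hhead hal.rev
        (M.tgt_turn c).symm hout, hcn]
      refine ⟨?_, hz1, hz2⟩
      have hx := hF.edge _ ht.outer_tail
      rw [hct] at hx
      apply A2Space.rel_of_ear (M.cost_cases c) (ht.rel_head hF) hx (p := p₀)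
      · rw [hz1, hz2, hy1, hy2]; exact hstep c ht.head_mem
      · rw [hx1, hx2, hy1, hy2, ← hct]; exact hstep _ ht.tail_mem
      · rw [hx1, hx2, hz1, hz2]; exact hside c hec
      · rw [hz1, hx1, hy1]
        rcases (hD f).1 hf with rfl | rfl
        · exact .inl hfh
        · exact .inr (by rw [hfh, hct])
      · rw [hz2, hx2, hy2]
        rcases (hD f').1 hf' with rfl | rfl
        · exact .inl hfk
        · right
          rw [hfk, dual_cost, hct, dual_tgt]; ring
    · intro d hd
      exact ((hD d).1 hd).imp_right .inl
    · intro g _ hfill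
      refine fills_erase hfill hold fun c hcc => ?_
      obtain rfl := (hc c).1 hcc
      rw [hF'1]
      exact hfill _ ht.outer_rev_head
  · -- two triangles: the vertex that they share with `y` becomes a boundary vertex, with value `W`
    have hear : M.IsEar S y := .two e hD hc hne
    have ht := headTail_two hD hc hne
    have hec : e ∈ M.corners S y := (hc e).2 (.inl rfl)
    have htc : M.turn e ∈ M.corners S y := (hc _).2 (.inr rfl)
    have hi := (M.mem_corners.1 hec).1.1
    have hi' := (M.mem_corners.1 htc).1.1
    have hsrc := src_of_mem ht.tail_mem
    have hout := ht.outer_nextIn_tail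
    have hsn := ht.src_nextIn_tail
    have hct := M.cost_turn hi
    have hct' : M.cost (M.turn (M.turn e)) = M.cost e := by rw [M.cost_turn hi', hct]; ring
    have hcn := M.cost_next e hi
    have hcn' := M.cost_next _ hi'
    have hal := next_alive_erase hear hec
    have hal' := next_alive_erase hear htc
    have hz1 := hF.dist_left _ ht.outer_rev_head
    have hz2 := hF.dist_right _ ht.outer_rev_head
    have hy1 := hF.dist_left _ ht.outer_tail
    have hy2 := hF.dist_right _ ht.outer_tail
    have hx1 := hF.dist_left _ hout
    have hx2 := hF.dist_right _ hout
    rw [hsrc] at hy1 hy2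
    rw [hsn] at hx1 hx2
    have hx := hF.edge _ ht.outer_tail
    rw [hct'] at hx
    have hsw := hstep _ (M.corners_subset _ _ htc)
    have hswx := hside _ htc
    rw [hct] at hsw hswx
    obtain ⟨W, r1, r2, r3, hW1, hW2, huniq⟩ := A2Space.exists_fourth (M.cost_cases e)
      (w1 := h (M.tgt (M.turn e))) (w2 := k (M.tgt (M.turn e))) (ht.rel_head hF) hx (p := p₀)
      (by rw [hz1, hz2, hy1, hy2]; exact hstep e ht.head_mem)
      (by rw [hx1, hx2, hy1, hy2, ← hct']; exact hstep _ ht.tail_mem)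
      (by rw [hy1, hy2]; exact hsw)
      (by rw [hz1, hz2]; exact hside e hec)
      (by rw [hx1, hx2]; exact hswx)
      (by
        rw [hz1, hx1, hy1]
        rcases (hD f).1 hf with rfl | rfl | rfl
        · exact .inl hfh
        · exact .inr (.inr (by rw [hfh, hct]))
        · exact .inr (.inl (by rw [hfh, hct'])))
      (by
        rw [hz2, hx2, hy2]
        rw [dual_cost, dual_tgt] at hfk
        rcases (hD f').1 hf' with rfl | rfl | rfl
        · exact .inl hfk
        · exact .inr (.inr (by rw [hfk, hct]; ring))
        · exact .inr (.inl (by rw [hfk, hct'])))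
      (by
        rw [hy1, hz1, hx1]
        rintro h2 ⟨h3, h4⟩
        exact hne (H.parent_unique ht.tail_mem ht.head_mem (hct'.trans h2) h2 h4 h3))
      (by
        rw [hy2, hz2, hx2]
        rintro h2 ⟨h3, h4⟩
        exact hne (K.parent_unique ht.tail_mem ht.head_mem (by rw [dual_cost, hct', h2]; rfl)
          (by rw [dual_cost, h2]; rfl) h4 h3))
    have hne' : M.next (M.turn e) ≠ M.next e := fun h1 => M.turn_ne hi (M.next_injective h1)
    let F' : E → P := fun d => if d = M.next e then F (M.rev e) else
      if d = M.next (M.turn e) then W else F d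
    have hF'1 : F' (M.next e) = F (M.rev e) := if_pos rfl
    have hF'2 : F' (M.next (M.turn e)) = W := (if_neg hne').trans (if_pos rfl)
    have hold : ∀ d, M.Outer S d → M.Alive (S.erase y) d → F' d = F d := fun d hd _ =>
      (if_neg (hne_next d hd e hec)).trans (if_neg (hne_next d hd _ htc))
    have hhead : ∀ z, M.Alive (S.erase y) z → M.src z = M.tgt e →
        F' (M.nextIn (S.erase y) e) = F (M.rev e) := fun z _ _ => by
      rw [nextIn_eq_next hal, hF'1]
    refine ⟨F', ht.isBoundaryConfig hF hold hhead ?_,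
      ht.exists_config hyp hear H' hp hF hold hhead ?_, ?_⟩
    · intro c hcc
      rcases (hc c).1 hcc with rfl | rfl
      · rw [hF'1, nextIn_erase_next hear hec, nextIn_eq_next hal', hF'2, hcn]
        exact ⟨r2, hz1, hz2⟩
      · rw [hF'2, nextIn_erase_next hear htc, ht.apply_nextIn_erase hold hhead hal'.rev
          (M.tgt_turn _).symm hout, hcn', hct]
        exact ⟨r3, hW1, hW2⟩
    · intro d hd
      rcases (hD d).1 hd with rfl | rfl | rfl
      · exact .inl rfl
      · refine .inr (.inr ⟨next_outer_erase hear htc, ?_⟩)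
        rw [hF'2, hct]; exact r1
      · exact .inr (.inl rfl)
    · intro g hg hfill
      refine fills_erase hfill hold fun c hcc => ?_
      have gz : g (M.tgt e) = F (M.rev e) := hfill _ ht.outer_rev_head
      rcases (hc c).1 hcc with rfl | rfl
      · rw [hF'1, gz]
      · rw [hF'2]
        have gx : g (M.tgt (M.turn (M.turn e))) = F (M.nextIn S (M.turn (M.turn e))) := by
          rw [← hsn]; exact hfill _ hout
        have gy : g y = F (M.turn (M.turn e)) := by
          rw [← hsrc]; exact hfill _ ht.outer_tail
        have htd := M.mem_darts.1 (M.corners_subset _ _ htc)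
        refine huniq _ ?_ ?_ ?_ (hg.dist_le H hp htd.1.2) (hg.dual.dist_le K kp htd.1.2)
        · have := hg.edge _ htd.1
          rwa [htd.2, gy, hct] at this
        · have := hg.edge _ (M.mem_corners.1 hec).1.next.alive
          rwa [src_next_eq_tgt, gz, hcn, ← tgt_turn] at this
        · have := hg.edge _ (M.mem_corners.1 htc).1.next.alive
          rwa [src_next_eq_tgt, ← tgt_turn, gx, hcn', hct] at this

/-- A boundary configuration extends uniquely to a configuration. -/
theorem exists_unique_config (H : M.IsRooted h S p) (K : M.dual.IsRooted k S p) (hp : h p = 0)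
    (kp : k p = 0) {F : E → P} (hF : M.IsBoundaryConfig A p₀ h k S F) :
    (∃ g, M.IsConfig A p₀ S p g ∧ M.Fills S F g) ∧
      ∀ g g', M.IsConfig A p₀ S p g → M.Fills S F g → M.IsConfig A p₀ S p g' → M.Fills S F g' →
        ∀ v ∈ S, g v = g' v := by
  induction hn : S.card generalizing S F with
  | zero =>
    have := Finset.card_pos.2 ⟨p, H.mem⟩
    omega
  | succ n ih =>
  by_cases hne : ∃ w ∈ S, w ≠ p
  · obtain ⟨y, hy, hyp, hear⟩ := H.exists_ear_ne hne
    obtain ⟨F', hF', hex, hfill⟩ := exists_reduction hear hy hyp H K hp kp hF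
    obtain ⟨h1, h2⟩ := ih (H.erase hy hyp hear) (K.erase hy hyp hear.dual) hF' (by
      rw [Finset.card_erase_of_mem hy, hn]; rfl)
    refine ⟨hex h1, fun g g' hg hgF hg' hgF' v hv => ?_⟩
    by_cases hvy : v = y
    · obtain ⟨a, b, ht⟩ : ∃ a b, M.HeadTail S y a b := by
        rcases hear with ⟨e, hD, hc⟩ | ⟨e, hD, hc⟩ | ⟨e, hD, hc, hne⟩
        exacts [⟨_, _, headTail_leaf hD hc⟩, ⟨_, _, headTail_one hD hc⟩,
          ⟨_, _, headTail_two hD hc hne⟩]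
      rw [hvy, ← src_of_mem ht.tail_mem, hgF _ ht.outer_tail, hgF' _ ht.outer_tail]
    · exact h2 g g' hg.erase (hfill g hg hgF) hg'.erase (hfill g' hg' hgF') v
        (Finset.mem_erase.2 ⟨hvy, hv⟩)
  · have hal := H.not_alive hne
    push Not at hne
    refine ⟨⟨fun _ => p₀, ⟨rfl, fun d hd => absurd hd (hal d)⟩, fun d hd => absurd hd.1 (hal d)⟩,
      fun g g' hg _ hg' _ v hv => ?_⟩
    rw [hne v hv, hg.base, hg'.base]

end TriMap

/-! ### Lattices and the affine Grassmannian -/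

/-- The `t`-adic valuation of a unit of `ℂ((t))`. -/
noncomputable def ord (u : ℂ⸨X⸩ˣ) : ℤ := (u : ℂ⸨X⸩).order

lemma ord_mul (u v : ℂ⸨X⸩ˣ) : ord (u * v) = ord u + ord v :=
  HahnSeries.order_mul u.ne_zero v.ne_zero

lemma ord_one : ord 1 = 0 := HahnSeries.order_one

lemma ord_inv (u : ℂ⸨X⸩ˣ) : ord u⁻¹ = -ord u := by
  have := ord_mul u u⁻¹
  rw [mul_inv_cancel, ord_one] at this
  omega

lemma ord_unitT : ord unitT = 1 := HahnSeries.order_single one_ne_zero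

lemma ord_unitT_zpow (n : ℤ) : ord (unitT ^ n) = n := by
  have hn : ∀ n : ℕ, ord (unitT ^ n) = n := by
    intro n
    induction n with
    | zero => simp [ord_one]
    | succ n ih => rw [pow_succ, ord_mul, ih, ord_unitT]; push_cast; rfl
  rcases Int.eq_nat_or_neg n with ⟨m, rfl | rfl⟩
  · rw [zpow_natCast, hn]
  · rw [zpow_neg, zpow_natCast, ord_inv, hn]

lemma mem_range_iff_ord (u : ℂ⸨X⸩ˣ) :
    (u : ℂ⸨X⸩) ∈ (algebraMap ℂ⟦X⟧ ℂ⸨X⸩).range ↔ 0 ≤ ord u := by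
  constructor
  · rintro ⟨g, hg⟩
    by_contra hneg
    have h1 : (u : ℂ⸨X⸩).coeff (ord u) ≠ 0 := by
      unfold ord
      exact HahnSeries.coeff_order_eq_zero.not.2 u.ne_zero
    rw [← hg, LaurentSeries.coe_algebraMap, PowerSeries.coeff_coe, if_pos (by omega)] at h1
    exact h1 rfl
  · intro h
    obtain ⟨n, hn⟩ := Int.eq_ofNat_of_zero_le h
    exact ⟨_, LaurentSeries.X_order_mul_powerSeriesPart hn.symm⟩

/-- The matrix has entries in `ℂ[[t]]`. -/
def IsIntegral (A : Matrix (Fin 3) (Fin 3) ℂ⸨X⸩) : Prop :=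
  A ∈ (algebraMap ℂ⟦X⟧ ℂ⸨X⸩).mapMatrix.range

lemma isIntegral_iff {A : Matrix (Fin 3) (Fin 3) ℂ⸨X⸩} :
    IsIntegral A ↔ ∀ i j, A i j ∈ (algebraMap ℂ⟦X⟧ ℂ⸨X⸩).range := by
  constructor
  · rintro ⟨B, rfl⟩ i j
    exact ⟨B i j, rfl⟩
  · intro h
    choose B hB using h
    exact ⟨Matrix.of B, Matrix.ext fun i j => hB i j⟩

lemma IsIntegral.mul {A B : Matrix (Fin 3) (Fin 3) ℂ⸨X⸩} (hA : IsIntegral A) (hB : IsIntegral B) :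
    IsIntegral (A * B) := by
  obtain ⟨A, rfl⟩ := hA
  obtain ⟨B, rfl⟩ := hB
  exact ⟨A * B, map_mul _ A B⟩

/-- The inclusion of `GL₃(ℂ[[t]])` into `GL₃(ℂ((t)))`. -/
noncomputable def intGL : GL (Fin 3) ℂ⟦X⟧ →* GL (Fin 3) ℂ⸨X⸩ :=
  Matrix.GeneralLinearGroup.map (algebraMap ℂ⟦X⟧ ℂ⸨X⸩)

lemma isIntegral_intGL (κ : GL (Fin 3) ℂ⟦X⟧) : IsIntegral (intGL κ).val := ⟨κ, rfl⟩

lemma exists_intGL {A : GL (Fin 3) ℂ⸨X⸩} (h : IsIntegral A.val)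
    (h' : IsIntegral A⁻¹.val) : ∃ κ, intGL κ = A := by
  obtain ⟨B, hB⟩ := h
  obtain ⟨B', hB'⟩ := h'
  have hinj : Function.Injective
      ((algebraMap ℂ⟦X⟧ ℂ⸨X⸩).mapMatrix : Matrix (Fin 3) (Fin 3) ℂ⟦X⟧ →+* _) :=
    Matrix.map_injective (IsFractionRing.injective ℂ⟦X⟧ ℂ⸨X⸩)
  have h1 : B * B' = 1 := hinj (by
    rw [map_mul, hB, hB', map_one, ← Units.val_mul, mul_inv_cancel, Units.val_one])
  have h2 : B' * B = 1 := hinj (by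
    rw [map_mul, hB, hB', map_one, ← Units.val_mul, inv_mul_cancel, Units.val_one])
  exact ⟨⟨B, B', h1, h2⟩, Units.ext hB⟩

lemma isIntegral_intGL_mul (κ κ' : GL (Fin 3) ℂ⟦X⟧) (A : GL (Fin 3) ℂ⸨X⸩) :
    IsIntegral (intGL κ * A * intGL κ').val ↔
      IsIntegral A.val := by
  constructor
  · intro h
    have := ((isIntegral_intGL κ⁻¹).mul h).mul (isIntegral_intGL κ'⁻¹)
    rwa [← Units.val_mul, ← Units.val_mul, map_inv, map_inv,
      show (intGL κ)⁻¹ * (intGL κ * A * intGL κ') * (intGL κ')⁻¹ = A by group] at this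
  · intro h
    exact ((isIntegral_intGL κ).mul h).mul (isIntegral_intGL κ')

/-- The scalar matrix `u`. -/
noncomputable def scalarGL : ℂ⸨X⸩ˣ →* GL (Fin 3) ℂ⸨X⸩ := Matrix.GeneralLinearGroup.scalar (Fin 3)

lemma scalarGL_comm (u : ℂ⸨X⸩ˣ) (g : GL (Fin 3) ℂ⸨X⸩) : g * scalarGL u = scalarGL u * g := by
  have h : scalarGL u ∈ Subgroup.center (GL (Fin 3) ℂ⸨X⸩) := by
    rw [Matrix.GeneralLinearGroup.center_eq_range_scalar]
    exact ⟨u, rfl⟩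
  exact Subgroup.mem_center_iff.1 h g

/-- The invertible diagonal matrix with the given entries. -/
noncomputable def diagGL (w : Fin 3 → ℂ⸨X⸩ˣ) : GL (Fin 3) ℂ⸨X⸩ :=
  Units.map (Matrix.diagonalRingHom (Fin 3) ℂ⸨X⸩).toMonoidHom (MulEquiv.piUnits.symm w)

lemma coe_diagGL (w : Fin 3 → ℂ⸨X⸩ˣ) :
    (diagGL w).val = Matrix.diagonal fun i => (w i : ℂ⸨X⸩) := rfl

lemma diagGL_mul (w w' : Fin 3 → ℂ⸨X⸩ˣ) : diagGL w * diagGL w' = diagGL (w * w') := by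
  rw [diagGL, diagGL, diagGL, map_mul, map_mul]

lemma diagGL_one : diagGL 1 = 1 := by rw [diagGL, map_one, map_one]

lemma scalarGL_eq (u : ℂ⸨X⸩ˣ) : scalarGL u = diagGL fun _ => u := by
  apply Units.ext
  rw [coe_diagGL]
  rfl

lemma isIntegral_diagGL (w : Fin 3 → ℂ⸨X⸩ˣ) :
    IsIntegral (diagGL w).val ↔ ∀ i, 0 ≤ ord (w i) := by
  rw [isIntegral_iff, coe_diagGL]
  constructor
  · intro h i
    have := h i i
    rwa [Matrix.diagonal_apply_eq, mem_range_iff_ord] at this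
  · intro h i j
    by_cases hij : i = j
    · subst hij
      rw [Matrix.diagonal_apply_eq, mem_range_iff_ord]
      exact h i
    · rw [Matrix.diagonal_apply_ne _ hij]
      exact zero_mem _

/-- The valuation of the determinant. -/
noncomputable def deg (g : GL (Fin 3) ℂ⸨X⸩) : ℤ := ord (Matrix.GeneralLinearGroup.det g)

lemma deg_mul (g h : GL (Fin 3) ℂ⸨X⸩) : deg (g * h) = deg g + deg h := by
  rw [deg, map_mul, ord_mul]; rfl

lemma deg_one : deg 1 = 0 := by rw [deg, map_one, ord_one]

lemma deg_diagGL (w : Fin 3 → ℂ⸨X⸩ˣ) : deg (diagGL w) = ord (w 0) + ord (w 1) + ord (w 2) := by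
  rw [deg, ← ord_mul, ← ord_mul]
  congr 1
  apply Units.ext
  rw [Matrix.GeneralLinearGroup.val_det_apply, coe_diagGL, Matrix.det_diagonal, Fin.prod_univ_three]
  rfl

lemma deg_scalarGL (u : ℂ⸨X⸩ˣ) : deg (scalarGL u) = 3 * ord u := by
  rw [scalarGL_eq, deg_diagGL]; ring

lemma deg_intGL (κ : GL (Fin 3) ℂ⟦X⟧) : deg (intGL κ) = 0 := by
  have key : ∀ κ : GL (Fin 3) ℂ⟦X⟧, 0 ≤ deg (intGL κ) := by
    intro κ
    rw [deg, ← mem_range_iff_ord]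
    exact ⟨Matrix.det (κ : Matrix (Fin 3) (Fin 3) ℂ⟦X⟧), by
      rw [Matrix.GeneralLinearGroup.val_det_apply, RingHom.map_det]; rfl⟩
  have h1 := key κ
  have h2 := key κ⁻¹
  have h3 := deg_mul (intGL κ) (intGL κ⁻¹)
  rw [← map_mul, mul_inv_cancel, map_one, deg_one] at h3
  omega

/-- The point of the affine Grassmannian represented by an invertible matrix. -/
noncomputable def pt (g : GL (Fin 3) ℂ⸨X⸩) : Gr := (Matrix.ProjGenLinGroup.mk g : PGL(3, ℂ⸨X⸩))

lemma pt_surjective (x : Gr) : ∃ g, pt g = x := by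
  obtain ⟨y, rfl⟩ := QuotientGroup.mk_surjective x
  obtain ⟨g, rfl⟩ := Matrix.ProjGenLinGroup.mk_surjective y
  exact ⟨g, rfl⟩

lemma smul_pt (c g : GL (Fin 3) ℂ⸨X⸩) : Matrix.ProjGenLinGroup.mk c • pt g = pt (c * g) := by
  rw [pt, pt, map_mul]; rfl

/-- Two matrices represent the same point if and only if they differ by a scalar and an integral
invertible matrix. -/
lemma pt_eq_iff {g g' : GL (Fin 3) ℂ⸨X⸩} :
    pt g = pt g' ↔ ∃ u κ, g' = g * intGL κ * scalarGL u := by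
  rw [pt, pt, QuotientGroup.eq, ← map_inv, ← map_mul]
  constructor
  · rintro ⟨y, hy⟩
    obtain ⟨κ, rfl⟩ := Matrix.ProjGenLinGroup.mk_surjective y
    rw [Matrix.ProjGenLinGroup.map_mk, Matrix.ProjGenLinGroup.mk_eq_mk_iff] at hy
    obtain ⟨u, hu⟩ := hy
    refine ⟨u, κ, ?_⟩
    rw [mul_assoc]
    exact eq_mul_of_inv_mul_eq hu.symm
  · rintro ⟨u, κ, rfl⟩
    refine ⟨Matrix.ProjGenLinGroup.mk κ, ?_⟩
    rw [Matrix.ProjGenLinGroup.map_mk, Matrix.ProjGenLinGroup.mk_eq_mk_iff]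
    exact ⟨u, by rw [mul_assoc, inv_mul_cancel_left]; rfl⟩

/-- The diagonal entries of `t^v`. -/
noncomputable def tEntries (v : Weight) : Fin 3 → ℂ⸨X⸩ˣ := ![unitT ^ (v.1 + v.2), unitT ^ v.2, 1]

lemma tPow_eq (v : Weight) : tPow v = pt (diagGL (tEntries v)) := rfl

lemma tPow_zero : tPow 0 = pt 1 := by
  rw [tPow_eq, ← diagGL_one]
  congr 2
  ext i
  fin_cases i <;> simp [tEntries]

/-- `t^m Λ_h ⊆ Λ_g`, where `Λ_g` is the lattice spanned by the columns of `g`. -/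
def Incl (m : ℤ) (g h : GL (Fin 3) ℂ⸨X⸩) : Prop :=
  IsIntegral (scalarGL (unitT ^ m) * (g⁻¹ * h)).val

/-- The weight-valued distance in terms of inclusions of lattices. -/
lemma GrDist.incl_iff {g h : GL (Fin 3) ℂ⸨X⸩} {v : Weight} (H : GrDist (pt g) (pt h) v) :
    (∀ m, Incl m g h ↔ v.1 + 2 * v.2 ≤ deg h + 3 * m - deg g) ∧
    (∀ m, Incl m h g ↔ 2 * v.1 + v.2 ≤ deg g + 3 * m - deg h) ∧
    ∃ j, deg h - deg g = v.1 + 2 * v.2 + 3 * j := by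
  obtain ⟨⟨ha, hb⟩, γ, h1, h2⟩ := H
  obtain ⟨c, rfl⟩ := Matrix.ProjGenLinGroup.mk_surjective γ
  rw [smul_pt, tPow_zero, eq_comm, pt_eq_iff] at h1
  rw [smul_pt, tPow_eq, eq_comm, pt_eq_iff] at h2
  obtain ⟨u, κ, hg⟩ := h1
  obtain ⟨u', κ', hh⟩ := h2
  rw [one_mul] at hg
  have dg := congrArg deg hg
  have dh := congrArg deg hh
  have e0 : ord (tEntries v 0) = v.1 + v.2 := ord_unitT_zpow _
  have e1 : ord (tEntries v 1) = v.2 := ord_unitT_zpow _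
  have e2 : ord (tEntries v 2) = 0 := ord_one
  rw [deg_mul, deg_mul, deg_intGL, deg_scalarGL] at dg
  rw [deg_mul, deg_mul, deg_mul, deg_intGL, deg_scalarGL, deg_diagGL, e0, e1, e2] at dh
  have hgh : g⁻¹ * h = intGL κ⁻¹ * (scalarGL (u⁻¹ * u') * diagGL (tEntries v)) * intGL κ' := by
    have : g⁻¹ * h = (c * g)⁻¹ * (c * h) := by group
    rw [this, hg, hh, mul_inv_rev, ← map_inv, ← map_inv, map_mul, scalarGL_comm u',
      ← scalarGL_comm u⁻¹]
    simp only [mul_assoc]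
  have hhg : h⁻¹ * g = intGL κ'⁻¹ * (scalarGL (u'⁻¹ * u) * diagGL (tEntries v)⁻¹) * intGL κ := by
    have hinv : diagGL (tEntries v)⁻¹ = (diagGL (tEntries v))⁻¹ :=
      eq_inv_of_mul_eq_one_left (by rw [diagGL_mul, inv_mul_cancel, diagGL_one])
    have : h⁻¹ * g = (c * h)⁻¹ * (c * g) := by group
    rw [this, hg, hh, hinv, scalarGL_comm u', scalarGL_comm u, mul_inv_rev, mul_inv_rev,
      ← scalarGL_comm (u'⁻¹ * u)]
    simp only [map_mul, map_inv, mul_assoc]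
  refine ⟨fun m => ?_, fun m => ?_, ?_⟩
  · have : scalarGL (unitT ^ m) * (g⁻¹ * h) = intGL κ⁻¹ *
        diagGL ((fun _ => unitT ^ m * (u⁻¹ * u')) * tEntries v) * intGL κ' := by
      rw [hgh, ← diagGL_mul, ← scalarGL_eq, map_mul scalarGL (unitT ^ m)]
      rw [← mul_assoc, ← mul_assoc, ← scalarGL_comm (unitT ^ m) (intGL κ⁻¹)]
      simp only [mul_assoc]
    rw [Incl, this, isIntegral_intGL_mul, isIntegral_diagGL, Fin.forall_fin_succ,
      Fin.forall_fin_two]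
    simp only [Pi.mul_apply, ord_mul, ord_inv, ord_unitT_zpow, Fin.succ_zero_eq_one,
      Fin.succ_one_eq_two, e0, e1, e2]
    omega
  · have : scalarGL (unitT ^ m) * (h⁻¹ * g) = intGL κ'⁻¹ *
        diagGL ((fun _ => unitT ^ m * (u'⁻¹ * u)) * (tEntries v)⁻¹) * intGL κ := by
      rw [hhg, ← diagGL_mul, ← scalarGL_eq, map_mul scalarGL (unitT ^ m)]
      rw [← mul_assoc, ← mul_assoc, ← scalarGL_comm (unitT ^ m) (intGL κ'⁻¹)]
      simp only [mul_assoc]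
    rw [Incl, this, isIntegral_intGL_mul, isIntegral_diagGL, Fin.forall_fin_succ,
      Fin.forall_fin_two]
    simp only [Pi.mul_apply, Pi.inv_apply, ord_mul, ord_inv, ord_unitT_zpow, Fin.succ_zero_eq_one,
      Fin.succ_one_eq_two, e0, e1, e2]
    omega
  · exact ⟨ord u' - ord u, by omega⟩

/-! ### The Cartan decomposition -/

/-- Smith normal form over the discrete valuation ring `ℂ[[t]]`. -/
lemma exists_smith (B : Matrix (Fin 3) (Fin 3) ℂ⟦X⟧) (hB : B.det ≠ 0) :
    ∃ (κ κ' : GL (Fin 3) ℂ⟦X⟧) (e : Fin 3 → ℕ), Antitone e ∧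
      B = κ.val * Matrix.diagonal (fun i => PowerSeries.X ^ e i) * κ'.val := by
  have hinj : Function.Injective B.mulVecLin := by
    rw [← LinearMap.ker_eq_bot, LinearMap.ker_eq_bot']
    intro v hv
    exact Matrix.eq_zero_of_mulVec_eq_zero hB hv
  obtain ⟨b, a, n, hn⟩ := Submodule.exists_smith_normal_form_of_rank_eq
    (N := LinearMap.range B.mulVecLin) (Pi.basisFun ℂ⟦X⟧ (Fin 3))
    (LinearMap.finrank_range_of_inj hinj)
  let c := n.map (LinearEquiv.ofInjective B.mulVecLin hinj).symm
  have hc : ∀ i, B.mulVec (c i) = a i • b i := by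
    intro i
    rw [← hn i]
    have := congrArg Subtype.val
      ((LinearEquiv.ofInjective B.mulVecLin hinj).apply_symm_apply (n i))
    exact this
  have ha : ∀ i, a i ≠ 0 := by
    intro i h0
    have := hc i
    rw [h0, zero_smul] at this
    exact c.ne_zero i (Matrix.eq_zero_of_mulVec_eq_zero hB this)
  choose e u he using fun i =>
    IsDiscreteValuationRing.eq_unit_mul_pow_irreducible (ha i)
      (PowerSeries.X_irreducible (R := ℂ))
  -- the order is reversed because `Tuple.sort` sorts increasingly
  let σ : Equiv.Perm (Fin 3) := Tuple.sort (fun i => OrderDual.toDual (e i))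
  have hσ : Antitone (e ∘ σ) := fun i j hij =>
    Tuple.monotone_sort (fun i => OrderDual.toDual (e i)) hij
  let b' := (b.unitsSMul u).reindex σ.symm
  let c' := c.reindex σ.symm
  have key : ∀ i, B.mulVec (c' i) = (PowerSeries.X ^ e (σ i) : ℂ⟦X⟧) • b' i := by
    intro i
    simp only [b', c', Module.Basis.reindex_apply, Equiv.symm_symm, Module.Basis.unitsSMul_apply]
    rw [hc, he, Units.smul_def, smul_smul, mul_comm]
  let s := Pi.basisFun ℂ⟦X⟧ (Fin 3)
  let P : GL (Fin 3) ℂ⟦X⟧ := ⟨s.toMatrix b', b'.toMatrix s, s.toMatrix_mul_toMatrix_flip b',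
    b'.toMatrix_mul_toMatrix_flip s⟩
  let C : GL (Fin 3) ℂ⟦X⟧ := ⟨s.toMatrix c', c'.toMatrix s, s.toMatrix_mul_toMatrix_flip c',
    c'.toMatrix_mul_toMatrix_flip s⟩
  have hBC : B * C.val = P.val * Matrix.diagonal (fun i => PowerSeries.X ^ (e ∘ σ) i) := by
    ext1 i j
    rw [Matrix.mul_diagonal]
    have := congrFun (key j) i
    rw [Pi.smul_apply, smul_eq_mul, mul_comm] at this
    exact this
  refine ⟨P, C⁻¹, e ∘ σ, hσ, ?_⟩
  rw [← hBC, mul_assoc, ← Units.val_mul, mul_inv_cancel, Units.val_one, mul_one]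

lemma algebraMap_X : algebraMap ℂ⟦X⟧ ℂ⸨X⸩ PowerSeries.X = (unitT : ℂ⸨X⸩) := by
  rw [LaurentSeries.coe_algebraMap]
  exact HahnSeries.ofPowerSeries_X

/-- Every invertible matrix over `ℂ((t))` is in the double coset of a dominant `t^v`, up to a
scalar. -/
lemma exists_cartan (A : GL (Fin 3) ℂ⸨X⸩) : ∃ (κ κ' : GL (Fin 3) ℂ⟦X⟧) (u : ℂ⸨X⸩ˣ) (v : Weight),
    v.IsDominant ∧ A = intGL κ * diagGL (tEntries v) * intGL κ' * scalarGL u := by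
  obtain ⟨⟨r, hr⟩, hB⟩ := IsLocalization.exist_integer_multiples_of_finite
    (nonZeroDivisors ℂ⟦X⟧) (fun ij : Fin 3 × Fin 3 => A.val ij.1 ij.2)
  choose B hB using hB
  have hr0 : algebraMap ℂ⟦X⟧ ℂ⸨X⸩ r ≠ 0 :=
    IsFractionRing.to_map_ne_zero_of_mem_nonZeroDivisors hr
  let w : ℂ⸨X⸩ˣ := Units.mk0 _ hr0
  have hmap : (Matrix.of fun i j => B (i, j)).map (algebraMap ℂ⟦X⟧ ℂ⸨X⸩)
      = (scalarGL w * A).val := by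
    ext1 i j
    rw [scalarGL_eq, Units.val_mul, coe_diagGL, Matrix.diagonal_mul]
    exact (hB (i, j)).trans (Algebra.smul_def _ _)
  obtain ⟨κ, κ', e, he, hκ⟩ := exists_smith (Matrix.of fun i j => B (i, j)) (by
    intro h0
    have h1 := congrArg Matrix.det hmap
    rw [← RingHom.mapMatrix_apply, ← RingHom.map_det, h0, map_zero] at h1
    exact (Matrix.GeneralLinearGroup.det (scalarGL w * A)).ne_zero h1.symm)
  have hd : scalarGL w * A = intGL κ * diagGL (fun i => unitT ^ e i) * intGL κ' := by
    apply Units.ext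
    rw [← hmap, hκ, Matrix.map_mul, Matrix.map_mul, Matrix.diagonal_map (map_zero _), Units.val_mul,
      Units.val_mul, coe_diagGL]
    simp only [map_pow, algebraMap_X, Units.val_pow_eq_pow_val]
    rfl
  have h01 : e 1 ≤ e 0 := he (by decide)
  have h12 : e 2 ≤ e 1 := he (by decide)
  refine ⟨κ, κ', w⁻¹ * unitT ^ e 2, (e 0 - e 1, e 1 - e 2), ⟨?_, ?_⟩, ?_⟩
  · simp only; omega
  · simp only; omega
  have hdiag : diagGL (fun i => unitT ^ e i) =
      scalarGL (unitT ^ e 2) * diagGL (tEntries (e 0 - e 1, e 1 - e 2)) := by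
    rw [scalarGL_eq, diagGL_mul]
    congr 1
    ext1 i
    fin_cases i <;> simp [tEntries, ← zpow_natCast, ← zpow_add]
  rw [scalarGL_comm, map_mul, map_inv, mul_assoc, eq_inv_mul_iff_mul_eq, hd, hdiag]
  rw [← mul_assoc (intGL κ), scalarGL_comm]
  simp only [mul_assoc]

/-- Any two points of the affine Grassmannian have a weight-valued distance. -/
lemma exists_grDist (x y : Gr) : ∃ v, GrDist x y v := by
  obtain ⟨g, rfl⟩ := pt_surjective x
  obtain ⟨h, rfl⟩ := pt_surjective y
  obtain ⟨κ, κ', u, v, hv, hA⟩ := exists_cartan (g⁻¹ * h)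
  refine ⟨v, hv, Matrix.ProjGenLinGroup.mk (intGL κ⁻¹ * g⁻¹), ?_, ?_⟩
  · rw [smul_pt, tPow_zero, eq_comm, pt_eq_iff]
    exact ⟨1, κ⁻¹, by simp⟩
  · rw [smul_pt, tPow_eq, eq_comm, pt_eq_iff]
    refine ⟨u, κ', ?_⟩
    rw [mul_assoc, hA, map_inv]
    group

/-! ### The affine Grassmannian as an `A₂`-space -/

/-- The asymmetric integral distance on the affine Grassmannian: it is `a + 2 b` where the
weight-valued distance is `a ω₁ + b ω₂`. -/
noncomputable def grDist (x y : Gr) : ℤ :=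
  (exists_grDist x y).choose.1 + 2 * (exists_grDist x y).choose.2

lemma grDist_nonneg (x y : Gr) : 0 ≤ grDist x y := by
  obtain ⟨⟨h1, h2⟩, -⟩ := (exists_grDist x y).choose_spec
  unfold grDist
  omega

lemma incl_iff_grDist (m : ℤ) (g h : GL (Fin 3) ℂ⸨X⸩) :
    Incl m g h ↔ grDist (pt g) (pt h) ≤ deg h + 3 * m - deg g :=
  (exists_grDist (pt g) (pt h)).choose_spec.incl_iff.1 m

lemma exists_deg_sub_eq (g h : GL (Fin 3) ℂ⸨X⸩) :
    ∃ j, deg h - deg g = grDist (pt g) (pt h) + 3 * j :=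
  (exists_grDist (pt g) (pt h)).choose_spec.incl_iff.2.2

/-- The weight-valued distance is determined by the integral ones; in particular it is unique. -/
lemma GrDist.grDist_eq {x y : Gr} {v : Weight} (H : GrDist x y v) :
    grDist x y = v.1 + 2 * v.2 ∧ grDist y x = 2 * v.1 + v.2 := by
  obtain ⟨g, rfl⟩ := pt_surjective x
  obtain ⟨h, rfl⟩ := pt_surjective y
  obtain ⟨h1, h2, j, h3⟩ := H.incl_iff
  obtain ⟨i, hi⟩ := exists_deg_sub_eq g h
  obtain ⟨k, hk⟩ := exists_deg_sub_eq h g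
  -- values of `m` for which the bounds by `grDist` and by the length of `v` are attained
  have e1 := (incl_iff_grDist (-i) g h).symm.trans (h1 (-i))
  have e2 := (incl_iff_grDist (-j) g h).symm.trans (h1 (-j))
  have e3 := (incl_iff_grDist (-k) h g).symm.trans (h2 (-k))
  have e4 := (incl_iff_grDist (j + v.1 + v.2) h g).symm.trans (h2 (j + v.1 + v.2))
  omega

lemma GrDist.of_grDist_eq {x y : Gr} {v : Weight} (h1 : grDist x y = v.1 + 2 * v.2)
    (h2 : grDist y x = 2 * v.1 + v.2) : GrDist x y v := by
  obtain ⟨w, hw⟩ := exists_grDist x y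
  obtain ⟨e1, e2⟩ := hw.grDist_eq
  have : v = w := Prod.ext (by omega) (by omega)
  rwa [this]

lemma grDist_smul (γ : PGL(3, ℂ⸨X⸩)) (x y : Gr) : grDist (γ • x) (γ • y) = grDist x y := by
  obtain ⟨v, hv⟩ := exists_grDist x y
  rw [hv.grDist_eq.1]
  obtain ⟨hd, c, h1, h2⟩ := hv
  exact (GrDist.grDist_eq (v := v) ⟨hd, c * γ⁻¹, by rw [smul_smul, inv_mul_cancel_right, h1],
    by rw [smul_smul, inv_mul_cancel_right, h2]⟩).1

lemma pt_mul_scalarGL (g : GL (Fin 3) ℂ⸨X⸩) (u : ℂ⸨X⸩ˣ) : pt (g * scalarGL u) = pt g :=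
  (pt_eq_iff.2 ⟨u, 1, by rw [map_one, mul_one]⟩).symm

/-- A point has representatives of all degrees that the distance from a given representative of
another point allows. -/
lemma exists_deg_eq (g : GL (Fin 3) ℂ⸨X⸩) (x : Gr) (m : ℤ) :
    ∃ h, pt h = x ∧ deg h = deg g + grDist (pt g) x + 3 * m := by
  obtain ⟨h, rfl⟩ := pt_surjective x
  obtain ⟨j, hj⟩ := exists_deg_sub_eq g h
  refine ⟨h * scalarGL (unitT ^ (m - j)), pt_mul_scalarGL _ _, ?_⟩
  rw [deg_mul, deg_scalarGL, ord_unitT_zpow]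
  omega

/-- The same with the roles of the two points exchanged. -/
lemma exists_deg_eq' (g : GL (Fin 3) ℂ⸨X⸩) (x : Gr) (m : ℤ) :
    ∃ h, pt h = x ∧ deg g = deg h + grDist x (pt g) + 3 * m := by
  obtain ⟨h, rfl⟩ := pt_surjective x
  obtain ⟨j, hj⟩ := exists_deg_sub_eq h g
  refine ⟨h * scalarGL (unitT ^ (j - m)), pt_mul_scalarGL _ _, ?_⟩
  rw [deg_mul, deg_scalarGL, ord_unitT_zpow]
  omega

/-- The `ℂ[[t]]`-linear map from the standard lattice with matrix `g`. -/
noncomputable def latticeMap (g : GL (Fin 3) ℂ⸨X⸩) : (Fin 3 → ℂ⟦X⟧) →ₗ[ℂ⟦X⟧] (Fin 3 → ℂ⸨X⸩) :=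
  (g.val.mulVecLin.restrictScalars ℂ⟦X⟧) ∘ₗ (Algebra.linearMap ℂ⟦X⟧ ℂ⸨X⸩).compLeft (Fin 3)

lemma latticeMap_apply (g : GL (Fin 3) ℂ⸨X⸩) (w : Fin 3 → ℂ⟦X⟧) :
    latticeMap g w = g.val.mulVec fun i => algebraMap ℂ⟦X⟧ ℂ⸨X⸩ (w i) := rfl

lemma latticeMap_injective (g : GL (Fin 3) ℂ⸨X⸩) : Function.Injective (latticeMap g) := by
  intro w w' h
  have := congrArg g⁻¹.val.mulVec h
  rw [latticeMap_apply, latticeMap_apply, Matrix.mulVec_mulVec, Matrix.mulVec_mulVec,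
    ← Units.val_mul, inv_mul_cancel, Units.val_one, Matrix.one_mulVec, Matrix.one_mulVec] at this
  ext1 i
  exact IsFractionRing.injective ℂ⟦X⟧ ℂ⸨X⸩ (congrFun this i)

/-- The lattice spanned by the columns of `g`. -/
noncomputable def lattice (g : GL (Fin 3) ℂ⸨X⸩) : Submodule ℂ⟦X⟧ (Fin 3 → ℂ⸨X⸩) :=
  (latticeMap g).range

lemma lattice_le_iff_isIntegral {g h : GL (Fin 3) ℂ⸨X⸩} :
    lattice h ≤ lattice g ↔ IsIntegral (g⁻¹ * h).val := by
  constructor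
  · intro H
    rw [isIntegral_iff]
    intro i j
    obtain ⟨w, hw⟩ := H (x := h.val.mulVec (Pi.single j 1)) ⟨Pi.single j 1, by
      rw [latticeMap_apply]
      congr 1
      ext1 k
      by_cases hk : k = j
      · subst hk; simp
      · simp [hk]⟩
    refine ⟨w i, ?_⟩
    have := congrArg (fun v => g⁻¹.val.mulVec v i) hw
    simp only [latticeMap_apply, Matrix.mulVec_mulVec, ← Units.val_mul] at this
    rw [inv_mul_cancel, Units.val_one, Matrix.one_mulVec] at this
    rw [Matrix.mulVec_single_one] at this
    exact this
  · rintro ⟨B, hB⟩ _ ⟨w, rfl⟩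
    refine ⟨B.mulVec w, ?_⟩
    have : h = g * (g⁻¹ * h) := by group
    rw [latticeMap_apply, latticeMap_apply, this, Units.val_mul, ← hB, ← Matrix.mulVec_mulVec]
    congr 1
    ext1 i
    exact RingHom.map_mulVec (algebraMap ℂ⟦X⟧ ℂ⸨X⸩) B w i

/-- Inclusion of lattices in terms of the integral distance. -/
lemma lattice_le_iff {g h : GL (Fin 3) ℂ⸨X⸩} :
    lattice h ≤ lattice g ↔ grDist (pt g) (pt h) ≤ deg h - deg g := by
  have := incl_iff_grDist 0 g h
  rw [Incl, zpow_zero, map_one, one_mul] at this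
  rw [lattice_le_iff_isIntegral, this]
  omega

lemma pt_eq_of_lattice_eq {g h : GL (Fin 3) ℂ⸨X⸩} (H : lattice g = lattice h) : pt g = pt h := by
  obtain ⟨κ, hκ⟩ := exists_intGL (lattice_le_iff_isIntegral.1 H.ge) (by
    rw [mul_inv_rev, inv_inv]; exact lattice_le_iff_isIntegral.1 H.le)
  exact pt_eq_iff.2 ⟨1, κ, by rw [hκ, map_one, mul_one, mul_inv_cancel_left]⟩

lemma grDist_self (x : Gr) : grDist x x = 0 :=
  (GrDist.grDist_eq (v := 0) ⟨⟨le_rfl, le_rfl⟩, by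
    obtain ⟨g, rfl⟩ := pt_surjective x
    refine ⟨Matrix.ProjGenLinGroup.mk g⁻¹, ?_⟩
    rw [smul_pt, inv_mul_cancel, tPow_zero]
    exact ⟨rfl, rfl⟩⟩).1

lemma lattice_eq_of_pt_eq {g h : GL (Fin 3) ℂ⸨X⸩} (H : pt g = pt h) (hd : deg g = deg h) :
    lattice g = lattice h :=
  le_antisymm (lattice_le_iff.2 (by rw [H, grDist_self]; omega))
    (lattice_le_iff.2 (by rw [H, grDist_self]; omega))

lemma mem_lattice_mul_diagGL {g : GL (Fin 3) ℂ⸨X⸩} {w : Fin 3 → ℂ⟦X⟧} :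
    latticeMap g w ∈ lattice (g * diagGL (tEntries (1, 0))) ↔ PowerSeries.X ∣ w 0 := by
  have key : ∀ w : Fin 3 → ℂ⟦X⟧, latticeMap (g * diagGL (tEntries (1, 0))) w =
      latticeMap g ![PowerSeries.X * w 0, w 1, w 2] := by
    intro w
    rw [latticeMap_apply, latticeMap_apply, Units.val_mul, ← Matrix.mulVec_mulVec, coe_diagGL]
    congr 1
    ext1 i
    rw [Matrix.mulVec_diagonal]
    fin_cases i <;> simp [tEntries, unitT]
  constructor
  · rintro ⟨w', hw'⟩
    rw [key] at hw'
    rw [← latticeMap_injective g hw']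
    exact ⟨w' 0, rfl⟩
  · rintro ⟨q, hq⟩
    refine ⟨![q, w 1, w 2], ?_⟩
    rw [key]
    congr 1
    ext1 i
    fin_cases i
    · exact hq.symm
    · rfl
    · rfl

/-- The sublattice on which the first coordinate is divisible by `t` is maximal, because the residue
ring of `ℂ[[t]]` is a field. -/
lemma lattice_mul_diagGL_covBy (g : GL (Fin 3) ℂ⸨X⸩) :
    lattice (g * diagGL (tEntries (1, 0))) ⋖ lattice g := by
  refine ⟨lt_of_le_of_ne ?_ fun h => ?_, fun N h1 h2 => h2.not_ge ?_⟩
  · rw [lattice_le_iff_isIntegral, inv_mul_cancel_left, isIntegral_diagGL]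
    intro i
    fin_cases i
    · exact (ord_unitT_zpow _).symm ▸ (by simp)
    · exact (ord_unitT_zpow _).symm ▸ le_rfl
    · exact ord_one.ge
  · have : latticeMap g (Pi.single 0 1) ∈ lattice g := ⟨_, rfl⟩
    rw [← h, mem_lattice_mul_diagGL, PowerSeries.X_dvd_iff] at this
    simp at this
  · obtain ⟨v, hv, hv'⟩ := SetLike.exists_of_lt h1
    obtain ⟨w, rfl⟩ := h2.le hv
    rw [mem_lattice_mul_diagGL, PowerSeries.X_dvd_iff] at hv'
    obtain ⟨u, hu⟩ := PowerSeries.isUnit_iff_constantCoeff.2 (isUnit_iff_ne_zero.2 hv')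
    rintro _ ⟨w', rfl⟩
    have h3 : latticeMap g (w' - (w' 0 * u⁻¹.val) • w) ∈ N := h1.le (by
      rw [mem_lattice_mul_diagGL, Pi.sub_apply, Pi.smul_apply, ← hu, smul_eq_mul, mul_assoc,
        Units.inv_mul, mul_one, sub_self]
      exact dvd_zero _)
    rw [map_sub, map_smul] at h3
    exact (N.sub_mem_iff_left (N.smul_mem _ hv)).1 h3

lemma deg_diagGL_tEntries (v : Weight) : deg (diagGL (tEntries v)) = v.1 + 2 * v.2 := by
  rw [deg_diagGL, show ord (tEntries v 0) = v.1 + v.2 from ord_unitT_zpow _,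
    show ord (tEntries v 1) = v.2 from ord_unitT_zpow _, show ord (tEntries v 2) = 0 from ord_one]
  ring

/-- Two lattices that represent an edge, in degrees that differ by one, are adjacent. -/
lemma lattice_covBy {g h : GL (Fin 3) ℂ⸨X⸩} (H : grDist (pt g) (pt h) = 1)
    (hd : deg h = deg g + 1) : lattice h ⋖ lattice g := by
  obtain ⟨⟨a, b⟩, hv⟩ := exists_grDist (pt g) (pt h)
  have hv1 := hv.grDist_eq.1
  obtain ⟨⟨ha, hb⟩, γ, hx, hy⟩ := hv
  simp only at ha hb hv1
  obtain ⟨rfl, rfl⟩ : a = 1 ∧ b = 0 := by omega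
  obtain ⟨c, rfl⟩ := Matrix.ProjGenLinGroup.mk_surjective γ
  rw [smul_pt, tPow_zero] at hx
  rw [smul_pt, tPow_eq] at hy
  have hc : deg c⁻¹ = - deg c := by
    have := deg_mul c⁻¹ c
    rw [inv_mul_cancel, deg_one] at this
    omega
  obtain ⟨j, hj⟩ := exists_deg_sub_eq 1 (c * g)
  rw [hx, grDist_self, deg_mul, deg_one] at hj
  let k := c⁻¹ * scalarGL (unitT ^ j)
  have hk : deg k = deg g := by
    rw [deg_mul, deg_scalarGL, ord_unitT_zpow, hc]
    omega
  have hg : lattice g = lattice k := lattice_eq_of_pt_eq (by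
    rw [pt_mul_scalarGL, ← mul_one c⁻¹, ← smul_pt, ← hx, smul_pt, inv_mul_cancel_left]) hk.symm
  have hh : lattice h = lattice (k * diagGL (tEntries (1, 0))) := lattice_eq_of_pt_eq (by
    rw [mul_assoc, ← scalarGL_comm, ← mul_assoc, pt_mul_scalarGL, ← smul_pt, ← hy, smul_pt,
      inv_mul_cancel_left]) (by
    rw [deg_mul, hk, deg_diagGL_tEntries, hd]
    ring)
  rw [hg, hh]
  exact lattice_mul_diagGL_covBy k

lemma grDist_triangle (x y z : Gr) : grDist x z ≤ grDist x y + grDist y z := by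
  obtain ⟨g, rfl⟩ := pt_surjective x
  obtain ⟨h, rfl, hh⟩ := exists_deg_eq g y 0
  obtain ⟨k, rfl, hk⟩ := exists_deg_eq h z 0
  have h1 : lattice h ≤ lattice g := lattice_le_iff.2 (by omega)
  have h2 : lattice k ≤ lattice h := lattice_le_iff.2 (by omega)
  have := lattice_le_iff.1 (h2.trans h1)
  omega

lemma grDist_eq_one {g h : GL (Fin 3) ℂ⸨X⸩} (H : lattice h ≤ lattice g)
    (hd : deg h = deg g + 1) : grDist (pt g) (pt h) = 1 := by
  have h1 := lattice_le_iff.1 H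
  obtain ⟨j, hj⟩ := exists_deg_sub_eq g h
  have := grDist_nonneg (pt g) (pt h)
  omega

lemma eq_of_grDist_eq_zero {x y : Gr} (h : grDist x y = 0) : x = y := by
  obtain ⟨v, hv⟩ := exists_grDist x y
  have h1 := hv.grDist_eq.1
  obtain ⟨⟨ha, hb⟩, c, hx, hy⟩ := hv
  have : v = 0 :=
    Prod.ext (by simp only [Prod.fst_zero]; omega) (by simp only [Prod.snd_zero]; omega)
  rw [this, ← hx] at hy
  exact (MulAction.injective c hy).symm

lemma grDist_symm_of_edge {x y : Gr} (h : grDist x y = 1) : grDist y x = 2 := by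
  obtain ⟨v, hv⟩ := exists_grDist x y
  have h1 := hv.grDist_eq
  obtain ⟨⟨ha, hb⟩, -⟩ := hv
  omega

lemma grDist_le_two_mul (x y : Gr) : grDist y x ≤ 2 * grDist x y := by
  obtain ⟨v, hv⟩ := exists_grDist x y
  have h1 := hv.grDist_eq
  obtain ⟨⟨ha, hb⟩, -⟩ := hv
  omega

/-- The representatives are chosen so that `lattice L` is contained in `lattice g`, but not in
`lattice h`. -/
lemma lattice_eq_sup {g h L : GL (Fin 3) ℂ⸨X⸩} (H : grDist (pt g) (pt h) = 1)
    (hd : deg h = deg g + 1) (h1 : grDist (pt g) (pt L) + 2 = grDist (pt h) (pt L))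
    (h2 : deg L = deg h + grDist (pt h) (pt L) - 3) : lattice h ⊔ lattice L = lattice g := by
  have hL : lattice L ≤ lattice g := lattice_le_iff.2 (by omega)
  have hL' : ¬ lattice L ≤ lattice h := fun hle => by
    have := lattice_le_iff.1 hle
    omega
  have hc := lattice_covBy H hd
  exact (hc.eq_or_eq le_sup_left (sup_le hc.le hL)).resolve_left fun he => hL' (sup_eq_left.1 he)

/-- The dual statement: `lattice l` is contained in `lattice L`, but `lattice h` is not. -/
lemma lattice_eq_inf {h l L : GL (Fin 3) ℂ⸨X⸩} (H : grDist (pt h) (pt l) = 1)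
    (hd : deg l = deg h + 1) (h1 : grDist (pt L) (pt l) + 2 = grDist (pt L) (pt h))
    (h2 : deg h = deg L + grDist (pt L) (pt h) - 3) : lattice h ⊓ lattice L = lattice l := by
  have hL : lattice l ≤ lattice L := lattice_le_iff.2 (by omega)
  have hL' : ¬ lattice h ≤ lattice L := fun hle => by
    have := lattice_le_iff.1 hle
    omega
  have hc := lattice_covBy H hd
  exact (hc.eq_or_eq (le_inf hc.le hL) inf_le_left).resolve_right fun he => hL' (inf_eq_left.1 he)

lemma grDist_pred_unique {p x x' y : Gr} (hx : grDist x y = 1) (hx' : grDist x' y = 1)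
    (h : grDist x p + 2 = grDist y p) (h' : grDist x' p + 2 = grDist y p) : x = x' := by
  obtain ⟨k, rfl⟩ := pt_surjective y
  obtain ⟨L, rfl, hL⟩ := exists_deg_eq k p (-1)
  obtain ⟨g, rfl, hg⟩ := exists_deg_eq' k x 0
  obtain ⟨g', rfl, hg'⟩ := exists_deg_eq' k x' 0
  apply pt_eq_of_lattice_eq
  rw [← lattice_eq_sup hx (by omega) h (by omega), ← lattice_eq_sup hx' (by omega) h' (by omega)]

lemma grDist_succ_unique {p y z z' : Gr} (hz : grDist y z = 1) (hz' : grDist y z' = 1)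
    (h : grDist p z + 2 = grDist p y) (h' : grDist p z' + 2 = grDist p y) : z = z' := by
  obtain ⟨k, rfl⟩ := pt_surjective y
  obtain ⟨L, rfl, hL⟩ := exists_deg_eq' k p (-1)
  obtain ⟨l, rfl, hl⟩ := exists_deg_eq k z 0
  obtain ⟨l', rfl, hl'⟩ := exists_deg_eq k z' 0
  apply pt_eq_of_lattice_eq
  rw [← lattice_eq_inf hz (by omega) h (by omega), ← lattice_eq_inf hz' (by omega) h' (by omega)]

lemma grDist_triangle_of_pred {p x y z : Gr} (hxy : grDist x y = 1) (hyz : grDist y z = 1)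
    (h : grDist x p + 2 = grDist y p) (h' : grDist z p + 1 = grDist y p) : grDist z x = 1 := by
  have hzy := grDist_symm_of_edge hyz
  obtain ⟨k, rfl⟩ := pt_surjective y
  obtain ⟨L, rfl, hL⟩ := exists_deg_eq k p (-1)
  obtain ⟨g, rfl, hg⟩ := exists_deg_eq' k x 0
  obtain ⟨l, rfl, hl⟩ := exists_deg_eq' k z 0
  refine grDist_eq_one ?_ (by omega)
  rw [← lattice_eq_sup hxy (by omega) h (by omega)]
  exact sup_le (lattice_le_iff.2 (by omega)) (lattice_le_iff.2 (by omega))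

lemma grDist_triangle_of_succ {p x y z : Gr} (hxy : grDist x y = 1) (hyz : grDist y z = 1)
    (h : grDist p z + 2 = grDist p y) (h' : grDist p x + 1 = grDist p y) : grDist z x = 1 := by
  have hyx := grDist_symm_of_edge hxy
  obtain ⟨k, rfl⟩ := pt_surjective y
  obtain ⟨L, rfl, hL⟩ := exists_deg_eq' k p (-1)
  obtain ⟨g, rfl, hg⟩ := exists_deg_eq k x 0
  obtain ⟨l, rfl, hl⟩ := exists_deg_eq k z 0
  refine grDist_eq_one ?_ (by omega)
  rw [← lattice_eq_inf hyz (by omega) h (by omega)]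
  exact le_inf (lattice_le_iff.2 (by omega)) (lattice_le_iff.2 (by omega))

/-- Integrality of a diagonal matrix bounds the distance between two points `t^v` and `t^w`. -/
lemma grDist_tPow_le {v w : Weight} {m : ℤ} (h0 : 0 ≤ m + w.1 + w.2 - v.1 - v.2)
    (h1 : 0 ≤ m + w.2 - v.2) (h2 : 0 ≤ m) :
    grDist (tPow v) (tPow w) ≤ w.1 + 2 * w.2 + 3 * m - (v.1 + 2 * v.2) := by
  rw [tPow_eq, tPow_eq, ← deg_diagGL_tEntries, ← deg_diagGL_tEntries, ← incl_iff_grDist, Incl]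
  have hinv : (diagGL (tEntries v))⁻¹ = diagGL (tEntries v)⁻¹ :=
    inv_eq_of_mul_eq_one_left (by rw [diagGL_mul, inv_mul_cancel, diagGL_one])
  rw [hinv, scalarGL_eq, diagGL_mul, diagGL_mul, isIntegral_diagGL, Fin.forall_fin_succ,
    Fin.forall_fin_two]
  simp only [Pi.mul_apply, Pi.inv_apply, ord_mul, ord_inv, ord_unitT_zpow, Fin.succ_zero_eq_one,
    Fin.succ_one_eq_two, tEntries, Matrix.cons_val, ord_one]
  omega

lemma exists_tPow_sub_eq (v w : Weight) :
    ∃ j, w.1 + 2 * w.2 - (v.1 + 2 * v.2) = grDist (tPow v) (tPow w) + 3 * j := by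
  rw [← deg_diagGL_tEntries, ← deg_diagGL_tEntries]
  exact exists_deg_sub_eq _ _

lemma exists_grDist_pred {p y : Gr} (h : 3 ≤ 2 * grDist y p - grDist p y) :
    ∃ x, grDist x y = 1 ∧ grDist p x + 1 = grDist p y ∧ grDist x p + 2 = grDist y p := by
  obtain ⟨⟨a, b⟩, hv⟩ := exists_grDist p y
  obtain ⟨e1, e2⟩ := hv.grDist_eq
  obtain ⟨⟨ha, hb⟩, c, hp, hy⟩ := hv
  simp only at ha hb e1 e2
  have hx : GrDist p (c⁻¹ • tPow (a - 1, b)) (a - 1, b) :=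
    ⟨⟨by simp only; omega, hb⟩, c, hp, smul_inv_smul _ _⟩
  obtain ⟨f1, f2⟩ := hx.grDist_eq
  refine ⟨c⁻¹ • tPow (a - 1, b), ?_, by omega, by omega⟩
  rw [← grDist_smul c, smul_inv_smul, hy]
  have h1 := grDist_tPow_le (v := (a - 1, b)) (w := (a, b)) (m := 0) (by simp) (by simp) le_rfl
  have h2 := grDist_nonneg (tPow (a - 1, b)) (tPow (a, b))
  obtain ⟨j, h3⟩ := exists_tPow_sub_eq (a - 1, b) (a, b)
  simp only at h1 h3
  omega

lemma exists_grDist_succ {p y : Gr} (h : 3 ≤ 2 * grDist p y - grDist y p) :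
    ∃ z, grDist y z = 1 ∧ grDist p z + 2 = grDist p y ∧ grDist z p + 1 = grDist y p := by
  obtain ⟨⟨a, b⟩, hv⟩ := exists_grDist p y
  obtain ⟨e1, e2⟩ := hv.grDist_eq
  obtain ⟨⟨ha, hb⟩, c, hp, hy⟩ := hv
  simp only at ha hb e1 e2
  have hx : GrDist p (c⁻¹ • tPow (a, b - 1)) (a, b - 1) :=
    ⟨⟨ha, by simp only; omega⟩, c, hp, smul_inv_smul _ _⟩
  obtain ⟨f1, f2⟩ := hx.grDist_eq
  refine ⟨c⁻¹ • tPow (a, b - 1), ?_, by omega, by omega⟩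
  rw [← grDist_smul c, smul_inv_smul, hy]
  have h1 := grDist_tPow_le (v := (a, b)) (w := (a, b - 1)) (m := 1) (by simp only; omega)
    (by simp only; omega) zero_le_one
  have h2 := grDist_nonneg (tPow (a, b)) (tPow (a, b - 1))
  obtain ⟨j, h3⟩ := exists_tPow_sub_eq (a, b) (a, b - 1)
  simp only at h1 h3
  omega

/-- The affine Grassmannian with its asymmetric distance. -/
noncomputable def grSpace : A2Space Gr where
  dist := grDist
  dist_self := grDist_self
  eq_of_dist_eq_zero _ _ := eq_of_grDist_eq_zero
  triangle := grDist_triangle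
  dist_symm_of_edge _ _ := grDist_symm_of_edge
  dist_le_two_mul := grDist_le_two_mul
  pred_unique _ _ _ _ := grDist_pred_unique
  succ_unique _ _ _ _ := grDist_succ_unique
  triangle_of_pred _ _ _ _ := grDist_triangle_of_pred
  triangle_of_succ _ _ _ _ := grDist_triangle_of_succ
  exists_pred _ _ := exists_grDist_pred
  exists_succ _ _ := exists_grDist_succ

/-! ### The planar map of a `CAT(0)` diskoid -/

lemma Weight.IsMinuscule.cases {v : Weight} (h : v.IsMinuscule) : v = (1, 0) ∨ v = (0, 1) := by
  obtain ⟨a, b⟩ := v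
  obtain ⟨⟨h1, h2⟩, h3, h4, h5, h6⟩ := h
  have : ¬ (a = 0 ∧ b = 0) := fun h => h3 (Prod.ext h.1 h.2)
  simp only [Prod.mk.injEq]
  simp only at *
  omega

/-- The integral length `a + 2 b` of a weight `a ω₁ + b ω₂`. -/
def Weight.len₁ : Weight →+ ℤ := AddMonoidHom.fst ℤ ℤ + 2 • AddMonoidHom.snd ℤ ℤ

/-- The integral length `2 a + b` of a weight `a ω₁ + b ω₂`. -/
def Weight.len₂ : Weight →+ ℤ := 2 • AddMonoidHom.fst ℤ ℤ + AddMonoidHom.snd ℤ ℤ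

lemma Weight.len₁_apply (v : Weight) : v.len₁ = v.1 + 2 * v.2 := by
  simp [Weight.len₁]

lemma Weight.len₂_apply (v : Weight) : v.len₂ = 2 * v.1 + v.2 := by
  simp [Weight.len₂]

namespace Diskoid

variable {n : ℕ} (D : Diskoid n)

lemma inner_next {d : D.Dart} (hd : d ∉ Set.range D.bdry) : D.next d ∉ Set.range D.bdry := by
  rintro ⟨k, hk⟩
  refine hd ⟨(finRotate n).symm k, D.next.injective ?_⟩
  rw [D.bdry_next, Equiv.apply_symm_apply, hk]

lemma card_inner [Fintype D.Dart] [DecidablePred (· ∉ Set.range D.bdry)] :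
    (Finset.univ.filter (· ∉ Set.range D.bdry)).card = Fintype.card D.Dart - n ∧
      n ≤ Fintype.card D.Dart := by
  classical
  have h : Finset.univ.filter (· ∉ Set.range D.bdry) = (Finset.univ.image D.bdry)ᶜ := by
    ext d; simp
  rw [h, Finset.card_compl, Finset.card_image_of_injective _ D.bdry_injective, Finset.card_univ,
    Fintype.card_fin]
  have := Fintype.card_le_of_injective D.bdry D.bdry_injective
  rw [Fintype.card_fin] at this
  exact ⟨rfl, this⟩

lemma two_dvd_card [Fintype D.Dart] : 2 ∣ Fintype.card D.Dart := by
  classical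
  have h := Equiv.Perm.card_fixedPoints_modEq (f := (D.rev : Function.End D.Dart)) (p := 2)
    (n := 1) (funext D.rev_rev)
  have h0 : Fintype.card (Function.fixedPoints D.rev) = 0 :=
    Fintype.card_eq_zero_iff.2 ⟨fun x => D.rev_ne x.1 x.2⟩
  rw [h0] at h
  exact (Nat.modEq_zero_iff_dvd).1 h

lemma three_dvd_card [Fintype D.Dart] : 3 ∣ Fintype.card D.Dart - n := by
  classical
  let σ : Function.End {d : D.Dart // d ∉ Set.range D.bdry} :=
    fun d => ⟨D.next d, D.inner_next d.2⟩
  have h := Equiv.Perm.card_fixedPoints_modEq (f := σ) (p := 3) (n := 1)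
    (funext fun d => Subtype.ext (D.triangle d d.2).2)
  have h0 : Fintype.card (Function.fixedPoints σ) = 0 :=
    Fintype.card_eq_zero_iff.2 ⟨fun x => (D.triangle x.1 x.1.2).1 (congrArg Subtype.val x.2)⟩
  rw [h0, Fintype.card_subtype, D.card_inner.1] at h
  exact (Nat.modEq_zero_iff_dvd).1 h

/-- The Euler characteristic is `1`: the formula cleared of denominators. -/
lemma six_mul_card [Fintype D.Dart] [Fintype D.V] :
    6 * Fintype.card D.V + 2 * (Fintype.card D.Dart - n) = 3 * Fintype.card D.Dart + 6 := by
  have h := D.euler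
  rw [Nat.card_eq_fintype_card, Nat.card_eq_fintype_card] at h
  have h2 := D.two_dvd_card
  have h3 := D.three_dvd_card
  omega

lemma six_le_ncard {D : Diskoid n} (hD : D.IsCAT0) {v : D.V} (hv : v ∉ Set.range D.bdryVertex)
    (hin : ∀ d, D.src d = v → d ∉ Set.range D.bdry) : 6 ≤ {d | D.src d = v}.ncard := by
  have h := hD v hv
  have hc : Nat.card {d : D.Dart // d ∉ Set.range D.bdry ∧ D.src d = v} =
      {d | D.src d = v}.ncard := by
    rw [← Nat.card_coe_set_eq]
    exact Nat.card_congr (Equiv.subtypeEquivRight fun d => ⟨fun h => h.2, fun h => ⟨hin d h, h⟩⟩)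
  rw [totalAngle, hc] at h
  have h6 : (6 : ℝ) ≤ ({d | D.src d = v}.ncard : ℝ) := by
    have := Real.pi_pos
    nlinarith
  exact_mod_cast h6

lemma bdryVertex_castSucc (k : Fin n) : D.bdryVertex k.castSucc = D.src (D.bdry k) :=
  dif_pos k.2

lemma bdryVertex_last : D.bdryVertex (Fin.last n) = D.base := dif_neg (lt_irrefl n)

/-- A `CAT(0)` diskoid with an empty boundary is a point: otherwise it would be a sphere with
at most one vertex of positive curvature, in contradiction with Gauss–Bonnet. -/
lemma src_ne_base_of_eq_zero {D : Diskoid n} (hD : D.IsCAT0) (hn : n = 0) (d : D.Dart) :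
    D.src d ≠ D.base := by
  classical
  subst hn
  have := D.finite_vertices
  have := D.finite_darts
  cases nonempty_fintype D.V
  cases nonempty_fintype D.Dart
  intro hd
  have hsum : Fintype.card D.Dart =
      ∑ v : D.V, (Finset.univ.filter fun d => D.src d = v).card := by
    rw [← Finset.card_univ]
    exact Finset.card_eq_sum_card_fiberwise (f := D.src) fun _ _ => Finset.mem_univ _
  rw [← Finset.add_sum_erase _ _ (Finset.mem_univ D.base)] at hsum
  have h6 : ∀ v ∈ Finset.univ.erase D.base, 6 ≤ (Finset.univ.filter fun d => D.src d = v).card := by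
    intro v hv
    have h := six_le_ncard hD (v := v) (by
      rintro ⟨k, rfl⟩
      rw [show k = Fin.last 0 from Subsingleton.elim (α := Fin 1) _ _, bdryVertex_last] at hv
      exact (Finset.mem_erase.1 hv).1 rfl) (by rintro _ _ ⟨k, -⟩; exact k.elim0)
    rwa [Set.ncard_eq_toFinset_card', Set.toFinset_ofPred] at h
  have h7 := Finset.card_nsmul_le_sum _ _ _ h6
  rw [Finset.card_erase_of_mem (Finset.mem_univ _), Finset.card_univ, smul_eq_mul] at h7
  have h8 : 0 < (Finset.univ.filter fun d => D.src d = D.base).card :=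
    Finset.card_pos.2 ⟨d, by simpa using hd⟩
  have h9 := D.six_mul_card
  have h10 : 0 < Fintype.card D.V := Fintype.card_pos_iff.2 ⟨D.base⟩
  omega

/-- The planar map of a `CAT(0)` diskoid. -/
def triMap (hD : D.IsCAT0) : TriMap D.V D.Dart where
  src := D.src
  rev := D.rev
  next := D.next
  inner d := d ∉ Set.range D.bdry
  cost d := 1 + (D.label d).1
  rev_rev := D.rev_rev
  next_injective := D.next.injective
  src_next := D.src_next
  rotation := D.rotation
  inner_next _ := D.inner_next
  next_next_next d hd := (D.triangle d hd).2
  next_ne d hd := (D.triangle d hd).1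
  cost_cases d := by rcases (D.label_minuscule d).cases with h | h <;> simp [h]
  cost_rev d := by
    rw [D.label_rev]
    rcases (D.label_minuscule d).cases with h | h <;> simp [h, Weight.dual]
  cost_next d hd := by rw [D.label_triangle d hd]
  six_le := by
    rintro v ⟨d, hd⟩ hin
    refine six_le_ncard hD ?_ hin
    rintro ⟨k, rfl⟩
    induction k using Fin.lastCases with
    | cast k => exact hin _ (D.bdryVertex_castSucc k).symm ⟨k, rfl⟩
    | last =>
      rw [bdryVertex_last] at hd hin
      rcases Nat.eq_zero_or_pos n with hn | hn
      · exact src_ne_base_of_eq_zero hD hn d hd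
      · exact hin _ (D.bdry_base ⟨0, hn⟩ rfl) ⟨_, rfl⟩

lemma sum_curv_triMap [Fintype D.V] [Fintype D.Dart] (hD : D.IsCAT0) :
    ∑ v, (D.triMap hD).curv Finset.univ v = 6 := by
  classical
  rw [TriMap.sum_curv]
  have h1 : Finset.univ.filter ((D.triMap hD).Alive Finset.univ) = Finset.univ := by
    ext d; simp [TriMap.Alive]
  have h2 : Finset.univ.filter ((D.triMap hD).InnerIn Finset.univ) =
      Finset.univ.filter (· ∉ Set.range D.bdry) := by
    ext d; simp [TriMap.InnerIn, triMap]
  rw [h1, h2, D.card_inner.1, Finset.card_univ, Finset.card_univ]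
  have h3 := D.six_mul_card
  omega

/-! ### Heights on a diskoid -/

variable {D}

lemma pathLength_snoc {v : D.linkage.V} {d : D.Dart} {w : Weight}
    (h : D.linkage.PathLength v (D.src d) w) :
    D.linkage.PathLength v (D.src (D.rev d)) (w + D.label d) := by
  generalize hq : D.src d = q at h
  induction h with
  | refl p =>
    rw [zero_add, ← add_zero (D.label d)]
    exact .forward ⟨d, hq, rfl, rfl⟩ (.refl _)
  | forward he _ ih => rw [add_assoc]; exact .forward he (ih hq)
  | backward he _ ih => rw [add_assoc]; exact .backward he (ih hq)

/-- A path is constant or has a last step. -/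
lemma pathLength_cases {v q : D.linkage.V} {w : Weight} (h : D.linkage.PathLength v q w) :
    (v = q ∧ w = 0) ∨ ∃ d w', D.src d = q ∧ D.linkage.PathLength v (D.src (D.rev d)) w' ∧
      w = w' + D.label (D.rev d) := by
  induction h with
  | refl p => exact .inl ⟨rfl, rfl⟩
  | forward he hp ih =>
    right
    rcases ih with ⟨rfl, rfl⟩ | ⟨d, w', hd, hp', rfl⟩
    · obtain ⟨d, hd, hd', rfl⟩ := he
      refine ⟨D.rev d, 0, hd', ?_, ?_⟩
      · rw [D.rev_rev, hd]; exact .refl _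
      · rw [D.rev_rev, add_comm]
    · exact ⟨d, _, hd, .forward he hp', (add_assoc _ _ _).symm⟩
  | backward he hp ih =>
    right
    rcases ih with ⟨rfl, rfl⟩ | ⟨d, w', hd, hp', rfl⟩
    · obtain ⟨d, hd, hd', rfl⟩ := he
      refine ⟨d, 0, hd, ?_, ?_⟩
      · rw [hd']; exact .refl _
      · rw [D.label_rev, add_comm]
    · exact ⟨d, _, hd, .backward he hp', (add_assoc _ _ _).symm⟩

lemma exists_pathLength (v : D.V) : ∃ w, D.linkage.PathLength D.base v w := by
  have h := D.connected D.base v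
  induction h with
  | refl => exact ⟨0, .refl _⟩
  | tail _ hd ih =>
    obtain ⟨d, rfl, rfl⟩ := hd
    obtain ⟨w, hw⟩ := ih
    exact ⟨_, pathLength_snoc hw⟩

variable (D) in
/-- The minimum of the integral length `len` on the edge paths from the base vertex to `v`. (Lengths
of paths are non-negative for the functions `len` in use, so that nothing is lost by the truncation
to natural numbers.) -/
noncomputable def height (len : Weight →+ ℤ) (v : D.V) : ℤ :=
  (sInf {m : ℕ | ∃ w, D.linkage.PathLength D.base v w ∧ (len w).toNat = m} : ℕ)

lemma len_nonneg {len : Weight →+ ℤ} (hlen : ∀ d, 0 < len (D.label d))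
    {p q : D.linkage.V} {w : Weight} (h : D.linkage.PathLength p q w) : 0 ≤ len w := by
  induction h with
  | refl p => rw [map_zero]
  | forward he _ ih =>
    obtain ⟨d, -, -, rfl⟩ := he
    rw [map_add]
    have := hlen d
    omega
  | backward he _ ih =>
    obtain ⟨d, -, -, rfl⟩ := he
    rw [map_add, ← D.label_rev]
    have := hlen (D.rev d)
    omega

lemma height_le {len : Weight →+ ℤ} (hlen : ∀ d, 0 < len (D.label d)) {v : D.V} {w : Weight}
    (h : D.linkage.PathLength D.base v w) : D.height len v ≤ len w := by
  rw [← Int.toNat_of_nonneg (len_nonneg hlen h)]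
  exact Int.ofNat_le.2 (Nat.sInf_le ⟨w, h, rfl⟩)

lemma exists_height_eq {len : Weight →+ ℤ} (hlen : ∀ d, 0 < len (D.label d)) (v : D.V) :
    ∃ w, D.linkage.PathLength D.base v w ∧ D.height len v = len w := by
  obtain ⟨w, hw⟩ := D.exists_pathLength v
  obtain ⟨w', hw', h⟩ := Nat.sInf_mem
    (s := {m : ℕ | ∃ w, D.linkage.PathLength D.base v w ∧ (len w).toNat = m}) ⟨_, w, hw, rfl⟩
  refine ⟨w', hw', ?_⟩
  rw [height, ← h, Int.toNat_of_nonneg (len_nonneg hlen hw')]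

lemma height_base {len : Weight →+ ℤ} (hlen : ∀ d, 0 < len (D.label d)) :
    D.height len D.base = 0 := by
  have h1 := height_le hlen (v := D.base) (.refl (Γ := D.linkage) D.base)
  obtain ⟨w, hw, h2⟩ := exists_height_eq hlen D.base
  have h3 := len_nonneg hlen hw
  rw [map_zero] at h1
  omega

lemma height_src_le {len : Weight →+ ℤ} (hlen : ∀ d, 0 < len (D.label d)) (d : D.Dart) :
    D.height len (D.src d) ≤ D.height len (D.src (D.rev d)) + len (D.label (D.rev d)) := by
  obtain ⟨w, hw, h⟩ := exists_height_eq hlen (D.src (D.rev d))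
  have := height_le hlen (pathLength_snoc hw)
  rwa [D.rev_rev, map_add, ← h] at this

lemma exists_height_parent {len : Weight →+ ℤ} (hlen : ∀ d, 0 < len (D.label d)) {v : D.V}
    (hv : v ≠ D.base) : ∃ d, D.src d = v ∧
      D.height len v = D.height len (D.src (D.rev d)) + len (D.label (D.rev d)) := by
  obtain ⟨w, hw, h⟩ := exists_height_eq hlen v
  rcases pathLength_cases hw with ⟨h1, -⟩ | ⟨d, w', rfl, hw', rfl⟩
  · exact absurd h1.symm hv
  · refine ⟨d, rfl, ?_⟩
    have h1 := height_src_le hlen d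
    have h2 := height_le hlen hw'
    rw [map_add] at h
    omega

/-- Where the minimum of the weight-valued lengths exists, it minimizes the integral lengths too. -/
lemma height_eq_of_dist {len : Weight →+ ℤ} (hlen : ∀ d, 0 < len (D.label d))
    (h1 : 0 ≤ len Weight.simpleRoot₁) (h2 : 0 ≤ len Weight.simpleRoot₂) {v : D.V} {u : Weight}
    (h : D.linkage.Dist D.base v u) : D.height len v = len u := by
  refine le_antisymm (height_le hlen h.1) ?_
  obtain ⟨w, hw, hh⟩ := exists_height_eq hlen v
  obtain ⟨k, l, hkl⟩ := h.2 w hw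
  have := congrArg len hkl
  rw [map_sub, map_add, map_nsmul, map_nsmul, nsmul_eq_mul, nsmul_eq_mul] at this
  have h3 : 0 ≤ (k : ℤ) * len Weight.simpleRoot₁ := by positivity
  have h4 : 0 ≤ (l : ℤ) * len Weight.simpleRoot₂ := by positivity
  omega

lemma len₁_label_pos (d : D.Dart) : 0 < (D.label d).len₁ := by
  rw [Weight.len₁_apply]
  rcases (D.label_minuscule d).cases with h | h <;> simp [h]

lemma len₂_label_pos (d : D.Dart) : 0 < (D.label d).len₂ := by
  rw [Weight.len₂_apply]
  rcases (D.label_minuscule d).cases with h | h <;> simp [h]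

lemma isRooted_triMap [Fintype D.V] [Fintype D.Dart] (hD : D.IsCAT0) :
    (D.triMap hD).IsRooted (D.height Weight.len₁) Finset.univ D.base where
  mem := Finset.mem_univ _
  sum := D.sum_curv_triMap hD
  le d _ := by
    refine (height_src_le len₁_label_pos d).trans_eq (congrArg _ ?_)
    rw [Weight.len₁_apply, D.label_rev, triMap]
    rcases (D.label_minuscule d).cases with h | h <;> simp [h, Weight.dual]
  parent v _ hv := by
    obtain ⟨d, rfl, h⟩ := exists_height_parent len₁_label_pos hv
    refine ⟨d, TriMap.mem_darts _ |>.2 ⟨⟨Finset.mem_univ _, Finset.mem_univ _⟩, rfl⟩,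
      h.trans (congrArg _ ?_)⟩
    rw [Weight.len₁_apply, D.label_rev, triMap]
    rcases (D.label_minuscule d).cases with h | h <;> simp [h, Weight.dual]

lemma isRooted_dual_triMap [Fintype D.V] [Fintype D.Dart] (hD : D.IsCAT0) :
    (D.triMap hD).dual.IsRooted (D.height Weight.len₂) Finset.univ D.base where
  mem := Finset.mem_univ _
  sum := D.sum_curv_triMap hD
  le d _ := by
    refine (height_src_le len₂_label_pos d).trans_eq (congrArg _ ?_)
    rw [Weight.len₂_apply, D.label_rev, TriMap.dual_cost, triMap]
    rcases (D.label_minuscule d).cases with h | h <;> simp [h, Weight.dual]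
  parent v _ hv := by
    obtain ⟨d, rfl, h⟩ := exists_height_parent len₂_label_pos hv
    refine ⟨d, TriMap.mem_darts _ |>.2 ⟨⟨Finset.mem_univ _, Finset.mem_univ _⟩, rfl⟩,
      h.trans (congrArg _ ?_)⟩
    rw [Weight.len₂_apply, D.label_rev, TriMap.dual_cost, triMap]
    rcases (D.label_minuscule d).cases with h | h <;> simp [h, Weight.dual]

/-! ### Fan configurations and diskoid configurations -/

lemma rel_iff_grDist {v : Weight} (hv : v.IsMinuscule) {x y : Gr} :
    grSpace.Rel (1 + v.1) x y ↔ GrDist x y v := by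
  rcases hv.cases with rfl | rfl
  · exact grSpace.rel_two.trans ⟨fun h => .of_grDist_eq h (grDist_symm_of_edge h),
      fun h => h.grDist_eq.1⟩
  · exact grSpace.rel_one.trans ⟨fun h => .of_grDist_eq (grDist_symm_of_edge h) h,
      fun h => h.grDist_eq.2⟩

lemma isConfig_iff [Fintype D.V] (hD : D.IsCAT0) {g : D.V → Gr} :
    (D.triMap hD).IsConfig grSpace (tPow 0) Finset.univ D.base g ↔ g ∈ D.linkage.configSpace := by
  constructor
  · rintro ⟨h1, h2⟩
    refine ⟨h1, ?_⟩
    rintro _ _ _ ⟨d, rfl, rfl, rfl⟩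
    exact (rel_iff_grDist (D.label_minuscule d)).1
      (h2 d ⟨Finset.mem_univ _, Finset.mem_univ _⟩)
  · rintro ⟨h1, h2⟩
    exact ⟨h1, fun d _ => (rel_iff_grDist (D.label_minuscule d)).2
      (h2 _ _ _ ⟨d, rfl, rfl, rfl⟩)⟩

lemma outer_iff [Fintype D.V] (hD : D.IsCAT0) {d : D.Dart} :
    (D.triMap hD).Outer Finset.univ d ↔ ∃ k, D.bdry k = d := by
  simp [TriMap.Outer, TriMap.Alive, TriMap.InnerIn, triMap]

end Diskoid

lemma polygonVertex_mk_last (n : ℕ) :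
    PolygonVertex.mk (Fin.last n) = PolygonVertex.mk 0 := (Quot.sound ⟨rfl, rfl⟩).symm

lemma polygonVertex_mk_finRotate {n : ℕ} (k : Fin n) :
    PolygonVertex.mk (finRotate n k).castSucc = PolygonVertex.mk k.succ := by
  cases n with
  | zero => exact k.elim0
  | succ n =>
    induction k using Fin.lastCases with
    | last => rw [finRotate_last, Fin.succ_last, polygonVertex_mk_last]; rfl
    | cast k =>
      congr 1
      ext
      rw [Fin.val_castSucc, coe_finRotate_of_ne_last (Fin.castSucc_lt_last k).ne]
      rfl

lemma grDist_zero (x : Gr) : GrDist x x 0 :=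
  .of_grDist_eq (grDist_self x) (grDist_self x)

/-- In a fan configuration the ribs give the distances from the base point, the two degenerate ribs
included. -/
lemma fan_grDist {n : ℕ} {lam : Fin n → Weight} {mu : Fin (n + 1) → Weight}
    (hmu : IsMinusculePath lam mu) {f : PolygonVertex n → Gr} (hf : f ∈ (fan lam mu).configSpace)
    (k : Fin (n + 1)) : GrDist (tPow 0) (f (.mk k)) (mu k) := by
  have h0 : f (.mk 0) = tPow 0 := hf.1
  by_cases hk : k = 0
  · rw [hk, hmu.start, h0]
    exact grDist_zero _
  by_cases hk' : k = Fin.last n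
  · rw [hk', hmu.finish, polygonVertex_mk_last, h0]
    exact grDist_zero _
  rw [← h0]
  exact hf.2 _ _ _ (.rib k hk hk')

/-- A fan configuration, transported to the boundary darts of the diskoid. -/
lemma isBoundaryConfig_of_fan {n : ℕ} {lam : Fin n → Weight} {mu : Fin (n + 1) → Weight}
    (hmu : IsMinusculePath lam mu) {D : Diskoid n} [Fintype D.V] (hD : IsDiskoidOf lam mu D)
    {f : PolygonVertex n → Gr} (hf : f ∈ (fan lam mu).configSpace) :
    (D.triMap hD.cat0).IsBoundaryConfig grSpace (tPow 0) (D.height Weight.len₁)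
      (D.height Weight.len₂) Finset.univ
      (Function.extend D.bdry (fun k => f (.mk k.castSucc)) fun _ => tPow 0) where
  edge d hd := by
    obtain ⟨k, rfl⟩ := (Diskoid.outer_iff hD.cat0).1 hd
    have hn : (D.triMap hD.cat0).nextIn Finset.univ (D.bdry k) = D.bdry (finRotate n k) := by
      rw [TriMap.nextIn_eq_next ⟨Finset.mem_univ _, Finset.mem_univ _⟩]
      exact D.bdry_next k
    rw [hn, D.bdry_injective.extend_apply, D.bdry_injective.extend_apply,
      polygonVertex_mk_finRotate]
    refine (Diskoid.rel_iff_grDist (D.label_minuscule _)).2 ?_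
    rw [hD.boundary]
    exact hf.2 _ _ _ (.side k)
  dist_left d hd := by
    obtain ⟨k, rfl⟩ := (Diskoid.outer_iff hD.cat0).1 hd
    rw [D.bdry_injective.extend_apply]
    have h := Diskoid.height_eq_of_dist Diskoid.len₁_label_pos (by decide) (by decide)
      (hD.distances k.castSucc)
    rw [D.bdryVertex_castSucc, Weight.len₁_apply] at h
    exact (fan_grDist hmu hf _).grDist_eq.1.trans h.symm
  dist_right d hd := by
    obtain ⟨k, rfl⟩ := (Diskoid.outer_iff hD.cat0).1 hd
    rw [D.bdry_injective.extend_apply]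
    have h := Diskoid.height_eq_of_dist Diskoid.len₂_label_pos (by decide) (by decide)
      (hD.distances k.castSucc)
    rw [D.bdryVertex_castSucc, Weight.len₂_apply] at h
    exact (fan_grDist hmu hf _).grDist_eq.2.trans h.symm

lemma fills_iff {n : ℕ} {D : Diskoid n} [Fintype D.V] (hD : D.IsCAT0) {f : PolygonVertex n → Gr}
    (hf : f (.mk 0) = tPow 0) {g : D.V → Gr} (hg : g D.base = tPow 0) :
    (D.triMap hD).Fills Finset.univ
      (Function.extend D.bdry (fun k => f (.mk k.castSucc)) fun _ => tPow 0) g ↔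
    ∀ k : Fin (n + 1), g (D.bdryVertex k) = f (.mk k) := by
  constructor
  · intro h k
    induction k using Fin.lastCases with
    | last => rw [D.bdryVertex_last, polygonVertex_mk_last, hf, hg]
    | cast k =>
      have := h (D.bdry k) ((Diskoid.outer_iff hD).2 ⟨k, rfl⟩)
      rw [D.bdry_injective.extend_apply] at this
      rw [D.bdryVertex_castSucc]
      exact this
  · intro h d hd
    obtain ⟨k, rfl⟩ := (Diskoid.outer_iff hD).1 hd
    rw [D.bdry_injective.extend_apply, ← h, D.bdryVertex_castSucc]
    rfl

end SL3

theorem mainTheorem7 {n : ℕ} (lam : Fin n → SL3.Weight) (hlam : ∀ k, (lam k).IsMinuscule)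
    (mu : Fin (n + 1) → SL3.Weight) (hmu : SL3.IsMinusculePath lam mu)
    (D : SL3.Diskoid n) (hD : SL3.IsDiskoidOf lam mu D)
    (f : SL3.PolygonVertex n → SL3.Gr) (hf : f ∈ (SL3.fan lam mu).configSpace) :
    ∃! g : D.V → SL3.Gr, g ∈ D.linkage.configSpace ∧
      ∀ k : Fin (n + 1), g (D.bdryVertex k) = f (SL3.PolygonVertex.mk k) := by
  classical
  have := D.finite_vertices
  have := D.finite_darts
  cases nonempty_fintype D.V
  cases nonempty_fintype D.Dart
  obtain ⟨⟨g, hg, hg'⟩, huniq⟩ := SL3.TriMap.exists_unique_config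
    (SL3.Diskoid.isRooted_triMap hD.cat0) (SL3.Diskoid.isRooted_dual_triMap hD.cat0)
    (SL3.Diskoid.height_base SL3.Diskoid.len₁_label_pos)
    (SL3.Diskoid.height_base SL3.Diskoid.len₂_label_pos)
    (SL3.isBoundaryConfig_of_fan hmu hD hf)
  refine ⟨g, ⟨(SL3.Diskoid.isConfig_iff hD.cat0).1 hg, (SL3.fills_iff hD.cat0 hf.1 hg.1).1 hg'⟩, ?_⟩
  rintro g₂ ⟨h1, h2⟩
  funext v
  exact huniq g₂ g ((SL3.Diskoid.isConfig_iff hD.cat0).2 h1)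
    ((SL3.fills_iff hD.cat0 hf.1 h1.1).2 h2) hg hg' v (Finset.mem_univ v)
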